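/- **Conventions.** Polygons lie in the plane $\mathbb C$; a convex polygon is nondegenerate and strictly convex, and its vertices and edges are listed counterclockwise. For a convex polygon $P$ with edge vectors $z_1,\dots,z_n$, the shape space $C_P$ is the set of convex polygons with edge vectors $r_1z_1,\dots,r_nz_n$ (in this counterclockwise order), where the reals $r_i$ are all positive or all negative; the position in the plane is irrelevant. A *tiling* of a convex polygon $R$ is a finite family of convex polygons with pairwise disjoint interiors whose union is $R$; tiles need not meet edge-to-edge. It is *nondegenerate* if every vertex of a tile lies in the relative interior of an edge of some tile or of an edge of $R$, or is a corner of $R$ that belongs to no other tile. The *bipartite graph* of the tiling has a white vertex for each tile $t_w$ and a black vertex for each maximal line segment $b$ contained in the union of the tile boundaries, with $w\sim b$ if $t_w$ has an edge in $b$. The edges of $R$ are black vertices, called *boundary* segments; the other segments $b$ are *interior*. Let $T=(t_w)_w$ be a nondegenerate tiling of $R$. Let $R'\in C_R$, and let $S=(s_w)_w$ be a family of polygons covering $R'$ exactly, with pairwise disjoint interiors, where $s_w$ is either a point or a convex polygon whose edges correspond, in order, to parallel edges of $t_w$ (if $s_w$ is a point, all its edges are that point). Then $S$ is *combinatorially equivalent*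 to $T$ if one can assign to each black vertex $b$ of $T$ a segment $\sigma_b$ (possibly a single point) such that 1. if an edge of $t_w$ lies in $b$, then the corresponding edge of $s_w$ lies in $\sigma_b$; 2. if $b$ is an edge of $R$, then $\sigma_b$ is the corresponding edge of $R'$, and it is covered by the edges of tiles $s_w$ that correspond to edges of tiles $t_w$ lying in $b$; 3. if $b$ is interior, each of the two sides of $\sigma_b$ is covered by edges of tiles $s_w$ on that side that correspond to edges of tiles $t_w$ lying in $b$; 4. if all $s_w$ are convex polygons and $S$ is itself nondegenerate, then $b\mapsto\sigma_b$ is a bijection onto the black vertices of $S$ with $t_w\sim b\iff s_w\sim\sigma_b$, that is, an isomorphism of the bipartite graphs. (In 3, an edge that is a point counts as lying on both sides of $\sigma_b$, and if $\sigma_b$ is a point, every edge equal to that point counts as lying on both sides.) **Theorem.** Let $T=(t_w)_w$ be a nondegenerate tiling of a convex polygon $R$, and for each $w$ let $t'_w\in C_{t_w}$ be a convex polygon. Then there are a convex polygon $R'\in C_R$, real numbers $a_w$ (each of which may be positive, zero or negative), and a tiling $S=(s_w)_w$ of $R'$ (in which tiles with $a_w=0$ are points), combinatorially equivalent to $T$,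 such that each $s_w$ is a translate of $a_wt'_w$. Moreover, $S$ can be taken such that corners of tiles that coincide in $T$ coincide in $S$. This tiling is unique up to homothety: if $R_1$, $(a_{1,w})$, $S_1=(s_{1,w})$ is any other solution (for the same $t'_w$, with $R_1\in C_R$, $S_1$ combinatorially equivalent to $T$, and $s_{1,w}$ a translate of $a_{1,w}t'_w$), then there are a real $\lambda\neq0$ and $v\in\mathbb C$ with $R_1=\lambda R'+v$, $a_{1,w}=\lambda a_w$ and $s_{1,w}=\lambda s_w+v$ for all $w$ (vertex by vertex). -/

import Mathlib

namespace PolygonTiling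

/-- The planar cross product: positive when `v` points to the left of `u`. -/
def cross (u v : ℂ) : ℝ := u.re * v.im - u.im * v.re

/-- The `i`-th edge vector of the closed polygon with cyclically ordered vertices `P`
(the index is cyclic: the last vertex is followed by the first one). -/
def edgeVec {n : ℕ} (P : Fin (n + 3) → ℂ) (i : Fin (n + 3)) : ℂ := P (i + 1) - P i

/-- The `i`-th edge, as a closed segment. It is a point if the two vertices coincide. -/
def edge {n : ℕ} (P : Fin (n + 3) → ℂ) (i : Fin (n + 3)) : Set ℂ := segment ℝ (P i) (P (i + 1))

/-- The closed region bounded by a convex polygon with vertices `P`. -/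
def region {n : ℕ} (P : Fin (n + 3) → ℂ) : Set ℂ := convexHull ℝ (Set.range P)

/-- `P` lists in counterclockwise order the vertices of a (nondegenerate, strictly) convex polygon:
every vertex that is not an endpoint of an edge lies strictly to the left of that edge. -/
def IsConvexPolygon {n : ℕ} (P : Fin (n + 3) → ℂ) : Prop :=
  ∀ i j : Fin (n + 3), j ≠ i → j ≠ i + 1 → 0 < cross (edgeVec P i) (P j - P i)

/-- `P'` belongs to the shape space `C_P`: it is a convex polygon whose edges, in the same
counterclockwise order, are real multiples of the edges of `P`, the factors being all positive or
all negative. (The position of `P'` is irrelevant here.) -/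
def InShapeSpace {n : ℕ} (P P' : Fin (n + 3) → ℂ) : Prop :=
  IsConvexPolygon P' ∧
    ∃ r : Fin (n + 3) → ℝ, ((∀ i, 0 < r i) ∨ (∀ i, r i < 0)) ∧
      ∀ i, edgeVec P' i = (r i : ℂ) * edgeVec P i

section Tilings

variable {W : Type*} {m : W → ℕ} {k : ℕ}

/-- The regions of the polygons `t w` cover exactly the region of `R` and have pairwise disjoint
interiors. Polygons that have shrunk to a point are allowed. -/
def IsTiling (R : Fin (k + 3) → ℂ) (t : ∀ w, Fin (m w + 3) → ℂ) : Prop :=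
  (⋃ w, region (t w)) = region R ∧
    ∀ w w', w ≠ w' → Disjoint (interior (region (t w))) (interior (region (t w')))

/-- Every vertex of a tile is at a `T` (it lies in the relative interior of an edge of a tile or
of an edge of `R`), except that a vertex of a tile may be a corner of `R`, and then it belongs to
no other tile. -/
def IsNondegenerate (R : Fin (k + 3) → ℂ) (t : ∀ w, Fin (m w + 3) → ℂ) : Prop :=
  ∀ w i,
    (∃ w' j, t w i ∈ openSegment ℝ (t w' j) (t w' (j + 1))) ∨
    (∃ j, t w i ∈ openSegment ℝ (R j) (R (j + 1))) ∨
    ((∃ j, t w i = R j) ∧ ∀ w', t w i ∈ region (t w') → w' = w)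

/-- The black vertices of the bipartite graph of a tiling: the maximal line segments in the union
of the boundaries of the tiles. (The white vertices are the tiles.) -/
def maximalSegments (t : ∀ w, Fin (m w + 3) → ℂ) : Set (Set ℂ) :=
  {b | Maximal (fun b : Set ℂ =>
    (∃ x y : ℂ, x ≠ y ∧ b = segment ℝ x y) ∧ b ⊆ ⋃ w, ⋃ i, edge (t w) i) b}

/-- Adjacency in the bipartite graph of a tiling: the tile `w` has an edge in the segment `b`. -/
def Adjacent (t : ∀ w, Fin (m w + 3) → ℂ) (w : W) (b : Set ℂ) : Prop :=
  ∃ i, edge (t w) i ⊆ b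

/-- The (possibly degenerate) tiling `s` of `R'` has the combinatorics of the nondegenerate tiling
`t` of `R`, with `s w` corresponding to `t w`: to each maximal segment `b` of `t` there corresponds
a segment `σ b` of `s` (possibly shrunk to a point) that plays the same role. -/
def CombinatoriallyEquivalent (R : Fin (k + 3) → ℂ) (t : ∀ w, Fin (m w + 3) → ℂ)
    (R' : Fin (k + 3) → ℂ) (s : ∀ w, Fin (m w + 3) → ℂ) : Prop :=
  ∃ σ : Set ℂ → Set ℂ,
    -- an edge of a tile lying in `b` corresponds to an edge lying in `σ b`
    (∀ b ∈ maximalSegments t, ∀ w i, edge (t w) i ⊆ b → edge (s w) i ⊆ σ b) ∧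
    -- the boundary segments are fixed: the `j`-th edge of `R` corresponds to the `j`-th edge of
    -- `R'`, and the latter is covered by the tiles adjacent to it
    (∀ j, σ (edge R j) = edge R' j ∧
      ∀ p ∈ edge R' j, ∃ w i, edge (t w) i ⊆ edge R j ∧ p ∈ edge (s w) i) ∧
    -- each of the two sides of an interior segment is covered by edges of tiles adjacent to it;
    -- tiles are on the left of their edges, so the direction of the edge tells the side
    (∀ b ∈ maximalSegments t, (∀ j, b ≠ edge R j) → ∃ x y : ℂ, σ b = segment ℝ x y ∧
      ∀ p ∈ segment ℝ x y,
        (∃ w i, edge (t w) i ⊆ b ∧ SameRay ℝ (y - x) (edgeVec (s w) i) ∧ p ∈ edge (s w) i) ∧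
        (∃ w i, edge (t w) i ⊆ b ∧ SameRay ℝ (x - y) (edgeVec (s w) i) ∧ p ∈ edge (s w) i)) ∧
    -- if `s` is nondegenerate as well, then `σ` is an isomorphism of the bipartite graphs
    ((∀ w, IsConvexPolygon (s w)) → IsNondegenerate R' s →
      Set.BijOn σ (maximalSegments t) (maximalSegments s) ∧
      ∀ w, ∀ b ∈ maximalSegments t, Adjacent t w b ↔ Adjacent s w (σ b))

/-- `s` is a tiling of a convex polygon `R'` in the shape space of `R`, combinatorially equivalent
to the tiling `t` of `R`, whose tiles are the homothetic copies `a w • t' w + c w` of the `t' w`. -/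
def IsHomotheticTiling (R : Fin (k + 3) → ℂ) (t t' : ∀ w, Fin (m w + 3) → ℂ)
    (R' : Fin (k + 3) → ℂ) (a : W → ℝ) (s : ∀ w, Fin (m w + 3) → ℂ) : Prop :=
  InShapeSpace R R' ∧
    (∀ w, ∃ c : ℂ, ∀ i, s w i = (a w : ℂ) * t' w i + c) ∧
    IsTiling R' s ∧
    CombinatoriallyEquivalent R t R' s

end Tilings

end PolygonTiling

namespace PolygonTiling

open Finset Filter Topology
open scoped Classical

/-! ### The cross product -/

/-! The unknown tiling is encoded linearly, by a map `f` of the vertices of the old tiling and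
factors `a w` such that `f` multiplies the edge vectors of `t' w` by `a w` (`IsSolution`). The
solutions with `a = 0` are the translations, which form a plane. One more dimension is needed, and
every solution outside this plane must be shown to be a genuine tiling.

The geometric tool is a count. A corner sees a point `x` if `x` lies in its cone or in the opposite
cone. A homothetic copy of a convex polygon with `n + 3` sides, possibly reversed or shrunk to a
point, has `n + 1` corners that see a generic `x`, and two more if `x` is inside (`card_sees`). On
the other hand, nondegeneracy makes the corners at a vertex that is not a corner of `R` fill a
half-plane, so exactly one of them sees `x`, wherever `f` puts the vertex (`card_cornerSees_add`).
Equating the two counts gives Euler's formula for the identity map (`card_verts`) and the index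
formula for any solution (`IsSolution.index`): twice the number of tiles around `x` plus the number
of corners of the image of `R` that do not see `x` is 2. Hence the image tiles do not overlap and
fill the image of `R`, provided that the latter has the right shape. It does, because no edge of `R`
can shrink to a point unless all factors vanish (`not_shrunk`).

So a solution is determined by the image of one edge of `R`, and the dimension is at most 3
(`finrank_ker_le`). Let V, C, W, I be the numbers of vertices, corners, tiles and interior segments.
There are 2V + W real unknowns and 2C equations with 2W + I independent relations: the edges of a
tile add up to zero, and the chain of edges along an interior segment has no boundary. With Euler's
formula the dimension is at least I + 4 - W (`le_finrank_ker`). For `t' = t` this yields I ≤ W - 1,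
while an injection of the corners yields I ≥ W - 1 (`card_corner_le`). Thus I = W - 1, and the
dimension is at least 3 for every `t'`. This gives existence, and proportionality of the solutions.

For uniqueness, a combinatorially equivalent tiling is not assumed to keep coinciding corners
together. The covering conditions put the edges of each segment on one line (`exists_line`), so at
least one corner of each vertex group still sees `x`; the count leaves room for only one; and two
neighbouring corners torn apart would see a common point (`pt_eq_of_matched`). Hence every such
tiling is a solution. -/

theorem cross_add_right (u v w : ℂ) : cross u (v + w) = cross u v + cross u w := by
  simp only [cross, Complex.add_re, Complex.add_im]; ring

theorem cross_sub_left (u v w : ℂ) : cross (u - v) w = cross u w - cross v w := by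
  simp only [cross, Complex.sub_re, Complex.sub_im]; ring

theorem cross_sub_right (u v w : ℂ) : cross u (v - w) = cross u v - cross u w := by
  simp only [cross, Complex.sub_re, Complex.sub_im]; ring

theorem cross_neg_left (u v : ℂ) : cross (-u) v = -cross u v := by
  simp only [cross, Complex.neg_re, Complex.neg_im]; ring

theorem cross_neg_right (u v : ℂ) : cross u (-v) = -cross u v := by
  simp only [cross, Complex.neg_re, Complex.neg_im]; ring

theorem cross_smul_left (r : ℝ) (u v : ℂ) : cross (r • u) v = r * cross u v := by
  simp only [cross, Complex.smul_re, Complex.smul_im, smul_eq_mul]; ring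

theorem cross_smul_right (r : ℝ) (u v : ℂ) : cross u (r • v) = r * cross u v := by
  simp only [cross, Complex.smul_re, Complex.smul_im, smul_eq_mul]; ring

theorem cross_self (u : ℂ) : cross u u = 0 := by simp only [cross]; ring

theorem cross_comm (u v : ℂ) : cross u v = -cross v u := by simp only [cross]; ring

theorem cross_zero_left (v : ℂ) : cross 0 v = 0 := by simp [cross]

theorem cross_zero_right (v : ℂ) : cross v 0 = 0 := by simp [cross]

/-- The cross product as a bilinear map. -/
def crossL (u : ℂ) : ℂ →ₗ[ℝ] ℝ where
  toFun := cross u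
  map_add' := cross_add_right u
  map_smul' r v := cross_smul_right r u v

theorem crossL_apply (u v : ℂ) : crossL u v = cross u v := rfl

theorem cross_sum_left {ι : Type*} (s : Finset ι) (f : ι → ℂ) (v : ℂ) :
    cross (∑ i ∈ s, f i) v = ∑ i ∈ s, cross (f i) v := by
  have h : ∀ u, cross u v = -crossL v u := fun u => by rw [crossL_apply, ← cross_comm]
  simp only [h, map_sum, Finset.sum_neg_distrib]

theorem continuous_cross (u : ℂ) : Continuous (cross u) := by
  unfold cross; fun_prop

theorem cross_I_mul (u : ℂ) : cross u (Complex.I * u) = u.re ^ 2 + u.im ^ 2 := by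
  simp [cross]; ring

theorem cross_I_mul_pos {u : ℂ} (hu : u ≠ 0) : 0 < cross u (Complex.I * u) := by
  rw [cross_I_mul]
  have := Complex.normSq_pos.2 hu
  rw [Complex.normSq_apply] at this
  nlinarith

/-- Plücker relation. -/
theorem cross_mul_cross (u v x y : ℂ) :
    cross u v * cross x y = cross u x * cross v y - cross u y * cross v x := by
  simp only [cross]; ring

/-- Cramer's rule without division: the expansion of `x` in the basis `u`, `v`. -/
theorem smul_eq_of_cross (u v x : ℂ) : cross u v • x = cross x v • u + cross u x • v := by
  apply Complex.ext <;> simp [cross] <;> ring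

theorem exists_smul_of_cross_eq_zero {u v : ℂ} (hu : u ≠ 0) (h : cross u v = 0) :
    ∃ r : ℝ, v = r • u := by
  have h1 := smul_eq_of_cross u (Complex.I * u) v
  have hp := cross_I_mul_pos hu
  rw [h, zero_smul, add_zero] at h1
  refine ⟨(cross u (Complex.I * u))⁻¹ * cross v (Complex.I * u), ?_⟩
  rw [mul_smul, ← h1, smul_smul, inv_mul_cancel₀ hp.ne', one_smul]

theorem ne_zero_of_cross_right {u v : ℂ} (h : cross u v ≠ 0) : v ≠ 0 := by
  rintro rfl; exact h (cross_zero_right u)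

/-- A vector in the closed cone `{d | 0 ≤ cross u d, 0 ≤ cross v d}` is a nonnegative combination
of `v` and `-u`. -/
theorem exists_cone_combination {u v d : ℂ} (huv : 0 < cross u v) (h1 : 0 ≤ cross u d)
    (h2 : 0 ≤ cross v d) : ∃ α β : ℝ, 0 ≤ α ∧ 0 ≤ β ∧ d = α • v - β • u := by
  refine ⟨cross u d / cross u v, cross v d / cross u v, by positivity, by positivity, ?_⟩
  have h := smul_eq_of_cross u v d
  rw [cross_comm d v] at h
  rw [div_eq_inv_mul, div_eq_inv_mul, mul_smul, mul_smul, ← smul_sub, eq_inv_smul_iff₀ huv.ne', h,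
    neg_smul]
  abel

/-! ### Convex polygons -/

section Polygon

variable {n : ℕ} {P : Fin (n + 3) → ℂ}

theorem fin_add_one_ne (i : Fin (n + 3)) : i + 1 ≠ i := by
  simp

theorem fin_add_one_ne_sub_one (i : Fin (n + 3)) : i + 1 ≠ i - 1 := by
  intro h
  have h2 : (1 : Fin (n + 3)) + 1 = 0 := by
    have := congrArg (fun x => x - i + 1) h
    simpa [sub_eq_add_neg, add_comm, add_left_comm, add_assoc] using this
  have h3 := congrArg Fin.val h2
  rw [Fin.val_add, Fin.val_one, Nat.mod_eq_of_lt (by omega)] at h3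
  simp at h3

/-- A predicate on a cyclic index set that propagates to the successor holds everywhere. -/
theorem fin_cyclic_induction {Q : Fin (n + 3) → Prop} (i₀ : Fin (n + 3)) (h0 : Q i₀)
    (hs : ∀ i, Q i → Q (i + 1)) (i : Fin (n + 3)) : Q i := by
  have key : ∀ (k : ℕ) (hk : k < n + 3), Q (i₀ + ⟨k, hk⟩) := by
    intro k
    induction k with
    | zero => intro hk; exact (add_zero i₀).symm ▸ h0
    | succ k ih =>
      intro hk
      have h1 := hs _ (ih (by omega))
      have h2 : (⟨k, by omega⟩ : Fin (n + 3)) + 1 = ⟨k + 1, hk⟩ := by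
        apply Fin.ext
        rw [Fin.val_add, Fin.val_one, Nat.mod_eq_of_lt hk]
      rwa [add_assoc, h2] at h1
  have := key (i - i₀).val (i - i₀).isLt
  rwa [Fin.eta, add_sub_cancel] at this

theorem edgeVec_sub_one (P : Fin (n + 3) → ℂ) (i : Fin (n + 3)) :
    edgeVec P (i - 1) = P i - P (i - 1) := by
  rw [edgeVec, sub_add_cancel]

theorem sum_edgeVec (P : Fin (n + 3) → ℂ) : ∑ i, edgeVec P i = 0 := by
  simp only [edgeVec, Finset.sum_sub_distrib]
  exact sub_eq_zero.2 (Equiv.sum_comp (Equiv.addRight (1 : Fin (n + 3))) P)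

/-- The edge vectors of a closed polygon add up to zero, so their cross products with `d` cannot all
have the same strict sign. -/
theorem not_forall_cross_edgeVec_neg (P : Fin (n + 3) → ℂ) (d : ℂ) :
    ¬ ∀ i, cross (edgeVec P i) d < 0 := by
  intro h
  have h1 : ∑ i, cross (edgeVec P i) d < 0 :=
    Finset.sum_neg (fun i _ => h i) Finset.univ_nonempty
  rw [← cross_sum_left, sum_edgeVec, cross_zero_left] at h1
  exact lt_irrefl _ h1

theorem not_forall_cross_edgeVec_pos (P : Fin (n + 3) → ℂ) (d : ℂ) :
    ¬ ∀ i, 0 < cross (edgeVec P i) d := by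
  intro h
  refine not_forall_cross_edgeVec_neg P (-d) fun i => ?_
  rw [cross_neg_right]; linarith [h i]

namespace IsConvexPolygon

theorem cross_vertex_nonneg (hP : IsConvexPolygon P) (i j : Fin (n + 3)) :
    0 ≤ cross (edgeVec P i) (P j - P i) := by
  by_cases h1 : j = i
  · rw [h1, sub_self, cross_zero_right]
  by_cases h2 : j = i + 1
  · rw [h2, ← edgeVec, cross_self]
  exact (hP i j h1 h2).le

theorem cross_prev_vertex_nonneg (hP : IsConvexPolygon P) (i j : Fin (n + 3)) :
    0 ≤ cross (edgeVec P (i - 1)) (P j - P i) := by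
  have h := hP.cross_vertex_nonneg (i - 1) j
  have : P j - P i = P j - P (i - 1) - edgeVec P (i - 1) := by rw [edgeVec_sub_one]; ring
  rw [this, cross_sub_right, cross_self, sub_zero]; exact h

theorem cross_edgeVec_pos (hP : IsConvexPolygon P) (i : Fin (n + 3)) :
    0 < cross (edgeVec P (i - 1)) (edgeVec P i) := by
  have h := hP (i - 1) (i + 1) (fin_add_one_ne_sub_one i)
    (by rw [sub_add_cancel]; exact fin_add_one_ne i)
  have e : P (i + 1) - P (i - 1) = edgeVec P (i - 1) + edgeVec P i := by
    rw [edgeVec_sub_one, edgeVec]; ring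
  rwa [e, cross_add_right, cross_self, zero_add] at h

theorem edgeVec_ne_zero (hP : IsConvexPolygon P) (i : Fin (n + 3)) : edgeVec P i ≠ 0 :=
  ne_zero_of_cross_right (hP.cross_edgeVec_pos i).ne'

/-- A vertex other than `P i` is strictly to the left of one of the two edges at `P i`. -/
theorem cross_pos_or (hP : IsConvexPolygon P) {i j : Fin (n + 3)} (h : j ≠ i) :
    0 < cross (edgeVec P (i - 1)) (P j - P i) ∨ 0 < cross (edgeVec P i) (P j - P i) := by
  by_cases h2 : j = i + 1
  · left; rw [h2, ← edgeVec]; exact hP.cross_edgeVec_pos i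
  · right; exact hP i j h h2

theorem injective (hP : IsConvexPolygon P) : Function.Injective P := by
  intro i j h
  by_contra hne
  have := hP.cross_pos_or (Ne.symm hne)
  rw [h, sub_self, cross_zero_right, cross_zero_right] at this
  simp at this

theorem vertex_cone (hP : IsConvexPolygon P) (i j : Fin (n + 3)) :
    ∃ α β : ℝ, 0 ≤ α ∧ 0 ≤ β ∧ P j - P i = α • edgeVec P i - β • edgeVec P (i - 1) :=
  exists_cone_combination (hP.cross_edgeVec_pos i) (hP.cross_prev_vertex_nonneg i j)
    (hP.cross_vertex_nonneg i j)

end IsConvexPolygon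

theorem vertex_mem_region (P : Fin (n + 3) → ℂ) (i : Fin (n + 3)) : P i ∈ region P :=
  subset_convexHull ℝ _ ⟨i, rfl⟩

theorem convex_region (P : Fin (n + 3) → ℂ) : Convex ℝ (region P) := convex_convexHull ℝ _

theorem isCompact_region (P : Fin (n + 3) → ℂ) : IsCompact (region P) :=
  (Set.finite_range P).isCompact_convexHull ℝ

theorem isClosed_region (P : Fin (n + 3) → ℂ) : IsClosed (region P) :=
  (isCompact_region P).isClosed

theorem edge_subset_region (P : Fin (n + 3) → ℂ) (i : Fin (n + 3)) : edge P i ⊆ region P :=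
  (convex_region P).segment_subset (vertex_mem_region P i) (vertex_mem_region P (i + 1))

theorem region_subset_of_forall {s : Set ℂ} (hs : Convex ℝ s) (h : ∀ i, P i ∈ s) :
    region P ⊆ s :=
  convexHull_min (by rintro _ ⟨i, rfl⟩; exact h i) hs

theorem convex_leftHalfPlane (u p : ℂ) : Convex ℝ {x | 0 ≤ cross u (x - p)} := by
  have : {x | 0 ≤ cross u (x - p)} = {x | cross u p ≤ crossL u x} := by
    ext x; simp only [Set.mem_ofPred_eq, cross_sub_right, crossL_apply, sub_nonneg]
  rw [this]
  exact convex_halfSpace_ge (crossL u).isLinear _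

/-- For the converse, suppose that a linear functional separates `x` from the polygon and take a
vertex where it is largest. The conditions at the two edges of this vertex put `x` in its cone, on
which the functional does not exceed its value at the vertex. -/
theorem IsConvexPolygon.mem_region_iff (hP : IsConvexPolygon P) {x : ℂ} :
    x ∈ region P ↔ ∀ i, 0 ≤ cross (edgeVec P i) (x - P i) := by
  constructor
  · intro hx i
    exact region_subset_of_forall (convex_leftHalfPlane (edgeVec P i) (P i))
      (fun j => hP.cross_vertex_nonneg i j) hx
  · intro hx
    by_contra hn
    obtain ⟨f, u, hfu, hux⟩ := geometric_hahn_banach_closed_point (convex_region P)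
      (isClosed_region P) hn
    obtain ⟨i, hi⟩ := Finite.exists_max (fun i => f (P i))
    have h1 : f (edgeVec P i) ≤ 0 := by
      rw [edgeVec, map_sub]; linarith [hi (i + 1)]
    have h2 : 0 ≤ f (edgeVec P (i - 1)) := by
      rw [edgeVec_sub_one, map_sub]; linarith [hi (i - 1)]
    have h3 : 0 ≤ cross (edgeVec P (i - 1)) (x - P i) := by
      have h := hx (i - 1)
      have : x - P i = x - P (i - 1) - edgeVec P (i - 1) := by rw [edgeVec_sub_one]; ring
      rw [this, cross_sub_right, cross_self, sub_zero]; exact h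
    obtain ⟨α, β, hα, hβ, hxe⟩ := exists_cone_combination (hP.cross_edgeVec_pos i) h3 (hx i)
    have h4 : f (x - P i) ≤ 0 := by
      rw [hxe, map_sub, map_smul, map_smul, smul_eq_mul, smul_eq_mul]
      nlinarith [mul_nonneg hα (neg_nonneg.2 h1), mul_nonneg hβ h2]
    have h5 := hfu (P i) (vertex_mem_region P i)
    rw [map_sub] at h4
    linarith

theorem eventually_cross_pos {u x : ℂ} (d : ℂ) (h : 0 < cross u x) :
    ∀ᶠ ε : ℝ in 𝓝 0, 0 < cross u (x + ε • d) := by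
  have hc : Continuous fun ε : ℝ => cross u (x + ε • d) :=
    (continuous_cross u).comp (by fun_prop)
  have : Tendsto (fun ε : ℝ => cross u (x + ε • d)) (𝓝 0) (𝓝 (cross u x)) := by
    have := hc.tendsto 0
    simpa using this
  exact this.eventually (lt_mem_nhds h)

theorem IsConvexPolygon.mem_interior_iff (hP : IsConvexPolygon P) {x : ℂ} :
    x ∈ interior (region P) ↔ ∀ i, 0 < cross (edgeVec P i) (x - P i) := by
  constructor
  · intro hx i
    have h0 := hP.mem_region_iff.1 (interior_subset hx) i
    refine h0.lt_of_ne fun h => ?_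
    -- The displacement points to the right of the edge, so it takes a point on the line of this
    -- edge out of the polygon at once.
    have hc : Continuous fun ε : ℝ => x + ε • (-(Complex.I * edgeVec P i)) := by fun_prop
    have hev : ∀ᶠ ε : ℝ in 𝓝[>] 0, x + ε • (-(Complex.I * edgeVec P i)) ∈ region P := by
      have ht : Tendsto (fun ε : ℝ => x + ε • (-(Complex.I * edgeVec P i))) (𝓝 0) (𝓝 x) := by
        simpa using hc.tendsto 0
      exact (ht.eventually (mem_interior_iff_mem_nhds.1 hx)).filter_mono nhdsWithin_le_nhds
    obtain ⟨ε, hε, hpos⟩ := (hev.and self_mem_nhdsWithin).exists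
    have := hP.mem_region_iff.1 hε i
    rw [add_sub_right_comm, cross_add_right, ← h, zero_add, cross_smul_right,
      cross_neg_right] at this
    have h2 := cross_I_mul_pos (hP.edgeVec_ne_zero i)
    have hpos' : (0 : ℝ) < ε := hpos
    nlinarith
  · intro hx
    have ho : IsOpen {y | ∀ i, 0 < cross (edgeVec P i) (y - P i)} := by
      simp only [Set.ofPred_forall]
      refine isOpen_iInter_of_finite fun i => ?_
      exact isOpen_lt continuous_const ((continuous_cross _).comp (by fun_prop))
    exact interior_maximal (fun y hy => hP.mem_region_iff.2 fun i => (hy i).le) ho hx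

/-- On the line of edge `i`, the half-planes of the preceding and of the following edge cut off
exactly the parameters from 0 to 1. -/
theorem IsConvexPolygon.mem_edge_iff (hP : IsConvexPolygon P) {x : ℂ} (i : Fin (n + 3)) :
    x ∈ edge P i ↔ x ∈ region P ∧ cross (edgeVec P i) (x - P i) = 0 := by
  constructor
  · intro hx
    refine ⟨edge_subset_region P i hx, ?_⟩
    rw [edge, segment_eq_image'] at hx
    obtain ⟨θ, -, rfl⟩ := hx
    rw [add_sub_cancel_left, cross_smul_right, ← edgeVec, cross_self, mul_zero]
  · rintro ⟨hx, h0⟩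
    obtain ⟨r, hr⟩ := exists_smul_of_cross_eq_zero (hP.edgeVec_ne_zero i) h0
    have hx' := hP.mem_region_iff.1 hx
    have h1 : 0 ≤ r := by
      have h := hx' (i - 1)
      have e : x - P (i - 1) = edgeVec P (i - 1) + r • edgeVec P i := by
        rw [← hr, edgeVec_sub_one]; ring
      rw [e, cross_add_right, cross_self, zero_add, cross_smul_right] at h
      exact nonneg_of_mul_nonneg_left h (hP.cross_edgeVec_pos i)
    have h2 : r ≤ 1 := by
      have h := hx' (i + 1)
      have e : x - P (i + 1) = (r - 1) • edgeVec P i := by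
        rw [sub_smul, one_smul, ← hr, edgeVec]; ring
      have hc := hP.cross_edgeVec_pos (i + 1)
      rw [add_sub_cancel_right, cross_comm] at hc
      rw [e, cross_smul_right] at h
      nlinarith
    rw [edge, segment_eq_image']
    exact ⟨r, ⟨h1, h2⟩, by change P i + r • edgeVec P i = x; rw [← hr]; ring⟩

/-- A point of an open edge lies strictly to the left of all other edges. -/
theorem IsConvexPolygon.cross_pos_of_mem_openSegment (hP : IsConvexPolygon P) {p : ℂ}
    {i j : Fin (n + 3)} (hp : p ∈ openSegment ℝ (P j) (P (j + 1))) (hij : i ≠ j) :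
    0 < cross (edgeVec P i) (p - P i) := by
  obtain ⟨a, b, ha, hb, hab, rfl⟩ := hp
  have e : a • P j + b • P (j + 1) - P i = a • (P j - P i) + b • (P (j + 1) - P i) := by
    have h2 : a • P i + b • P i = P i := by rw [← add_smul, hab, one_smul]
    rw [smul_sub, smul_sub]
    linear_combination h2
  rw [e, cross_add_right, cross_smul_right, cross_smul_right]
  have h1 := hP.cross_vertex_nonneg i j
  have h2 := hP.cross_vertex_nonneg i (j + 1)
  -- If `P j` is the end of edge `i`, strictness comes from `P (j + 1)`, which is off the edge since
  -- there are at least three vertices; otherwise it comes from `P j`.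
  by_cases h : j = i + 1
  · have h3 := hP i (j + 1) (by rw [h, add_assoc]; intro h'; apply fin_add_one_ne_sub_one (i + 1); rw [add_sub_cancel_right, add_assoc]; exact h') (by rw [h]; exact fun h' => fin_add_one_ne (i + 1) h')
    have := mul_pos hb h3
    have := mul_nonneg ha.le h1
    linarith
  · have h3 := hP i j (Ne.symm hij) h
    have := mul_pos ha h3
    have := mul_nonneg hb.le h2
    linarith

end Polygon

/-! ### Small displacements in a convex polygon; homothetic copies. -/

section Polygon

variable {n : ℕ} {P : Fin (n + 3) → ℂ}

namespace IsConvexPolygon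

theorem cross_prev (P : Fin (n + 3) → ℂ) (i : Fin (n + 3)) (x : ℂ) :
    cross (edgeVec P (i - 1)) (x - P (i - 1)) = cross (edgeVec P (i - 1)) (x - P i) := by
  have : x - P (i - 1) = x - P i + edgeVec P (i - 1) := by rw [edgeVec_sub_one]; ring
  rw [this, cross_add_right, cross_self, add_zero]

/-- Only finitely many inequalities are involved: a strict one persists under small displacements,
and an equality becomes strict because `d` points inwards. -/
theorem eventually_mem_interior (hP : IsConvexPolygon P) {p d : ℂ}
    (h : ∀ l, 0 < cross (edgeVec P l) (p - P l) ∨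
      (cross (edgeVec P l) (p - P l) = 0 ∧ 0 < cross (edgeVec P l) d)) :
    ∀ᶠ ε : ℝ in 𝓝[>] 0, p + ε • d ∈ interior (region P) := by
  have : ∀ l, ∀ᶠ ε : ℝ in 𝓝[>] 0, 0 < cross (edgeVec P l) (p + ε • d - P l) := by
    intro l
    rcases h l with h | ⟨h0, hd⟩
    · filter_upwards [(eventually_cross_pos d h).filter_mono nhdsWithin_le_nhds] with ε hε
      rwa [add_sub_right_comm]
    · filter_upwards [self_mem_nhdsWithin] with ε hε
      rw [add_sub_right_comm, cross_add_right, h0, zero_add, cross_smul_right]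
      exact mul_pos hε hd
  filter_upwards [eventually_all.2 this] with ε hε
  exact hP.mem_interior_iff.2 hε

theorem eventually_mem_interior_of_mem_openSegment (hP : IsConvexPolygon P) {p d : ℂ}
    {j : Fin (n + 3)} (hp : p ∈ openSegment ℝ (P j) (P (j + 1)))
    (hd : 0 < cross (edgeVec P j) d) :
    ∀ᶠ ε : ℝ in 𝓝[>] 0, p + ε • d ∈ interior (region P) := by
  refine hP.eventually_mem_interior fun l => ?_
  by_cases h : l = j
  · subst h
    exact Or.inr ⟨((hP.mem_edge_iff l).1 (openSegment_subset_segment ℝ _ _ hp)).2, hd⟩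
  · exact Or.inl (hP.cross_pos_of_mem_openSegment hp h)

theorem eventually_mem_interior_of_corner (hP : IsConvexPolygon P) {d : ℂ}
    {i : Fin (n + 3)} (h1 : 0 < cross (edgeVec P (i - 1)) d) (h2 : 0 < cross (edgeVec P i) d) :
    ∀ᶠ ε : ℝ in 𝓝[>] 0, P i + ε • d ∈ interior (region P) := by
  refine hP.eventually_mem_interior fun l => ?_
  by_cases h : i = l
  · subst h
    exact Or.inr ⟨by rw [sub_self, cross_zero_right], h2⟩
  by_cases h' : i = l + 1
  · have : l = i - 1 := by rw [h', add_sub_cancel_right]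
    subst this
    exact Or.inr ⟨by rw [cross_prev, sub_self, cross_zero_right], h1⟩
  · exact Or.inl (hP l i h h')

theorem eventually_mem_interior_of_mem_interior {s : Set ℂ} {p : ℂ} (hp : p ∈ interior s) (d : ℂ) :
    ∀ᶠ ε : ℝ in 𝓝[>] 0, p + ε • d ∈ interior s := by
  have ht : Tendsto (fun ε : ℝ => p + ε • d) (𝓝 0) (𝓝 p) := by
    have hc : Continuous fun ε : ℝ => p + ε • d := by fun_prop
    simpa using hc.tendsto 0
  exact (ht.eventually (isOpen_interior.mem_nhds hp)).filter_mono nhdsWithin_le_nhds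

theorem region_cases (hP : IsConvexPolygon P) {p : ℂ} (hp : p ∈ region P) :
    p ∈ interior (region P) ∨ (∃ i, p = P i) ∨ ∃ i, p ∈ openSegment ℝ (P i) (P (i + 1)) := by
  by_cases h : p ∈ interior (region P)
  · exact Or.inl h
  right
  rw [hP.mem_interior_iff] at h
  push Not at h
  obtain ⟨i, hi⟩ := h
  have h0 := le_antisymm hi (hP.mem_region_iff.1 hp i)
  have he := (hP.mem_edge_iff i).2 ⟨hp, h0⟩
  rw [edge, ← insert_endpoints_openSegment] at he
  rcases he with rfl | rfl | he
  · exact Or.inl ⟨i, rfl⟩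
  · exact Or.inl ⟨i + 1, rfl⟩
  · exact Or.inr ⟨i, he⟩

theorem cross_nonneg_of_corner (hP : IsConvexPolygon P) {d : ℂ} {i : Fin (n + 3)} {ε : ℝ}
    (hε : 0 < ε) (h : P i + ε • d ∈ region P) :
    0 ≤ cross (edgeVec P (i - 1)) d ∧ 0 ≤ cross (edgeVec P i) d := by
  have h1 := hP.mem_region_iff.1 h (i - 1)
  have h2 := hP.mem_region_iff.1 h i
  rw [cross_prev, add_sub_cancel_left, cross_smul_right] at h1
  rw [add_sub_cancel_left, cross_smul_right] at h2
  exact ⟨nonneg_of_mul_nonneg_right h1 hε, nonneg_of_mul_nonneg_right h2 hε⟩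

theorem cross_nonneg_of_mem_edge (hP : IsConvexPolygon P) {p d : ℂ} {i : Fin (n + 3)} {ε : ℝ}
    (hε : 0 < ε) (hp : p ∈ edge P i) (h : p + ε • d ∈ region P) :
    0 ≤ cross (edgeVec P i) d := by
  have h2 := hP.mem_region_iff.1 h i
  rw [add_sub_right_comm, cross_add_right, ((hP.mem_edge_iff i).1 hp).2, zero_add,
    cross_smul_right] at h2
  exact nonneg_of_mul_nonneg_right h2 hε

theorem not_mem_interior_of_mem_edge (hP : IsConvexPolygon P) {p : ℂ} {i : Fin (n + 3)}
    (hp : p ∈ edge P i) : p ∉ interior (region P) := by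
  intro h
  have := hP.mem_interior_iff.1 h i
  rw [((hP.mem_edge_iff i).1 hp).2] at this
  exact lt_irrefl _ this

theorem vertex_mem_edge (P : Fin (n + 3) → ℂ) (i : Fin (n + 3)) : P i ∈ edge P i :=
  left_mem_segment ℝ _ _

theorem vertex_mem_edge_sub_one (P : Fin (n + 3) → ℂ) (i : Fin (n + 3)) : P i ∈ edge P (i - 1) := by
  rw [edge, sub_add_cancel]; exact right_mem_segment ℝ _ _

theorem vertex_not_mem_openSegment (hP : IsConvexPolygon P) (i j : Fin (n + 3)) :
    P i ∉ openSegment ℝ (P j) (P (j + 1)) := by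
  intro h
  by_cases hij : i = j
  · subst hij
    have h1 := hP.cross_pos_of_mem_openSegment h (i := i - 1) (by simp)
    rw [cross_prev, sub_self, cross_zero_right] at h1
    exact lt_irrefl _ h1
  · have h1 := hP.cross_pos_of_mem_openSegment h hij
    rw [sub_self, cross_zero_right] at h1
    exact lt_irrefl _ h1

theorem homothetic (hP : IsConvexPolygon P) {a : ℝ} (ha : a ≠ 0) (c : ℂ) {s : Fin (n + 3) → ℂ}
    (hs : ∀ i, s i = a • P i + c) : IsConvexPolygon s := by
  intro i j h1 h2
  have e1 : edgeVec s i = a • edgeVec P i := by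
    rw [edgeVec, edgeVec, hs, hs, smul_sub]; ring
  have e2 : s j - s i = a • (P j - P i) := by rw [hs, hs, smul_sub]; ring
  rw [e1, e2, cross_smul_left, cross_smul_right, ← mul_assoc]
  exact mul_pos (mul_self_pos.2 ha) (hP i j h1 h2)

theorem not_forall_cross_neg (hP : IsConvexPolygon P) (x : ℂ) :
    ¬ ∀ i, cross (edgeVec P i) (x - P i) < 0 := by
  intro h
  refine not_forall_cross_edgeVec_neg P (x - P 0) fun i => ?_
  have h1 := h i
  have h2 := hP.cross_vertex_nonneg i 0
  have : x - P i = (x - P 0) + (P 0 - P i) := by ring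
  rw [this, cross_add_right] at h1
  linarith

theorem interior_nonempty (hP : IsConvexPolygon P) : (interior (region P)).Nonempty := by
  have h := hP.eventually_mem_interior_of_corner (i := 0)
    (d := edgeVec P 0 - edgeVec P (0 - 1))
    (by rw [cross_sub_right, cross_self, sub_zero]; exact hP.cross_edgeVec_pos 0)
    (by rw [cross_sub_right, cross_self, zero_sub, ← cross_comm]; exact hP.cross_edgeVec_pos 0)
  obtain ⟨ε, hε⟩ := h.exists
  exact ⟨_, hε⟩

theorem closure_interior (hP : IsConvexPolygon P) : closure (interior (region P)) = region P := by
  rw [(convex_region P).closure_interior_eq_closure_of_nonempty_interior hP.interior_nonempty,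
    (isClosed_region P).closure_eq]

end IsConvexPolygon

theorem interior_region_of_const {s : Fin (n + 3) → ℂ} {c : ℂ} (hs : ∀ i, s i = c) :
    region s = {c} ∧ interior (region s) = ∅ := by
  have h : region s = {c} := by
    have : Set.range s = {c} := by
      ext x; simp only [Set.mem_range, hs, Set.mem_singleton_iff]
      exact ⟨fun ⟨_, h⟩ => h.symm, fun h => ⟨0, h.symm⟩⟩
    rw [region, this, convexHull_singleton]
  exact ⟨h, by rw [h, interior_singleton]⟩

/-- For a homothetic copy of a convex polygon (possibly reversed or shrunk to a point), a point is
in the interior iff it is on the same side of all edges. -/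
theorem IsConvexPolygon.mem_interior_homothetic_iff (hP : IsConvexPolygon P) {a : ℝ} {c : ℂ}
    {s : Fin (n + 3) → ℂ} (hs : ∀ i, s i = a • P i + c) {x : ℂ} :
    x ∈ interior (region s) ↔ (∀ i, 0 < cross (edgeVec P i) (x - s i)) ∨
      ∀ i, cross (edgeVec P i) (x - s i) < 0 := by
  by_cases ha : a = 0
  · have hc : ∀ i, s i = c := fun i => by rw [hs, ha, zero_smul, zero_add]
    rw [(interior_region_of_const hc).2]
    simp only [hc, Set.mem_empty_iff_false, false_iff, not_or]
    exact ⟨not_forall_cross_edgeVec_pos P _, not_forall_cross_edgeVec_neg P _⟩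
  have hS := hP.homothetic ha c hs
  have e1 : ∀ i, edgeVec s i = a • edgeVec P i := fun i => by
    rw [edgeVec, edgeVec, hs, hs, smul_sub]; ring
  have hneg := hS.not_forall_cross_neg x
  rw [hS.mem_interior_iff]
  simp only [e1, cross_smul_left] at hneg ⊢
  -- For negative `a` the edges of `s` point against those of `P`, so the two alternatives change
  -- roles; `hneg` excludes the spurious one.
  rcases lt_or_gt_of_ne ha with h | h
  · constructor
    · exact fun H => Or.inr fun i => by nlinarith [H i]
    · rintro (H | H) i
      · exact absurd (fun i => mul_neg_of_neg_of_pos h (H i)) hneg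
      · exact mul_pos_of_neg_of_neg h (H i)
  · constructor
    · exact fun H => Or.inl fun i => pos_of_mul_pos_right (H i) h.le
    · rintro (H | H) i
      · exact mul_pos h (H i)
      · exact absurd (fun i => mul_neg_of_pos_of_neg h (H i)) hneg

/-! ### Counting the corners of one polygon that see a point. -/

/-- The corner `i` of `s` "sees" `x`: the point `x` is on the same side of the lines of the two
edges of the corner, whose directions are those of `P`. -/
def Sees (P s : Fin (n + 3) → ℂ) (i : Fin (n + 3)) (x : ℂ) : Prop :=
  0 < cross (edgeVec P (i - 1)) (x - s i) * cross (edgeVec P i) (x - s i)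

/-- If `x` is on different sides of the edges at `s i`, then the line through `x` and `s i` is
a supporting line. -/
theorem IsConvexPolygon.cross_neg_of_change (hP : IsConvexPolygon P) {i j : Fin (n + 3)} {d : ℂ}
    (h1 : cross (edgeVec P (i - 1)) d < 0) (h2 : 0 < cross (edgeVec P i) d) (hij : j ≠ i) :
    cross d (P j - P i) < 0 := by
  have hD := hP.cross_edgeVec_pos i
  -- In this Plücker relation both contributions to the right side are nonpositive, and one is
  -- negative because `P j` is strictly to the left of one of the two edges at `P i`.
  have key := cross_mul_cross (edgeVec P (i - 1)) (edgeVec P i) d (P j - P i)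
  have a1 := hP.cross_prev_vertex_nonneg i j
  have a2 := hP.cross_vertex_nonneg i j
  by_contra hn
  push Not at hn
  have := mul_nonneg hD.le hn
  rcases hP.cross_pos_or hij with h | h
  · nlinarith [mul_pos h h2, mul_nonneg a2 (neg_nonneg.2 h1.le)]
  · nlinarith [mul_pos h (neg_pos.2 h1), mul_nonneg a1 h2.le]

theorem IsConvexPolygon.cross_pos_of_change (hP : IsConvexPolygon P) {i j : Fin (n + 3)} {d : ℂ}
    (h1 : 0 < cross (edgeVec P (i - 1)) d) (h2 : cross (edgeVec P i) d < 0) (hij : j ≠ i) :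
    0 < cross d (P j - P i) := by
  have := hP.cross_neg_of_change (d := -d) (by rw [cross_neg_right]; linarith)
    (by rw [cross_neg_right]; linarith) hij
  rw [cross_neg_left] at this; linarith

/-- Follow around the polygon the side of edge `i` on which `x` lies. A corner fails to see `x`
exactly where this side changes. There the line through `x` supports the polygon from a prescribed
side, which can happen at most once for each kind of change. As the changes alternate, there are
none (precisely when `x` is inside) or one of each kind. For `a = 0` the first case does not occur.
-/
theorem IsConvexPolygon.card_sees (hP : IsConvexPolygon P) {a : ℝ} {c : ℂ}
    {s : Fin (n + 3) → ℂ} (hs : ∀ i, s i = a • P i + c) {x : ℂ}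
    (hx : ∀ i, cross (edgeVec P i) (x - s i) ≠ 0) :
    (univ.filter fun i => Sees P s i x).card =
      n + 1 + 2 * if x ∈ interior (region s) then 1 else 0 := by
  set G : Fin (n + 3) → ℝ := fun i => cross (edgeVec P i) (x - s i) with hG
  have hGp : ∀ i, cross (edgeVec P (i - 1)) (x - s i) = G (i - 1) := by
    intro i
    have e : x - s (i - 1) = x - s i + a • edgeVec P (i - 1) := by
      rw [edgeVec_sub_one, hs, hs, smul_sub]; ring
    simp only [hG]
    rw [e, cross_add_right, cross_smul_right, cross_self, mul_zero, add_zero]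
  -- The chord from `s i` to `s j` is a multiple of that of `P`, so supporting lines of the same
  -- kind at two vertices would contradict each other.
  have hd : ∀ i j, cross (x - s j) (P i - P j) = -cross (x - s i) (P j - P i) := by
    intro i j
    have e : x - s j = x - s i - a • (P j - P i) := by rw [hs, hs, smul_sub]; ring
    rw [e, cross_sub_left, cross_smul_left, ← neg_sub (P j) (P i), cross_neg_right,
      cross_neg_right, cross_self]
    ring
  have hSees : ∀ i, Sees P s i x ↔ 0 < G (i - 1) * G i := fun i => by rw [Sees, hGp]
  have hA : (univ.filter fun i => G (i - 1) < 0 ∧ 0 < G i).card ≤ 1 := by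
    refine Finset.card_le_one.2 fun i hi j hj => ?_
    simp only [mem_filter, mem_univ, true_and] at hi hj
    by_contra hne
    have h1 := hP.cross_neg_of_change (by rw [hGp]; exact hi.1) hi.2 (Ne.symm hne)
    have h2 := hP.cross_neg_of_change (by rw [hGp]; exact hj.1) hj.2 hne
    rw [hd] at h2; linarith
  have hB : (univ.filter fun i => 0 < G (i - 1) ∧ G i < 0).card ≤ 1 := by
    refine Finset.card_le_one.2 fun i hi j hj => ?_
    simp only [mem_filter, mem_univ, true_and] at hi hj
    by_contra hne
    have h1 := hP.cross_pos_of_change (by rw [hGp]; exact hi.1) hi.2 (Ne.symm hne)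
    have h2 := hP.cross_pos_of_change (by rw [hGp]; exact hj.1) hj.2 hne
    rw [hd] at h2; linarith
  have hsgn : ∀ i, G i < 0 ∨ 0 < G i := fun i => lt_or_gt_of_ne (hx i)
  have hint := hP.mem_interior_homothetic_iff hs (x := x)
  by_cases hin : x ∈ interior (region s)
  · rw [if_pos hin, Finset.filter_true_of_mem, Finset.card_univ, Fintype.card_fin]
    intro i _
    rw [hSees]
    rcases hint.1 hin with H | H
    · exact mul_pos (H _) (H i)
    · exact mul_pos_of_neg_of_neg (H _) (H i)
  · rw [if_neg hin]
    rw [hint, not_or] at hin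
    obtain ⟨hn1, hn2⟩ := hin
    push Not at hn1 hn2
    obtain ⟨i1, hi1⟩ := hn1
    obtain ⟨i2, hi2⟩ := hn2
    have hi1 : G i1 < 0 := (hsgn i1).resolve_right (not_lt.2 hi1)
    have hi2 : 0 < G i2 := (hsgn i2).resolve_left (not_lt.2 hi2)
    have hA1 : 0 < (univ.filter fun i => G (i - 1) < 0 ∧ 0 < G i).card := by
      rw [Finset.card_pos]
      by_contra hne
      rw [Finset.not_nonempty_iff_eq_empty, Finset.filter_eq_empty_iff] at hne
      have := fin_cyclic_induction (Q := fun i => G i < 0) i1 hi1 (fun i hi => by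
        refine (hsgn (i + 1)).resolve_right fun h => hne (mem_univ (i + 1)) ?_
        rw [add_sub_cancel_right]; exact ⟨hi, h⟩) i2
      linarith
    have hB1 : 0 < (univ.filter fun i => 0 < G (i - 1) ∧ G i < 0).card := by
      rw [Finset.card_pos]
      by_contra hne
      rw [Finset.not_nonempty_iff_eq_empty, Finset.filter_eq_empty_iff] at hne
      have := fin_cyclic_induction (Q := fun i => 0 < G i) i2 hi2 (fun i hi => by
        refine (hsgn (i + 1)).resolve_left fun h => hne (mem_univ (i + 1)) ?_
        rw [add_sub_cancel_right]; exact ⟨hi, h⟩) i1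
      linarith
    have hnot : (univ.filter fun i => ¬ Sees P s i x) =
        (univ.filter fun i => G (i - 1) < 0 ∧ 0 < G i) ∪
          (univ.filter fun i => 0 < G (i - 1) ∧ G i < 0) := by
      ext i
      simp only [mem_filter, mem_univ, true_and, mem_union, hSees]
      rcases hsgn i with h | h <;> rcases hsgn (i - 1) with h' | h'
      · have := mul_pos_of_neg_of_neg h' h
        simp [this, h.not_gt, h'.not_gt]
      · have := mul_neg_of_pos_of_neg h' h
        simp [this.not_gt, h, h']
      · have := mul_neg_of_neg_of_pos h' h
        simp [this.not_gt, h, h']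
      · have := mul_pos h' h
        simp [this, h.not_gt, h'.not_gt]
    have hdisj : Disjoint (univ.filter fun i => G (i - 1) < 0 ∧ 0 < G i)
        (univ.filter fun i => 0 < G (i - 1) ∧ G i < 0) := by
      rw [Finset.disjoint_filter]
      intro i _ h1 h2
      linarith [h1.1, h2.1]
    have hcard := Finset.card_filter_add_card_filter_not (s := univ) fun i : Fin (n + 3) => Sees P s i x
    rw [hnot, Finset.card_union_of_disjoint hdisj, Finset.card_univ, Fintype.card_fin] at hcard
    omega

end Polygon

/-! ### Directions in the plane -/

/-- A half-plane containing the open cone contains its boundary rays, which are spanned by `v` and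
`-u`. -/
theorem cross_nonneg_of_cone {u v e : ℂ} (huv : 0 < cross u v)
    (h : ∀ d, 0 < cross u d → 0 < cross v d → 0 ≤ cross e d) :
    0 ≤ cross e v ∧ cross e u ≤ 0 := by
  have hd : ∀ α β : ℝ, 0 < α → 0 < β → 0 ≤ α * cross e v - β * cross e u := by
    intro α β hα hβ
    have := h (α • v - β • u)
      (by rw [cross_sub_right, cross_smul_right, cross_smul_right, cross_self]; nlinarith)
      (by rw [cross_sub_right, cross_smul_right, cross_smul_right, cross_self, cross_comm v u]
          nlinarith)
    rwa [cross_sub_right, cross_smul_right, cross_smul_right] at this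
  constructor
  · by_contra hn
    push Not at hn
    -- With these weights the expression factors as `cross e v * (1 + |cross e u| + cross e u)`,
    -- which would be negative.
    have h1 := hd (1 + |cross e u|) (-cross e v) (by positivity) (by linarith)
    have h2 := neg_abs_le (cross e u)
    have h3 := le_abs_self (cross e u)
    nlinarith
  · by_contra hn
    push Not at hn
    have h1 := hd (cross e u) (1 + |cross e v|) hn (by positivity)
    have h2 := neg_abs_le (cross e v)
    have h3 := le_abs_self (cross e v)
    nlinarith

theorem cross_pos_of_cone {u v e d : ℂ} (he : e ≠ 0) (huv : 0 < cross u v) (h1 : 0 ≤ cross e v)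
    (h2 : cross e u ≤ 0) (hu : 0 < cross u d) (hv : 0 < cross v d) : 0 < cross e d := by
  have key := cross_mul_cross u v e d
  have e1 := cross_comm u e
  have e2 := cross_comm v e
  have h0 : 0 ≤ cross u v * cross e d := by nlinarith
  have h3 : 0 ≤ cross e d := nonneg_of_mul_nonneg_right h0 huv
  refine h3.lt_of_ne fun h => ?_
  rw [← h, mul_zero] at key
  have hv0 : cross e v = 0 := by nlinarith
  have hu0 : cross e u = 0 := by nlinarith
  obtain ⟨r, hr⟩ := exists_smul_of_cross_eq_zero he hv0
  obtain ⟨q, hq⟩ := exists_smul_of_cross_eq_zero he hu0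
  rw [hr, hq, cross_smul_left, cross_smul_right, cross_self] at huv
  simp at huv

theorem add_smul_mem_segment {x v : ℂ} {r : ℝ} (h0 : 0 ≤ r) (h1 : r ≤ 1) :
    x + r • v ∈ segment ℝ x (x + v) := by
  rw [segment_eq_image', add_sub_cancel_left]
  exact ⟨r, ⟨h0, h1⟩, rfl⟩

theorem exists_segment_subset {p x y : ℂ} (hp : p ∈ openSegment ℝ x y) :
    ∃ δ : ℝ, 0 < δ ∧ segment ℝ (p - δ • (y - x)) (p + δ • (y - x)) ⊆ segment ℝ x y := by
  rw [openSegment_eq_image'] at hp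
  obtain ⟨b, ⟨hb0, hb1⟩, rfl⟩ := hp
  refine ⟨min b (1 - b), lt_min hb0 (by linarith), (convex_segment _ _).segment_subset ?_ ?_⟩
  · have := add_smul_mem_segment (x := x) (v := y - x) (r := b - min b (1 - b))
      (by linarith [min_le_left b (1 - b)]) (by linarith [lt_min hb0 (sub_pos.2 hb1)])
    rwa [add_sub_cancel, sub_smul, ← add_sub_assoc] at this
  · have := add_smul_mem_segment (x := x) (v := y - x) (r := b + min b (1 - b))
      (by linarith [lt_min hb0 (sub_pos.2 hb1)]) (by linarith [min_le_right b (1 - b)])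
    rwa [add_sub_cancel, add_smul, ← add_assoc] at this

/-! ### Corners of tiles and the local picture at a vertex. -/

section Tiling

variable {W : Type*} {m : W → ℕ} {k : ℕ}

/-- A corner of a tile. -/
abbrev Corner (m : W → ℕ) : Type _ := Σ w, Fin (m w + 3)

/-- The position of a corner. -/
def pt (t : ∀ w, Fin (m w + 3) → ℂ) (c : Corner m) : ℂ := t c.1 c.2

/-- The edge vector leaving a corner. -/
def outVec (t : ∀ w, Fin (m w + 3) → ℂ) (c : Corner m) : ℂ := edgeVec (t c.1) c.2

/-- The edge vector arriving at a corner. -/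
def inVec (t : ∀ w, Fin (m w + 3) → ℂ) (c : Corner m) : ℂ := edgeVec (t c.1) (c.2 - 1)

/-- The corner following a given one. -/
def next (c : Corner m) : Corner m := ⟨c.1, c.2 + 1⟩

/-- The corner preceding a given one. -/
def prev (c : Corner m) : Corner m := ⟨c.1, c.2 - 1⟩

theorem next_prev (c : Corner m) : next (prev c) = c :=
  Sigma.ext rfl (heq_of_eq (sub_add_cancel c.2 1))

/-- The union of the tile boundaries. -/
def edges (t : ∀ w, Fin (m w + 3) → ℂ) : Set ℂ := ⋃ w, ⋃ i, edge (t w) i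

/-- A nondegenerate tiling of a convex polygon. -/
structure NondegTiling (R : Fin (k + 3) → ℂ) (t : ∀ w, Fin (m w + 3) → ℂ) : Prop where
  hR : IsConvexPolygon R
  ht : ∀ w, IsConvexPolygon (t w)
  hT : IsTiling R t
  hnd : IsNondegenerate R t

/-- Near `p`, the line through `p` in direction `e` is contained in the tile boundaries, and
the tiles with a corner at `p` fill its left side. -/
structure IsTee (R : Fin (k + 3) → ℂ) (t : ∀ w, Fin (m w + 3) → ℂ) (p e : ℂ) : Prop where
  ne : e ≠ 0
  out_nonneg : ∀ c, pt t c = p → 0 ≤ cross e (outVec t c)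
  in_nonpos : ∀ c, pt t c = p → cross e (inVec t c) ≤ 0
  cover : ∀ d, 0 < cross e d →
    ∃ c, pt t c = p ∧ 0 ≤ cross (inVec t c) d ∧ 0 ≤ cross (outVec t c) d
  line : ∃ δ : ℝ, 0 < δ ∧ segment ℝ (p - δ • e) (p + δ • e) ⊆ edges t
  below : ∀ d, cross e d < 0 → ∀ᶠ ε : ℝ in 𝓝[>] 0, p + ε • d ∉ edges t
  -- The corners at `p` are on the left of `e`. A tile is on the left of its own edges, so a tile
  -- edge running through `p` has to be reversed, whereas an edge of `R` has not.
  src : (∃ w j, p ∈ openSegment ℝ (t w j) (t w (j + 1)) ∧ e = -edgeVec (t w) j) ∨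
    ∃ j, p ∈ openSegment ℝ (R j) (R (j + 1)) ∧ e = edgeVec R j

/-- The `j`-th corner of `R` coincides with the corner `c` of a tile, and no other tile is there. -/
structure IsCornerOf (R : Fin (k + 3) → ℂ) (t : ∀ w, Fin (m w + 3) → ℂ) (j : Fin (k + 3))
    (c : Corner m) : Prop where
  pt_eq : pt t c = R j
  unique : ∀ w, R j ∈ region (t w) → w = c.1
  out_eq : ∃ r : ℝ, 0 < r ∧ outVec t c = r • edgeVec R j
  in_eq : ∃ r : ℝ, 0 < r ∧ inVec t c = r • edgeVec R (j - 1)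

theorem edge_subset_edges (t : ∀ w, Fin (m w + 3) → ℂ) (w : W) (i : Fin (m w + 3)) :
    edge (t w) i ⊆ edges t :=
  (Set.subset_iUnion (fun i => edge (t w) i) i).trans
    (Set.subset_iUnion (fun w => ⋃ i, edge (t w) i) w)

theorem mem_edges {t : ∀ w, Fin (m w + 3) → ℂ} {x : ℂ} :
    x ∈ edges t ↔ ∃ w i, x ∈ edge (t w) i := by
  simp only [edges, Set.mem_iUnion]

namespace NondegTiling

variable {R : Fin (k + 3) → ℂ} {t : ∀ w, Fin (m w + 3) → ℂ}

theorem cone_pos (h : NondegTiling R t) (c : Corner m) : 0 < cross (inVec t c) (outVec t c) :=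
  (h.ht c.1).cross_edgeVec_pos c.2

theorem outVec_ne_zero (h : NondegTiling R t) (c : Corner m) : outVec t c ≠ 0 :=
  (h.ht c.1).edgeVec_ne_zero c.2

theorem inVec_ne_zero (h : NondegTiling R t) (c : Corner m) : inVec t c ≠ 0 :=
  (h.ht c.1).edgeVec_ne_zero _

theorem region_subset (h : NondegTiling R t) (w : W) : region (t w) ⊆ region R := by
  rw [← h.hT.1]; exact Set.subset_iUnion (fun w => region (t w)) w

/-- A tile is the closure of its interior, so interior points of one tile in another tile would make
the interiors overlap. -/
theorem tile_eq (h : NondegTiling R t) {x : ℂ} {w w' : W} (h1 : x ∈ interior (region (t w)))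
    (h2 : x ∈ region (t w')) : w = w' := by
  by_contra hne
  have hd := h.hT.2 w w' hne
  rw [← (h.ht w').closure_interior] at h2
  obtain ⟨y, hy1, hy2⟩ := mem_closure_iff.1 h2 _ isOpen_interior h1
  exact Set.disjoint_left.1 hd hy1 hy2

theorem not_mem_edges_of_mem_interior (h : NondegTiling R t) {x : ℂ} {w : W}
    (h1 : x ∈ interior (region (t w))) : x ∉ edges t := by
  intro hx
  obtain ⟨w', i, hi⟩ := mem_edges.1 hx
  obtain rfl := h.tile_eq h1 (edge_subset_region _ _ hi)
  exact (h.ht w).not_mem_interior_of_mem_edge hi h1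

theorem eventually_interior (h : NondegTiling R t) (c : Corner m) {d : ℂ}
    (h1 : 0 < cross (inVec t c) d) (h2 : 0 < cross (outVec t c) d) :
    ∀ᶠ ε : ℝ in 𝓝[>] 0, pt t c + ε • d ∈ interior (region (t c.1)) :=
  (h.ht c.1).eventually_mem_interior_of_corner h1 h2

/-- Corners at the same point have disjoint cones. -/
theorem corner_eq (h : NondegTiling R t) {c c' : Corner m} (hp : pt t c = pt t c') {d : ℂ}
    (h1 : 0 < cross (inVec t c) d) (h2 : 0 < cross (outVec t c) d)
    (h3 : 0 < cross (inVec t c') d) (h4 : 0 < cross (outVec t c') d) : c = c' := by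
  obtain ⟨ε, e1, e2⟩ := ((h.eventually_interior c h1 h2).and
    (h.eventually_interior c' h3 h4)).exists
  rw [← hp] at e2
  have hw := h.tile_eq e1 (interior_subset e2)
  obtain ⟨w, i⟩ := c
  obtain ⟨w', i'⟩ := c'
  obtain rfl : w = w' := hw
  exact congrArg (Sigma.mk w) ((h.ht w).injective hp)

theorem pt_not_mem_interior (h : NondegTiling R t) (c : Corner m) (w : W) :
    pt t c ∉ interior (region (t w)) := fun hi =>
  h.not_mem_edges_of_mem_interior hi
    (edge_subset_edges t c.1 c.2 (IsConvexPolygon.vertex_mem_edge _ _))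

/-- If `p` is in the relative interior of an edge, corners at `p` are on the other side. -/
theorem corner_cross_openSegment (h : NondegTiling R t) {c : Corner m} {w : W}
    {j : Fin (m w + 3)} (hp : pt t c ∈ openSegment ℝ (t w j) (t w (j + 1))) :
    cross (edgeVec (t w) j) (outVec t c) ≤ 0 ∧ 0 ≤ cross (edgeVec (t w) j) (inVec t c) := by
  have := cross_nonneg_of_cone (e := -edgeVec (t w) j) (h.cone_pos c) fun d h1 h2 => by
    rw [cross_neg_left, neg_nonneg]
    by_contra hn
    push Not at hn
    obtain ⟨ε, e1, e2⟩ := ((h.eventually_interior c h1 h2).and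
      ((h.ht w).eventually_mem_interior_of_mem_openSegment hp hn)).exists
    have hw := h.tile_eq e1 (interior_subset e2)
    obtain ⟨w', i'⟩ := c
    obtain rfl : w' = w := hw
    exact (h.ht w').vertex_not_mem_openSegment _ _ hp
  rw [cross_neg_left, cross_neg_left] at this
  exact ⟨by linarith [this.1], by linarith [this.2]⟩

theorem edge_R_subset_edges (h : NondegTiling R t) (j : Fin (k + 3)) : edge R j ⊆ edges t := by
  intro x hx
  have h1 := edge_subset_region _ _ hx
  rw [← h.hT.1, Set.mem_iUnion] at h1
  obtain ⟨w, hw⟩ := h1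
  rcases (h.ht w).region_cases hw with h2 | ⟨i, rfl⟩ | ⟨i, hi⟩
  · exact absurd (interior_mono (h.region_subset w) h2) (h.hR.not_mem_interior_of_mem_edge hx)
  · exact edge_subset_edges t w i (IsConvexPolygon.vertex_mem_edge _ _)
  · exact edge_subset_edges t w i (openSegment_subset_segment ℝ _ _ hi)

theorem edges_subset_region (h : NondegTiling R t) : edges t ⊆ region R := by
  intro x hx
  obtain ⟨w, i, hi⟩ := mem_edges.1 hx
  exact h.region_subset w (edge_subset_region _ _ hi)

/-- The corners of a tile are on the left of the edges of `R`. -/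
theorem corner_cross_edge_R (h : NondegTiling R t) {c : Corner m} {j : Fin (k + 3)}
    (hp : pt t c ∈ edge R j) :
    0 ≤ cross (edgeVec R j) (outVec t c) ∧ cross (edgeVec R j) (inVec t c) ≤ 0 := by
  refine cross_nonneg_of_cone (h.cone_pos c) fun d h1 h2 => ?_
  obtain ⟨ε, e1, e2⟩ := ((h.eventually_interior c h1 h2).and self_mem_nhdsWithin).exists
  exact h.hR.cross_nonneg_of_mem_edge e2 hp (h.region_subset _ (interior_subset e1))

theorem exists_cone_vector (h : NondegTiling R t) (c : Corner m) :
    ∃ d, 0 < cross (inVec t c) d ∧ 0 < cross (outVec t c) d := by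
  refine ⟨outVec t c - inVec t c, ?_, ?_⟩
  · rw [cross_sub_right, cross_self, sub_zero]; exact h.cone_pos c
  · rw [cross_sub_right, cross_self, zero_sub, ← cross_comm]; exact h.cone_pos c

variable [Finite W]

theorem isClosed_edges (t : ∀ w, Fin (m w + 3) → ℂ) : IsClosed (edges t) := by
  refine isClosed_iUnion_of_finite fun w => isClosed_iUnion_of_finite fun i => ?_
  rw [edge, ← convexHull_pair]
  exact ((Set.toFinite _).isCompact_convexHull ℝ).isClosed

/-- There are finitely many tiles, so one of them contains `p + ε • d` for arbitrarily small `ε`; as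
it is closed, it contains `p` too. -/
theorem exists_frequently (h : NondegTiling R t) {p d : ℂ}
    (hf : ∀ᶠ ε : ℝ in 𝓝[>] 0, p + ε • d ∈ region R) :
    ∃ w, p ∈ region (t w) ∧ ∃ ε : ℝ, 0 < ε ∧ p + ε • d ∈ region (t w) := by
  obtain ⟨w, hw⟩ : ∃ w, ∃ᶠ ε : ℝ in 𝓝[>] 0, p + ε • d ∈ region (t w) := by
    by_contra hn
    push Not at hn
    have := eventually_all.2 fun w => hn w
    obtain ⟨ε, e1, e2⟩ := (this.and hf).exists
    rw [← h.hT.1, Set.mem_iUnion] at e2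
    obtain ⟨w, hw⟩ := e2
    exact e1 w hw
  refine ⟨w, ?_, ?_⟩
  · by_contra hn
    have ho : (region (t w))ᶜ ∈ 𝓝 p := (isClosed_region _).isOpen_compl.mem_nhds hn
    have ht : Tendsto (fun ε : ℝ => p + ε • d) (𝓝[>] 0) (𝓝 p) := by
      have hc : Continuous fun ε : ℝ => p + ε • d := by fun_prop
      have := hc.tendsto 0
      rw [zero_smul, add_zero] at this
      exact this.mono_left nhdsWithin_le_nhds
    exact hw (ht.eventually ho)
  · obtain ⟨ε, e1, e2⟩ := (hw.and_eventually self_mem_nhdsWithin).exists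
    exact ⟨ε, e2, e1⟩

/-- The tile `w` occupies one side of its edge near the point, which pushes all corners at the point
to the other side. -/
theorem isTee_of_openSegment (h : NondegTiling R t) (c₀ : Corner m) {w : W} {j : Fin (m w + 3)}
    (hp : pt t c₀ ∈ openSegment ℝ (t w j) (t w (j + 1))) :
    IsTee R t (pt t c₀) (-edgeVec (t w) j) := by
  have hne := (h.ht w).edgeVec_ne_zero j
  obtain ⟨d₀, hd1, hd2⟩ := h.exists_cone_vector c₀
  have hopen : ∀ {w' : W} {j' : Fin (m w' + 3)},
      pt t c₀ ∈ openSegment ℝ (t w' j') (t w' (j' + 1)) → cross (edgeVec (t w') j') d₀ < 0 := by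
    intro w' j' hp'
    obtain ⟨h1, h2⟩ := h.corner_cross_openSegment hp'
    have := cross_pos_of_cone (e := -edgeVec (t w') j') (neg_ne_zero.2 ((h.ht w').edgeVec_ne_zero j'))
      (h.cone_pos c₀) (by rw [cross_neg_left]; linarith) (by rw [cross_neg_left]; linarith) hd1 hd2
    rw [cross_neg_left] at this; linarith
  -- On an edge of `R`, the direction `d₀` into the corner `c₀` and the direction `-d₀` into the
  -- tile `w` would both have to point into `R`.
  have hint : pt t c₀ ∈ interior (region R) := by
    have hpR : pt t c₀ ∈ region R := h.region_subset _ (vertex_mem_region _ _)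
    refine h.hR.mem_interior_iff.2 fun l => ?_
    refine (h.hR.mem_region_iff.1 hpR l).lt_of_ne fun h0 => ?_
    have hin := (h.hR.mem_edge_iff l).2 ⟨hpR, h0.symm⟩
    obtain ⟨h1, h2⟩ := h.corner_cross_edge_R hin
    have h3 := cross_pos_of_cone (h.hR.edgeVec_ne_zero l) (h.cone_pos c₀) h1 h2 hd1 hd2
    have h4 := (h.ht w).eventually_mem_interior_of_mem_openSegment hp (d := -d₀)
      (by rw [cross_neg_right]; linarith [hopen hp])
    obtain ⟨ε, e1, e2⟩ := (h4.and self_mem_nhdsWithin).exists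
    have := h.hR.cross_nonneg_of_mem_edge e2 hin (h.region_subset _ (interior_subset e1))
    rw [cross_neg_right] at this
    linarith
  refine ⟨neg_ne_zero.2 hne, ?_, ?_, ?_, ?_, ?_, Or.inl ⟨w, j, hp, rfl⟩⟩
  · intro c hc
    rw [← hc] at hp
    rw [cross_neg_left]; linarith [(h.corner_cross_openSegment hp).1]
  · intro c hc
    rw [← hc] at hp
    rw [cross_neg_left]; linarith [(h.corner_cross_openSegment hp).2]
  · intro d hd
    rw [cross_neg_left] at hd
    obtain ⟨w', hw', ε, hε, hpε⟩ := h.exists_frequently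
      ((IsConvexPolygon.eventually_mem_interior_of_mem_interior hint d).mono
        fun _ hx => interior_subset hx)
    rcases (h.ht w').region_cases hw' with h1 | ⟨i, hi⟩ | ⟨i, hi⟩
    · exact absurd h1 (h.pt_not_mem_interior _ _)
    · refine ⟨⟨w', i⟩, hi.symm, ?_⟩
      rw [hi] at hpε
      exact (h.ht w').cross_nonneg_of_corner hε hpε
    -- A second open edge through the point also has its tile on the side of `-d₀`. So this tile
    -- overlaps `w`, hence equals it, and the two edges are the same; but then `d` points to the
    -- wrong side.
    · exfalso
      have h1 := (h.ht w').cross_nonneg_of_mem_edge hε (openSegment_subset_segment ℝ _ _ hi) hpε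
      obtain ⟨δ, e1, e2⟩ := (((h.ht w).eventually_mem_interior_of_mem_openSegment hp (d := -d₀)
        (by rw [cross_neg_right]; linarith [hopen hp])).and
        ((h.ht w').eventually_mem_interior_of_mem_openSegment hi (d := -d₀)
        (by rw [cross_neg_right]; linarith [hopen hi]))).exists
      obtain rfl := h.tile_eq e1 (interior_subset e2)
      have hij : j = i := by
        by_contra hne
        have h2 := (h.ht w).cross_pos_of_mem_openSegment hi hne
        have h3 := ((h.ht w).mem_edge_iff j).1 (openSegment_subset_segment ℝ _ _ hp)
        linarith [h3.2]
      subst hij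
      linarith
  · obtain ⟨δ, hδ, hs⟩ := exists_segment_subset hp
    refine ⟨δ, hδ, ?_⟩
    rw [smul_neg, sub_neg_eq_add, ← sub_eq_add_neg, segment_symm]
    exact hs.trans (edge_subset_edges t w j)
  · intro d hd
    rw [cross_neg_left, neg_lt_zero] at hd
    filter_upwards [(h.ht w).eventually_mem_interior_of_mem_openSegment hp hd] with ε hε
    exact h.not_mem_edges_of_mem_interior hε

theorem isTee_of_openSegment_R (h : NondegTiling R t) (c₀ : Corner m) {j : Fin (k + 3)}
    (hp : pt t c₀ ∈ openSegment ℝ (R j) (R (j + 1))) :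
    IsTee R t (pt t c₀) (edgeVec R j) := by
  have hpe : pt t c₀ ∈ edge R j := openSegment_subset_segment ℝ _ _ hp
  refine ⟨h.hR.edgeVec_ne_zero j, ?_, ?_, ?_, ?_, ?_, Or.inr ⟨j, hp, rfl⟩⟩
  · intro c hc
    rw [← hc] at hpe
    exact (h.corner_cross_edge_R hpe).1
  · intro c hc
    rw [← hc] at hpe
    exact (h.corner_cross_edge_R hpe).2
  · intro d hd
    obtain ⟨w', hw', ε, hε, hpε⟩ := h.exists_frequently
      ((h.hR.eventually_mem_interior_of_mem_openSegment hp hd).mono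
        fun _ hx => interior_subset hx)
    rcases (h.ht w').region_cases hw' with h1 | ⟨i, hi⟩ | ⟨i, hi⟩
    · exact absurd h1 (h.pt_not_mem_interior _ _)
    · refine ⟨⟨w', i⟩, hi.symm, ?_⟩
      rw [hi] at hpε
      exact (h.ht w').cross_nonneg_of_corner hε hpε
    · exfalso
      have hT := h.isTee_of_openSegment c₀ hi
      obtain ⟨d₀, hd1, hd2⟩ := h.exists_cone_vector c₀
      have h3 := cross_pos_of_cone hT.ne (h.cone_pos c₀) (hT.out_nonneg c₀ rfl)
        (hT.in_nonpos c₀ rfl) hd1 hd2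
      rw [cross_neg_left] at h3
      have h4 := cross_pos_of_cone (h.hR.edgeVec_ne_zero j) (h.cone_pos c₀)
        (h.corner_cross_edge_R hpe).1 (h.corner_cross_edge_R hpe).2 hd1 hd2
      obtain ⟨δ, e1, e2⟩ := ((h.ht w').eventually_mem_interior_of_mem_openSegment hi (d := -d₀)
        (by rw [cross_neg_right]; linarith)).and self_mem_nhdsWithin |>.exists
      have := h.hR.cross_nonneg_of_mem_edge e2 hpe (h.region_subset _ (interior_subset e1))
      rw [cross_neg_right] at this
      linarith
  · obtain ⟨δ, hδ, hs⟩ := exists_segment_subset hp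
    exact ⟨δ, hδ, hs.trans (h.edge_R_subset_edges j)⟩
  · intro d hd
    filter_upwards [self_mem_nhdsWithin] with ε hε hmem
    have := h.hR.cross_nonneg_of_mem_edge hε hpe (h.edges_subset_region hmem)
    linarith

/-- A segment of directions within the cone at a vertex of a convex polygon stays inside. -/
theorem _root_.PolygonTiling.IsConvexPolygon.eventually_mem_region_edge {n : ℕ}
    {P : Fin (n + 3) → ℂ} (i : Fin (n + 3)) :
    (∀ᶠ ε : ℝ in 𝓝[>] 0, P i + ε • edgeVec P i ∈ edge P i) ∧
      ∀ᶠ ε : ℝ in 𝓝[>] 0, P i + ε • (-edgeVec P (i - 1)) ∈ edge P (i - 1) := by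
  have hev : ∀ᶠ ε : ℝ in 𝓝[>] 0, ε ∈ Set.Icc (0 : ℝ) 1 :=
    Filter.mem_of_superset (Ioc_mem_nhdsGT (zero_lt_one)) Set.Ioc_subset_Icc_self
  constructor
  · filter_upwards [hev] with ε hε
    rw [edge, segment_eq_image']
    exact ⟨ε, hε, rfl⟩
  · filter_upwards [hev] with ε hε
    rw [edge, sub_add_cancel, segment_symm, segment_eq_image']
    refine ⟨ε, hε, ?_⟩
    rw [edgeVec_sub_one, neg_sub]

/-- Near `R j` the polygon `R` is covered by the tile of `c` alone, so the edges of `R` lie in the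
cone of `c`; since the tile is contained in `R`, the two cones agree. -/
theorem isCornerOf (h : NondegTiling R t) (c : Corner m) {j : Fin (k + 3)} (hp : pt t c = R j)
    (hu : ∀ w, pt t c ∈ region (t w) → w = c.1) : IsCornerOf R t j c := by
  have hR := h.hR
  obtain ⟨r1, r2⟩ := IsConvexPolygon.eventually_mem_region_edge (P := R) j
  have key : ∀ d, (∀ᶠ ε : ℝ in 𝓝[>] 0, R j + ε • d ∈ region R) →
      0 ≤ cross (inVec t c) d ∧ 0 ≤ cross (outVec t c) d := by
    intro d hd
    obtain ⟨w, hw, ε, hε, hwε⟩ := h.exists_frequently hd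
    rw [← hp] at hw hwε
    obtain rfl := hu w hw
    exact (h.ht c.1).cross_nonneg_of_corner hε hwε
  obtain ⟨a1, a2⟩ := key _ (r1.mono fun _ hx => edge_subset_region _ _ hx)
  obtain ⟨b1, b2⟩ := key _ (r2.mono fun _ hx => edge_subset_region _ _ hx)
  obtain ⟨c1, c2⟩ := h.corner_cross_edge_R (c := c) (j := j)
    (by rw [hp]; exact IsConvexPolygon.vertex_mem_edge _ _)
  obtain ⟨d1, d2⟩ := h.corner_cross_edge_R (c := c) (j := j - 1)
    (by rw [hp]; exact IsConvexPolygon.vertex_mem_edge_sub_one _ _)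
  have hcR := hR.cross_edgeVec_pos j
  have hct := h.cone_pos c
  rw [cross_comm] at a2
  rw [cross_neg_right, cross_comm, neg_neg] at b1
  refine ⟨hp, fun w hw => hu w (hp ▸ hw), ?_, ?_⟩
  · obtain ⟨r, hr⟩ := exists_smul_of_cross_eq_zero (hR.edgeVec_ne_zero j)
      (le_antisymm (by linarith) c1)
    rw [hr, cross_smul_right] at d1
    have h0 : 0 ≤ r := nonneg_of_mul_nonneg_left d1 hcR
    refine ⟨r, h0.lt_of_ne ?_, hr⟩
    rintro rfl
    exact h.outVec_ne_zero c (by rw [hr, zero_smul])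
  · obtain ⟨r, hr⟩ := exists_smul_of_cross_eq_zero (hR.edgeVec_ne_zero (j - 1))
      (le_antisymm d2 b1)
    rw [hr, cross_smul_right, cross_comm] at c2
    have h0 : 0 ≤ r := by nlinarith
    refine ⟨r, h0.lt_of_ne ?_, hr⟩
    rintro rfl
    exact h.inVec_ne_zero c (by rw [hr, zero_smul])

theorem tee_or_corner (h : NondegTiling R t) (c : Corner m) :
    (∃ e, IsTee R t (pt t c) e) ∨ ∃ j, IsCornerOf R t j c := by
  rcases h.hnd c.1 c.2 with ⟨w, j, hp⟩ | ⟨j, hp⟩ | ⟨⟨j, hp⟩, hu⟩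
  · exact Or.inl ⟨_, h.isTee_of_openSegment c hp⟩
  · exact Or.inl ⟨_, h.isTee_of_openSegment_R c hp⟩
  · exact Or.inr ⟨j, h.isCornerOf c hp hu⟩

end NondegTiling

end Tiling

/-! ### The order of the corners around a vertex. -/

section Tiling

variable {W : Type*} {m : W → ℕ} {k : ℕ} {R : Fin (k + 3) → ℂ} {t : ∀ w, Fin (m w + 3) → ℂ}

/-- The first edge of the corner `c` leaves along the same ray as the second edge of `c'`. -/
def Matched (t : ∀ w, Fin (m w + 3) → ℂ) (c c' : Corner m) : Prop :=
  pt t c = pt t c' ∧ ∃ r : ℝ, 0 < r ∧ outVec t c = -(r • inVec t c')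

theorem eventually_cross_add_smul_pos {u ρ : ℂ} (q : ℂ) (h : 0 < cross u ρ) :
    ∀ᶠ η : ℝ in 𝓝[>] 0, 0 < cross u (ρ + η • q) :=
  (eventually_cross_pos q h).filter_mono nhdsWithin_le_nhds

namespace NondegTiling

/-- Both cones contain the directions slightly to the left of the common outgoing ray, and cones at
the same point do not overlap. -/
theorem out_unique (h : NondegTiling R t) {c c' : Corner m} (hp : pt t c = pt t c') {r : ℝ}
    (hr : 0 < r) (he : outVec t c = r • outVec t c') : c = c' := by
  have h1 := h.cone_pos c
  have h2 := h.cone_pos c'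
  have h3 := cross_I_mul_pos (h.outVec_ne_zero c')
  have h1' : 0 < cross (inVec t c) (outVec t c') := by
    rw [he, cross_smul_right] at h1
    exact pos_of_mul_pos_right h1 hr.le
  obtain ⟨η, ⟨e1, e2⟩, e3⟩ :=
    (((eventually_cross_add_smul_pos (Complex.I * outVec t c') h1').and
    (eventually_cross_add_smul_pos (Complex.I * outVec t c') h2)).and
      self_mem_nhdsWithin).exists
  have e4 : 0 < cross (outVec t c') (outVec t c' + η • (Complex.I * outVec t c')) := by
    rw [cross_add_right, cross_self, zero_add, cross_smul_right]; exact mul_pos e3 h3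
  refine h.corner_eq hp e1 ?_ e2 e4
  rw [he, cross_smul_left]; exact mul_pos hr e4

theorem in_unique (h : NondegTiling R t) {c c' : Corner m} (hp : pt t c = pt t c') {r : ℝ}
    (hr : 0 < r) (he : inVec t c = r • inVec t c') : c = c' := by
  have h1 : 0 < cross (outVec t c) (-inVec t c') := by
    have := h.cone_pos c
    rw [he, cross_smul_left] at this
    rw [cross_neg_right, ← cross_comm]
    exact pos_of_mul_pos_right this hr.le
  have h2 : 0 < cross (outVec t c') (-inVec t c') := by
    rw [cross_neg_right, ← cross_comm]; exact h.cone_pos c'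
  have h3 := cross_I_mul_pos (h.inVec_ne_zero c')
  obtain ⟨η, ⟨e1, e2⟩, e3⟩ :=
    (((eventually_cross_add_smul_pos (Complex.I * inVec t c') h1).and
    (eventually_cross_add_smul_pos (Complex.I * inVec t c') h2)).and
      self_mem_nhdsWithin).exists
  have e4 : 0 < cross (inVec t c') (-inVec t c' + η • (Complex.I * inVec t c')) := by
    rw [cross_add_right, cross_neg_right, cross_self, neg_zero, zero_add, cross_smul_right]
    exact mul_pos e3 h3
  refine h.corner_eq hp ?_ e1 e4 e2
  rw [he, cross_smul_left]; exact mul_pos hr e4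

end NondegTiling

namespace IsTee

variable {p e : ℂ}

theorem cross_pos (hT : IsTee R t p e) (h : NondegTiling R t) {c : Corner m} (hc : pt t c = p)
    {d : ℂ} (h1 : 0 < cross (inVec t c) d) (h2 : 0 < cross (outVec t c) d) : 0 < cross e d :=
  cross_pos_of_cone hT.ne (h.cone_pos c) (hT.out_nonneg c hc) (hT.in_nonpos c hc) h1 h2

variable [Finite W]

/-- A corner whose closed cone contains `ρ` and directions slightly to the side `q` of it. -/
theorem exists_limit_corner (hT : IsTee R t p e) {ρ q : ℂ}
    (hq : ∀ᶠ η : ℝ in 𝓝[>] 0, 0 < cross e (ρ + η • q)) :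
    ∃ c, pt t c = p ∧ 0 ≤ cross (inVec t c) ρ ∧ 0 ≤ cross (outVec t c) ρ ∧
      ∃ η : ℝ, 0 < η ∧ 0 ≤ cross (inVec t c) (ρ + η • q) ∧
        0 ≤ cross (outVec t c) (ρ + η • q) := by
  -- By finiteness one corner serves for arbitrarily small `η`, and its closed cone then contains
  -- the limit `ρ`.
  obtain ⟨c, hc⟩ : ∃ c : Corner m, ∃ᶠ η : ℝ in 𝓝[>] 0, pt t c = p ∧
      0 ≤ cross (inVec t c) (ρ + η • q) ∧ 0 ≤ cross (outVec t c) (ρ + η • q) := by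
    by_contra hn
    push Not at hn
    obtain ⟨η, e1, e2⟩ := ((eventually_all.2 hn).and hq).exists
    obtain ⟨c, h1, h2, h3⟩ := hT.cover _ e2
    exact absurd h3 (not_le.2 (e1 c h1 h2))
  have hlim : ∀ u : ℂ, (∃ᶠ η : ℝ in 𝓝[>] 0, 0 ≤ cross u (ρ + η • q)) → 0 ≤ cross u ρ := by
    intro u hu
    by_contra hn
    push Not at hn
    have := eventually_cross_add_smul_pos (u := -u) (ρ := ρ) q (by rw [cross_neg_left]; linarith)
    obtain ⟨η, e1, e2⟩ := (hu.and_eventually this).exists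
    rw [cross_neg_left] at e2
    linarith
  obtain ⟨η, ⟨h1, h2, h3⟩, h4⟩ := (hc.and_eventually self_mem_nhdsWithin).exists
  exact ⟨c, h1, hlim _ (hc.mono fun _ hx => hx.2.1), hlim _ (hc.mono fun _ hx => hx.2.2),
    η, h4, h2, h3⟩

/-- The neighbour is the corner that covers the directions slightly to the right of the ray of `c`;
that ray has to be its other side. -/
theorem exists_matched_right (hT : IsTee R t p e) (h : NondegTiling R t) {c : Corner m}
    (hc : pt t c = p) (ho : 0 < cross e (outVec t c)) : ∃ c', Matched t c c' := by
  set ρ := outVec t c with hρ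
  have hρ0 : ρ ≠ 0 := h.outVec_ne_zero c
  have hI := cross_I_mul_pos hρ0
  obtain ⟨c', hc', hA, hB, η, hη, hA', hB'⟩ := hT.exists_limit_corner (ρ := ρ)
    (q := -(Complex.I * ρ)) (eventually_cross_add_smul_pos _ ho)
  refine ⟨c', hc.trans hc'.symm, ?_⟩
  have hcone := h.cone_pos c'
  -- Otherwise the ray is inside the cone of `c'`, which then overlaps that of `c`, or it is the
  -- outgoing side of `c'`, whose cone is then not on the right of it.
  have hA0 : cross (inVec t c') ρ = 0 := by
    refine le_antisymm (not_lt.1 fun hA1 => ?_) hA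
    rcases hB.lt_or_eq with hB1 | hB1
    · obtain ⟨ζ, ⟨⟨e1, e2⟩, e3⟩, e4⟩ :=
        (((eventually_cross_add_smul_pos (Complex.I * ρ) (h.cone_pos c)).and
        (eventually_cross_add_smul_pos (Complex.I * ρ) hA1)).and
        (eventually_cross_add_smul_pos (Complex.I * ρ) hB1)).and self_mem_nhdsWithin |>.exists
      have := h.corner_eq (hc.trans hc'.symm) e1
        (by rw [← hρ, cross_add_right, cross_self, zero_add, cross_smul_right]
            exact mul_pos e4 hI) e2 e3
      rw [← this, ← hρ, cross_self] at hB1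
      exact lt_irrefl _ hB1
    · obtain ⟨r, hr⟩ := exists_smul_of_cross_eq_zero hρ0 (v := outVec t c')
        (by rw [cross_comm, ← hB1, neg_zero])
      rw [hr, cross_smul_right] at hcone
      have hr0 : 0 < r := pos_of_mul_pos_left hcone hA
      rw [hr, cross_smul_left, cross_add_right, cross_self, zero_add, cross_smul_right,
        cross_neg_right] at hB'
      nlinarith [mul_pos hr0 (mul_pos hη hI)]
  obtain ⟨r, hr⟩ := exists_smul_of_cross_eq_zero hρ0 (v := inVec t c')
    (by rw [cross_comm, hA0, neg_zero])
  rw [hr, cross_smul_left, cross_add_right, cross_self, zero_add, cross_smul_right,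
    cross_neg_right] at hA'
  have hr0 : r < 0 := by
    refine lt_of_le_of_ne (not_lt.1 fun h0 => ?_) ?_
    · nlinarith [mul_pos h0 (mul_pos hη hI)]
    · rintro rfl; exact h.inVec_ne_zero c' (by rw [hr, zero_smul])
  refine ⟨-r⁻¹, by rw [neg_pos]; exact inv_lt_zero.2 hr0, ?_⟩
  rw [hr, neg_smul, neg_neg, smul_smul, inv_mul_cancel₀ hr0.ne, one_smul]

theorem exists_matched_left (hT : IsTee R t p e) (h : NondegTiling R t) {c' : Corner m}
    (hc' : pt t c' = p) (ho : cross e (inVec t c') < 0) : ∃ c, Matched t c c' := by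
  set ρ := -inVec t c' with hρ
  have hin : inVec t c' = -ρ := by rw [hρ, neg_neg]
  have hρ0 : ρ ≠ 0 := neg_ne_zero.2 (h.inVec_ne_zero c')
  have hI := cross_I_mul_pos hρ0
  obtain ⟨c, hc, hA, hB, η, hη, hA', hB'⟩ := hT.exists_limit_corner (ρ := ρ)
    (q := Complex.I * ρ) (eventually_cross_add_smul_pos _ (by rw [cross_neg_right]; linarith))
  refine ⟨c, hc.trans hc'.symm, ?_⟩
  have hcone := h.cone_pos c
  have hB0 : cross (outVec t c) ρ = 0 := by
    refine le_antisymm (not_lt.1 fun hB1 => ?_) hB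
    rcases hA.lt_or_eq with hA1 | hA1
    · have hc0 : 0 < cross (outVec t c') ρ := by
        have := h.cone_pos c'
        rwa [hin, cross_neg_left, ← cross_comm] at this
      obtain ⟨ζ, ⟨⟨e1, e2⟩, e3⟩, e4⟩ :=
        (((eventually_cross_add_smul_pos (-(Complex.I * ρ)) hc0).and
        (eventually_cross_add_smul_pos (-(Complex.I * ρ)) hA1)).and
        (eventually_cross_add_smul_pos (-(Complex.I * ρ)) hB1)).and self_mem_nhdsWithin |>.exists
      have := h.corner_eq (hc'.trans hc.symm)
        (by rw [hin, cross_add_right, cross_smul_right, cross_neg_left, cross_self,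
              cross_neg_left, cross_neg_right, neg_zero, zero_add, neg_neg]
            exact mul_pos e4 hI) e1 e2 e3
      rw [← this, hin, cross_neg_left, cross_self, neg_zero] at hA1
      exact lt_irrefl _ hA1
    · obtain ⟨r, hr⟩ := exists_smul_of_cross_eq_zero hρ0 (v := inVec t c)
        (by rw [cross_comm, ← hA1, neg_zero])
      rw [hr, cross_smul_left, cross_comm] at hcone
      have hr0 : r < 0 := by nlinarith
      rw [hr, cross_smul_left, cross_add_right, cross_self, zero_add, cross_smul_right] at hA'
      nlinarith [mul_pos (neg_pos.2 hr0) (mul_pos hη hI)]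
  obtain ⟨r, hr⟩ := exists_smul_of_cross_eq_zero hρ0 (v := outVec t c)
    (by rw [cross_comm, hB0, neg_zero])
  rw [hr, cross_smul_left, cross_add_right, cross_self, zero_add, cross_smul_right] at hB'
  refine ⟨r, ?_, by rw [hr, hρ, smul_neg]⟩
  refine lt_of_le_of_ne (not_lt.1 fun h0 => ?_) ?_
  · nlinarith [mul_pos (neg_pos.2 h0) (mul_pos hη hI)]
  · rintro rfl; exact h.outVec_ne_zero c (by rw [hr, zero_smul])

/-- The corner that covers the directions slightly to the left of `e` has its outgoing side along
`e`, because no corner extends to the right of the tee line. -/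
theorem exists_first (hT : IsTee R t p e) (h : NondegTiling R t) :
    ∃ c, pt t c = p ∧ ∃ r : ℝ, 0 < r ∧ outVec t c = r • e := by
  have hI := cross_I_mul_pos hT.ne
  obtain ⟨c, hc, hA, hB, η, hη, hA', hB'⟩ := hT.exists_limit_corner (ρ := e)
    (q := Complex.I * e) (by
      filter_upwards [self_mem_nhdsWithin] with η hη
      rw [cross_add_right, cross_self, zero_add, cross_smul_right]; exact mul_pos hη hI)
  refine ⟨c, hc, ?_⟩
  have h1 := hT.out_nonneg c hc
  rw [cross_comm] at hB
  obtain ⟨r, hr⟩ := exists_smul_of_cross_eq_zero hT.ne (v := outVec t c) (by linarith)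
  rw [hr, cross_smul_left, cross_add_right, cross_self, zero_add, cross_smul_right] at hB'
  refine ⟨r, ?_, hr⟩
  refine lt_of_le_of_ne (not_lt.1 fun h0 => ?_) ?_
  · nlinarith [mul_pos (neg_pos.2 h0) (mul_pos hη hI)]
  · rintro rfl; exact h.outVec_ne_zero c (by rw [hr, zero_smul])

theorem exists_last (hT : IsTee R t p e) (h : NondegTiling R t) :
    ∃ c, pt t c = p ∧ ∃ r : ℝ, 0 < r ∧ inVec t c = r • e := by
  have hI := cross_I_mul_pos hT.ne
  obtain ⟨c, hc, hA, hB, η, hη, hA', hB'⟩ := hT.exists_limit_corner (ρ := -e)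
    (q := Complex.I * e) (by
      filter_upwards [self_mem_nhdsWithin] with η hη
      rw [cross_add_right, cross_neg_right, cross_self, neg_zero, zero_add, cross_smul_right]
      exact mul_pos hη hI)
  refine ⟨c, hc, ?_⟩
  have h1 := hT.in_nonpos c hc
  rw [cross_neg_right, ← cross_comm] at hA
  obtain ⟨r, hr⟩ := exists_smul_of_cross_eq_zero hT.ne (v := inVec t c) (by linarith)
  rw [hr, cross_smul_left, cross_add_right, cross_neg_right, cross_self, neg_zero, zero_add,
    cross_smul_right] at hA'
  refine ⟨r, ?_, hr⟩
  refine lt_of_le_of_ne (not_lt.1 fun h0 => ?_) ?_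
  · nlinarith [mul_pos (neg_pos.2 h0) (mul_pos hη hI)]
  · rintro rfl; exact h.inVec_ne_zero c (by rw [hr, zero_smul])

omit [Finite W] in
theorem in_parallel (hT : IsTee R t p e) (h : NondegTiling R t) {c : Corner m} (hc : pt t c = p)
    (h0 : cross e (inVec t c) = 0) : ∃ r : ℝ, 0 < r ∧ inVec t c = r • e := by
  obtain ⟨r, hr⟩ := exists_smul_of_cross_eq_zero hT.ne h0
  have h1 := h.cone_pos c
  rw [hr, cross_smul_left] at h1
  exact ⟨r, pos_of_mul_pos_left h1 (hT.out_nonneg c hc), hr⟩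

omit [Finite W] in
theorem out_parallel (hT : IsTee R t p e) (h : NondegTiling R t) {c : Corner m} (hc : pt t c = p)
    (h0 : cross e (outVec t c) = 0) : ∃ r : ℝ, 0 < r ∧ outVec t c = r • e := by
  obtain ⟨r, hr⟩ := exists_smul_of_cross_eq_zero hT.ne h0
  have h1 := h.cone_pos c
  rw [hr, cross_smul_right, cross_comm] at h1
  have h2 := hT.in_nonpos c hc
  exact ⟨r, by nlinarith, hr⟩

/-- A function on the corners at `p` that agrees at matched corners is constant. -/
theorem chain (hT : IsTee R t p e) (h : NondegTiling R t) {α : Type*} (F : Corner m → α)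
    (hF : ∀ c c', pt t c = p → Matched t c c' → F c = F c') {c c' : Corner m}
    (hc : pt t c = p) (hc' : pt t c' = p) : F c = F c' := by
  obtain ⟨l, hl, r, hr, hlr⟩ := hT.exists_last h
  suffices H : ∀ c, pt t c = p → F c = F l by rw [H c hc, H c' hc']
  by_contra hn
  push Not at hn
  -- This is minus the cotangent of the angle from `e` to the reversed incoming edge. It strictly
  -- increases on passing to the neighbour `c₁`, so a corner with the largest value among those
  -- where `F` differs from `F l` is contradictory.
  set κ : Corner m → ℝ := fun c =>
    cross (inVec t c) (Complex.I * e) / -cross e (inVec t c) with hκ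
  have hfin : {c : Corner m | pt t c = p ∧ F c ≠ F l}.Finite := Set.toFinite _
  obtain ⟨c, ⟨hcp, hcF⟩, hmax⟩ := Set.exists_max_image _ κ hfin hn
  have hlast : ∀ c, pt t c = p → F c ≠ F l → cross e (inVec t c) < 0 := by
    intro c hcp hcF
    refine (hT.in_nonpos c hcp).lt_of_ne fun h0 => hcF ?_
    obtain ⟨q, hq, hcq⟩ := hT.in_parallel h hcp h0
    rw [h.in_unique (c := c) (c' := l) (r := q * r⁻¹) (hcp.trans hl.symm)
      (mul_pos hq (inv_pos.2 hr))]
    rw [hlr, smul_smul, mul_assoc, inv_mul_cancel₀ hr.ne', mul_one, hcq]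
  obtain ⟨c₁, h1, s, hs, h2⟩ := hT.exists_matched_left h hcp (hlast c hcp hcF)
  have h3 : F c₁ = F c := hF c₁ c (h1.trans hcp) ⟨h1, s, hs, h2⟩
  have h4 := hmax c₁ ⟨h1.trans hcp, h3 ▸ hcF⟩
  have h5 := hlast c hcp hcF
  have h6 := hlast c₁ (h1.trans hcp) (h3 ▸ hcF)
  simp only [hκ] at h4
  rw [div_le_div_iff₀ (by linarith) (by linarith)] at h4
  have h7 := h.cone_pos c₁
  rw [h2, cross_neg_right, cross_smul_right] at h7
  have h8 : 0 < cross (inVec t c) (inVec t c₁) := by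
    rw [cross_comm]; nlinarith
  have h9 := cross_mul_cross (inVec t c) (inVec t c₁) e (Complex.I * e)
  have h10 := mul_pos h8 (cross_I_mul_pos hT.ne)
  rw [h9, cross_comm (inVec t c) e, cross_comm (inVec t c₁) e] at h10
  linarith

-- The cones at `p` tile the left side of the tee line and the opposite cones its right side, so a
-- generic direction lies in exactly one of them. This is where nondegeneracy enters the count.
omit [Finite W] in
theorem existsUnique_sees (hT : IsTee R t p e) (h : NondegTiling R t) {d : ℂ}
    (hd : cross e d ≠ 0)
    (hi : ∀ c, pt t c = p → cross (inVec t c) d ≠ 0)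
    (ho : ∀ c, pt t c = p → cross (outVec t c) d ≠ 0) :
    ∃! c, pt t c = p ∧ 0 < cross (inVec t c) d * cross (outVec t c) d := by
  have hex : ∃ c, pt t c = p ∧ 0 < cross (inVec t c) d * cross (outVec t c) d := by
    rcases lt_or_gt_of_ne hd with h0 | h0
    · obtain ⟨c, hc, h1, h2⟩ := hT.cover (-d) (by rw [cross_neg_right]; linarith)
      rw [cross_neg_right, neg_nonneg] at h1 h2
      exact ⟨c, hc, mul_pos_of_neg_of_neg (h1.lt_of_ne (hi c hc)) (h2.lt_of_ne (ho c hc))⟩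
    · obtain ⟨c, hc, h1, h2⟩ := hT.cover d h0
      exact ⟨c, hc, mul_pos (h1.lt_of_ne' (hi c hc)) (h2.lt_of_ne' (ho c hc))⟩
  obtain ⟨c, hc, hs⟩ := hex
  refine ⟨c, ⟨hc, hs⟩, ?_⟩
  rintro c' ⟨hc', hs'⟩
  have hneg : ∀ {c : Corner m}, cross (inVec t c) d < 0 ∧ cross (outVec t c) d < 0 →
      0 < cross (inVec t c) (-d) ∧ 0 < cross (outVec t c) (-d) := by
    intro c hc
    rw [cross_neg_right, cross_neg_right]; constructor <;> linarith [hc.1, hc.2]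
  rcases pos_and_pos_or_neg_and_neg_of_mul_pos hs with H | H <;>
    rcases pos_and_pos_or_neg_and_neg_of_mul_pos hs' with H' | H'
  · exact h.corner_eq (hc'.trans hc.symm) H'.1 H'.2 H.1 H.2
  · have h1 := hT.cross_pos h hc H.1 H.2
    have h2 := hT.cross_pos h hc' (hneg H').1 (hneg H').2
    rw [cross_neg_right] at h2; linarith
  · have h1 := hT.cross_pos h hc' H'.1 H'.2
    have h2 := hT.cross_pos h hc (hneg H).1 (hneg H).2
    rw [cross_neg_right] at h2; linarith
  · exact h.corner_eq (hc'.trans hc.symm) (hneg H').1 (hneg H').2 (hneg H).1 (hneg H).2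

end IsTee

end Tiling

/-! ### Parametrized segments. -/

theorem mem_segment_iff_add_smul {x y z : ℂ} :
    z ∈ segment ℝ x y ↔ ∃ r : ℝ, 0 ≤ r ∧ r ≤ 1 ∧ z = x + r • (y - x) := by
  rw [segment_eq_image']
  constructor
  · rintro ⟨r, ⟨h0, h1⟩, rfl⟩; exact ⟨r, h0, h1, rfl⟩
  · rintro ⟨r, h0, h1, rfl⟩; exact ⟨r, ⟨h0, h1⟩, rfl⟩

/-- The points of a segment, in terms of two of them. -/
theorem exists_add_smul_of_mem_segment {x y p q z : ℂ} (hp : p ∈ segment ℝ x y)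
    (hq : q ∈ segment ℝ x y) (hpq : p ≠ q) (hz : z ∈ segment ℝ x y) :
    ∃ r : ℝ, z = p + r • (q - p) := by
  obtain ⟨a, -, -, rfl⟩ := mem_segment_iff_add_smul.1 hp
  obtain ⟨b, -, -, rfl⟩ := mem_segment_iff_add_smul.1 hq
  obtain ⟨c, -, -, rfl⟩ := mem_segment_iff_add_smul.1 hz
  have hab : b - a ≠ 0 := by
    intro h; apply hpq; rw [sub_eq_zero.1 h]
  refine ⟨(c - a) / (b - a), ?_⟩
  have e : x + b • (y - x) - (x + a • (y - x)) = (b - a) • (y - x) := by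
    rw [sub_smul]; ring
  rw [e, smul_smul, div_mul_cancel₀ _ hab, sub_smul]; ring

theorem mem_openSegment_of_symm {x y p d : ℂ} (hd : d ≠ 0) (h1 : p - d ∈ segment ℝ x y)
    (h2 : p + d ∈ segment ℝ x y) : p ∈ openSegment ℝ x y := by
  have hp : p ∈ segment ℝ x y := by
    have := (convex_segment x y).midpoint_mem h1 h2
    rwa [midpoint_sub_add] at this
  obtain ⟨a, ha0, ha1, ha⟩ := mem_segment_iff_add_smul.1 h1
  obtain ⟨b, hb0, hb1, hb⟩ := mem_segment_iff_add_smul.1 h2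
  have hab : a ≠ b := by
    rintro rfl
    rw [← ha] at hb
    apply hd
    have : (2 : ℂ) * d = 0 := by linear_combination hb
    simpa using this
  have e : p = x + ((a + b) / 2) • (y - x) := by
    have h3 : (2 : ℂ) * p = 2 * x + (a + b) • (y - x) := by
      rw [add_smul]; linear_combination ha + hb
    have h4 : (a + b) • (y - x) = 2 * (((a + b) / 2) • (y - x)) := by
      simp only [Complex.real_smul]; push_cast; ring
    rw [h4, ← mul_add] at h3
    exact mul_left_cancel₀ two_ne_zero h3
  rw [openSegment_eq_image']
  refine ⟨(a + b) / 2, ⟨?_, ?_⟩, e.symm⟩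
  · rcases ha0.lt_or_eq with h | h
    · linarith
    · rcases hb0.lt_or_eq with h' | h'
      · linarith
      · exact absurd (h.symm.trans h') hab
  · rcases ha1.lt_or_eq with h | h
    · linarith
    · rcases hb1.lt_or_eq with h' | h'
      · linarith
      · exact absurd (h.trans h'.symm) hab

section Tiling

variable {W : Type*} {m : W → ℕ} {k : ℕ} {R : Fin (k + 3) → ℂ} {t : ∀ w, Fin (m w + 3) → ℂ}

/-! ### Maximal segments -/

theorem exists_endpoints {b : Set ℂ} (hb : b ∈ maximalSegments t) :
    ∃ x y : ℂ, x ≠ y ∧ b = segment ℝ x y := hb.1.1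

theorem subset_edges {b : Set ℂ} (hb : b ∈ maximalSegments t) : b ⊆ edges t := hb.1.2

theorem convex_of_mem_maximalSegments {b : Set ℂ} (hb : b ∈ maximalSegments t) : Convex ℝ b := by
  obtain ⟨x, y, -, rfl⟩ := exists_endpoints hb
  exact convex_segment x y

theorem exists_add_smul {b : Set ℂ} (hb : b ∈ maximalSegments t) {p q z : ℂ} (hp : p ∈ b)
    (hq : q ∈ b) (hpq : p ≠ q) (hz : z ∈ b) : ∃ r : ℝ, z = p + r • (q - p) := by
  obtain ⟨x, y, -, rfl⟩ := exists_endpoints hb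
  exact exists_add_smul_of_mem_segment hp hq hpq hz

theorem pt_next (t : ∀ w, Fin (m w + 3) → ℂ) (c : Corner m) :
    pt t (next c) = pt t c + outVec t c := by
  simp [pt, next, outVec, edgeVec]

theorem pt_prev (t : ∀ w, Fin (m w + 3) → ℂ) (c : Corner m) :
    pt t (prev c) = pt t c - inVec t c := by
  simp [pt, prev, inVec, edgeVec]

theorem edge_eq (t : ∀ w, Fin (m w + 3) → ℂ) (c : Corner m) :
    edge (t c.1) c.2 = segment ℝ (pt t c) (pt t (next c)) := rfl

theorem isBounded_edges [Finite W] (t : ∀ w, Fin (m w + 3) → ℂ) :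
    Bornology.IsBounded (edges t) := by
  refine (Bornology.isBounded_iUnion.2 fun w => Bornology.isBounded_iUnion.2 fun i => ?_)
  rw [edge, ← convexHull_pair]
  exact ((Set.toFinite _).isCompact_convexHull ℝ).isBounded

theorem isBounded_smul_line {s : Set ℂ} (hs : Bornology.IsBounded s) (p : ℂ) {v : ℂ}
    (hv : v ≠ 0) : Bornology.IsBounded {τ : ℝ | p + τ • v ∈ s} := by
  obtain ⟨C, hC⟩ := hs.subset_closedBall p
  refine (Metric.isBounded_closedBall (x := (0 : ℝ)) (r := C / ‖v‖)).subset fun τ hτ => ?_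
  have h1 := hC hτ
  rw [Metric.mem_closedBall, dist_self_add_left, norm_smul] at h1
  rw [Metric.mem_closedBall, dist_zero_right, le_div_iff₀ (norm_pos_iff.2 hv)]
  exact h1

/-- Every segment in the union of the boundaries is contained in a maximal one, and the latter is
determined by two points. -/
theorem exists_maximal [Finite W] {p q : ℂ} (hpq : p ≠ q) (hs : segment ℝ p q ⊆ edges t) :
    ∃ b ∈ maximalSegments t, p ∈ b ∧ q ∈ b ∧
      ∀ b' ∈ maximalSegments t, p ∈ b' → q ∈ b' → b' = b := by
  set v := q - p with hv
  have hv0 : v ≠ 0 := sub_ne_zero.2 hpq.symm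
  have hq : q = p + (1 : ℝ) • v := by rw [one_smul, hv]; ring
  -- The parameters that can be reached from `p` without leaving the boundaries. This set is
  -- compact, and its extreme values give the ends of the maximal segment.
  set A : Set ℝ := {τ | segment ℝ p (p + τ • v) ⊆ edges t} with hA
  have h1A : (1 : ℝ) ∈ A := by rw [hA, Set.mem_ofPred_eq, ← hq]; exact hs
  have h0A : (0 : ℝ) ∈ A := by
    rw [hA, Set.mem_ofPred_eq, zero_smul, add_zero, segment_same, Set.singleton_subset_iff]
    exact hs (left_mem_segment ℝ _ _)
  have hAB : Bornology.IsBounded A :=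
    (isBounded_smul_line (isBounded_edges t) p hv0).subset fun τ hτ => hτ (right_mem_segment ℝ _ _)
  have hAc : IsClosed A := by
    -- Written as an intersection of preimages of a closed set, `A` is visibly closed.
    have : A = ⋂ θ ∈ Set.Icc (0 : ℝ) 1, {τ : ℝ | p + (θ * τ) • v ∈ edges t} := by
      ext τ
      simp only [hA, Set.mem_ofPred_eq, Set.mem_iInter]
      constructor
      · intro h θ hθ
        apply h
        rw [mem_segment_iff_add_smul]
        exact ⟨θ, hθ.1, hθ.2, by rw [add_sub_cancel_left, smul_smul]⟩
      · intro h z hz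
        obtain ⟨θ, h0, h1, rfl⟩ := mem_segment_iff_add_smul.1 hz
        rw [add_sub_cancel_left, smul_smul]
        exact h θ ⟨h0, h1⟩
    rw [this]
    refine isClosed_biInter fun θ _ => ?_
    exact (NondegTiling.isClosed_edges t).preimage (by fun_prop)
  have hcomp : IsCompact A := Metric.isCompact_of_isClosed_isBounded hAc hAB
  have hα := hcomp.sInf_mem ⟨0, h0A⟩
  have hβ := hcomp.sSup_mem ⟨0, h0A⟩
  have hle : ∀ τ ∈ A, sInf A ≤ τ ∧ τ ≤ sSup A := fun τ hτ =>
    ⟨csInf_le hcomp.bddBelow hτ, le_csSup hcomp.bddAbove hτ⟩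
  set α := sInf A
  set β := sSup A
  have hα0 := (hle 0 h0A).1
  have hβ1 := (hle 1 h1A).2
  have hmem : ∀ τ, α ≤ τ → τ ≤ β → p + τ • v ∈ segment ℝ (p + α • v) (p + β • v) := by
    intro τ h1 h2
    rw [mem_segment_iff_add_smul]
    have hpos : 0 < β - α := by linarith
    refine ⟨(τ - α) / (β - α), div_nonneg (by linarith) hpos.le,
      (div_le_one hpos).2 (by linarith), ?_⟩
    have e : p + β • v - (p + α • v) = (β - α) • v := by rw [sub_smul]; ring
    rw [e, smul_smul, div_mul_cancel₀ _ hpos.ne', sub_smul]; ring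
  have hsub : segment ℝ (p + α • v) (p + β • v) ⊆ edges t := by
    intro z hz
    obtain ⟨θ, hθ0, hθ1, rfl⟩ := mem_segment_iff_add_smul.1 hz
    have e : p + β • v - (p + α • v) = (β - α) • v := by rw [sub_smul]; ring
    have e2 : p + α • v + θ • (p + β • v - (p + α • v)) = p + (α + θ * (β - α)) • v := by
      rw [e, smul_smul, add_smul]; ring
    rw [e2]
    rcases le_total (α + θ * (β - α)) 0 with h | h
    · apply hα
      rw [mem_segment_iff_add_smul, add_sub_cancel_left]
      have h2 : α + θ * (β - α) ≥ α := by
        have : 0 ≤ θ * (β - α) := mul_nonneg hθ0 (by linarith)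
        linarith
      rcases eq_or_lt_of_le hα0 with h3 | h3
      · have : α + θ * (β - α) = 0 := by linarith
        exact ⟨0, le_rfl, zero_le_one, by rw [this]; simp⟩
      · refine ⟨(α + θ * (β - α)) / α, div_nonneg_of_nonpos h h3.le,
          (div_le_one_of_neg h3).2 h2, ?_⟩
        rw [smul_smul, div_mul_cancel₀ _ h3.ne]
    · apply hβ
      rw [mem_segment_iff_add_smul, add_sub_cancel_left]
      have h3 : 0 < β := by linarith
      have h2 : α + θ * (β - α) ≤ β := by nlinarith
      refine ⟨(α + θ * (β - α)) / β, div_nonneg h h3.le, (div_le_one h3).2 h2, ?_⟩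
      rw [smul_smul, div_mul_cancel₀ _ h3.ne']
  have hp : p ∈ segment ℝ (p + α • v) (p + β • v) := by
    have := hmem 0 hα0 (by linarith); rwa [zero_smul, add_zero] at this
  have hq' : q ∈ segment ℝ (p + α • v) (p + β • v) := by
    have := hmem 1 (by linarith) hβ1; rwa [← hq] at this
  have hbig : ∀ x y : ℂ, segment ℝ x y ⊆ edges t → p ∈ segment ℝ x y → q ∈ segment ℝ x y →
      segment ℝ x y ⊆ segment ℝ (p + α • v) (p + β • v) := by
    intro x y hxy h1 h2 z hz
    obtain ⟨r, hr⟩ := exists_add_smul_of_mem_segment h1 h2 hpq hz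
    have hrA : r ∈ A := by
      rw [hA, Set.mem_ofPred_eq, hv, ← hr]
      exact ((convex_segment x y).segment_subset h1 hz).trans hxy
    rw [hr, ← hv]
    exact hmem r (hle r hrA).1 (hle r hrA).2
  have hne : p + α • v ≠ p + β • v := by
    intro h
    have h1 : (β - α) • v = 0 := by rw [sub_smul]; linear_combination -h
    rcases smul_eq_zero.1 h1 with h2 | h2
    · linarith
    · exact hv0 h2
  refine ⟨_, ⟨⟨⟨_, _, hne, rfl⟩, hsub⟩, ?_⟩, hp, hq', ?_⟩
  · rintro b ⟨⟨x, y, -, rfl⟩, hb⟩ hle'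
    exact hbig x y hb (hle' hp) (hle' hq')
  · intro b' hb' h1 h2
    obtain ⟨x, y, hxy, rfl⟩ := exists_endpoints hb'
    exact Set.Subset.antisymm (hbig x y (subset_edges hb') h1 h2)
      (hb'.2 ⟨⟨_, _, hne, rfl⟩, hsub⟩ (hbig x y (subset_edges hb') h1 h2))

theorem maximal_eq [Finite W] {b b' : Set ℂ} (hb : b ∈ maximalSegments t)
    (hb' : b' ∈ maximalSegments t) {p q : ℂ} (hpq : p ≠ q) (h1 : p ∈ b) (h2 : q ∈ b)
    (h3 : p ∈ b') (h4 : q ∈ b') : b = b' := by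
  obtain ⟨c, -, -, -, hc⟩ := exists_maximal hpq
    (((convex_of_mem_maximalSegments hb).segment_subset h1 h2).trans (subset_edges hb))
  rw [hc b hb h1 h2, hc b' hb' h3 h4]

end Tiling

/-! ### The maximal segment of an edge, and connectivity of the tile edges. -/

section Tiling

variable {W : Type*} [Finite W] {m : W → ℕ} {k : ℕ} {R : Fin (k + 3) → ℂ}
  {t : ∀ w, Fin (m w + 3) → ℂ}

namespace NondegTiling

omit [Finite W] in
theorem pt_ne_next (h : NondegTiling R t) (c : Corner m) : pt t c ≠ pt t (next c) := by
  rw [pt_next]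
  intro h'
  exact h.outVec_ne_zero c (by linear_combination -h')

theorem exists_seg (h : NondegTiling R t) (c : Corner m) :
    ∃ b ∈ maximalSegments t, pt t c ∈ b ∧ pt t (next c) ∈ b := by
  obtain ⟨b, hb, h1, h2, -⟩ := exists_maximal (h.pt_ne_next c) (edge_subset_edges t c.1 c.2)
  exact ⟨b, hb, h1, h2⟩

/-- The maximal segment that contains the edge leaving a corner. -/
noncomputable def seg (h : NondegTiling R t) (c : Corner m) : Set ℂ := (h.exists_seg c).choose

theorem seg_mem (h : NondegTiling R t) (c : Corner m) : h.seg c ∈ maximalSegments t :=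
  (h.exists_seg c).choose_spec.1

theorem pt_mem_seg (h : NondegTiling R t) (c : Corner m) : pt t c ∈ h.seg c :=
  (h.exists_seg c).choose_spec.2.1

theorem pt_next_mem_seg (h : NondegTiling R t) (c : Corner m) : pt t (next c) ∈ h.seg c :=
  (h.exists_seg c).choose_spec.2.2

theorem edge_subset_seg (h : NondegTiling R t) (c : Corner m) : edge (t c.1) c.2 ⊆ h.seg c :=
  (convex_of_mem_maximalSegments (h.seg_mem c)).segment_subset (h.pt_mem_seg c)
    (h.pt_next_mem_seg c)

theorem seg_eq (h : NondegTiling R t) {c : Corner m} {b : Set ℂ} (hb : b ∈ maximalSegments t)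
    {p q : ℂ} (hpq : p ≠ q) (h1 : p ∈ edge (t c.1) c.2) (h2 : q ∈ edge (t c.1) c.2) (h3 : p ∈ b)
    (h4 : q ∈ b) : h.seg c = b :=
  maximal_eq (h.seg_mem c) hb hpq (h.edge_subset_seg c h1) (h.edge_subset_seg c h2) h3 h4

theorem seg_eq_of_ray (h : NondegTiling R t) {c : Corner m} {b : Set ℂ}
    (hb : b ∈ maximalSegments t) {p v : ℂ} (hv0 : v ≠ 0) {r : ℝ} (hr : 0 < r) (hp : p ∈ b)
    (hpv : p + v ∈ b) (hc : segment ℝ p (p + r • v) ⊆ edge (t c.1) c.2) : h.seg c = b := by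
  have hq0 : 0 < min 1 r := lt_min one_pos hr
  refine h.seg_eq hb (p := p) (q := p + (min 1 r) • v) ?_ (hc (left_mem_segment ℝ _ _)) ?_ hp ?_
  · intro h'; exact smul_ne_zero hq0.ne' hv0 (by linear_combination -h')
  · apply hc
    have := add_smul_mem_segment (x := p) (v := r • v) (r := min 1 r / r)
      (by positivity) ((div_le_one hr).2 (min_le_right _ _))
    rwa [smul_smul, div_mul_cancel₀ _ hr.ne'] at this
  · exact (convex_of_mem_maximalSegments hb).segment_subset hp hpv
      (add_smul_mem_segment hq0.le (min_le_left _ _))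

theorem edge_subset_iff (h : NondegTiling R t) {c : Corner m} {b : Set ℂ}
    (hb : b ∈ maximalSegments t) : edge (t c.1) c.2 ⊆ b ↔ h.seg c = b := by
  constructor
  · intro hs
    exact h.seg_eq hb (h.pt_ne_next c) (left_mem_segment ℝ _ _) (right_mem_segment ℝ _ _)
      (hs (left_mem_segment ℝ _ _)) (hs (right_mem_segment ℝ _ _))
  · rintro rfl
    exact h.edge_subset_seg c

/-- Infinitely many points of `b` are distributed among finitely many edges, so one edge shares two
points with `b`; a maximal segment is determined by two of its points. -/
theorem exists_seg_eq (h : NondegTiling R t) {b : Set ℂ} (hb : b ∈ maximalSegments t) :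
    ∃ c, h.seg c = b := by
  obtain ⟨x, y, hxy, hbe⟩ := exists_endpoints hb
  have hf : ∀ n : ℕ, ∃ c : Corner m, x + (1 / ((n : ℝ) + 1)) • (y - x) ∈ edge (t c.1) c.2 := by
    intro n
    have : x + (1 / ((n : ℝ) + 1)) • (y - x) ∈ b := by
      rw [hbe, mem_segment_iff_add_smul]
      exact ⟨_, by positivity, by rw [div_le_one (by positivity)]; linarith [n.cast_nonneg (α := ℝ)],
        rfl⟩
    obtain ⟨w, i, hi⟩ := mem_edges.1 (subset_edges hb this)
    exact ⟨⟨w, i⟩, hi⟩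
  choose f hf using hf
  obtain ⟨n, n', hnn, he⟩ := Finite.exists_ne_map_eq_of_infinite f
  have hb' : ∀ n : ℕ, x + (1 / ((n : ℝ) + 1)) • (y - x) ∈ b := by
    intro n
    rw [hbe, mem_segment_iff_add_smul]
    exact ⟨_, by positivity, by rw [div_le_one (by positivity)]; linarith [n.cast_nonneg (α := ℝ)],
        rfl⟩
  refine ⟨f n, h.seg_eq hb ?_ (hf n) (he ▸ hf n') (hb' n) (hb' n')⟩
  intro h1
  have h2 := smul_left_injective ℝ (sub_ne_zero.2 hxy.symm) (add_left_cancel h1)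
  simp only [one_div, inv_inj, add_left_inj, Nat.cast_inj] at h2
  exact hnn h2

theorem finite_maximalSegments (h : NondegTiling R t) : (maximalSegments t).Finite :=
  (Set.finite_range h.seg).subset fun _ hb => by
    obtain ⟨c, hc⟩ := h.exists_seg_eq hb
    exact ⟨c, hc⟩

theorem edge_R_mem (h : NondegTiling R t) (j : Fin (k + 3)) : edge R j ∈ maximalSegments t := by
  have hne : R j ≠ R (j + 1) := fun h' => fin_add_one_ne j (h.hR.injective h').symm
  obtain ⟨b, hb, h1, h2, -⟩ := exists_maximal hne (h.edge_R_subset_edges j)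
  have : edge R j = b := by
    refine Set.Subset.antisymm
      ((convex_of_mem_maximalSegments hb).segment_subset h1 h2) fun z hz => ?_
    rw [h.hR.mem_edge_iff]
    refine ⟨h.edges_subset_region (subset_edges hb hz), ?_⟩
    obtain ⟨r, hr⟩ := exists_add_smul hb h1 h2 hne hz
    rw [hr, add_sub_cancel_left, cross_smul_right, ← edgeVec, cross_self, mul_zero]
  rw [this]; exact hb

theorem outVec_cross (h : NondegTiling R t) {c : Corner m} {x y : ℂ} (hx : x ∈ h.seg c)
    (hy : y ∈ h.seg c) : cross (outVec t c) (y - x) = 0 := by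
  have e : pt t (next c) - pt t c = outVec t c := by rw [pt_next, add_sub_cancel_left]
  obtain ⟨r, rfl⟩ := exists_add_smul (h.seg_mem c) (h.pt_mem_seg c) (h.pt_next_mem_seg c)
    (h.pt_ne_next c) hx
  obtain ⟨s, rfl⟩ := exists_add_smul (h.seg_mem c) (h.pt_mem_seg c) (h.pt_next_mem_seg c)
    (h.pt_ne_next c) hy
  rw [e, add_sub_add_left_eq_sub, ← sub_smul, cross_smul_right, cross_self, mul_zero]

end NondegTiling

namespace IsTee

variable {p e : ℂ}

omit [Finite W] in
/-- A segment through `p` is parallel to the tee line. -/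
theorem parallel_of_mem_openSegment (hT : IsTee R t p e) {x y : ℂ}
    (hs : segment ℝ x y ⊆ edges t) (hp : p ∈ openSegment ℝ x y) : cross e (y - x) = 0 := by
  obtain ⟨δ, hδ, hsub⟩ := exists_segment_subset hp
  have key : ∀ d, p + δ • d ∈ segment ℝ x y → 0 ≤ cross e d := by
    intro d hd
    by_contra hn
    push Not at hn
    have hev : ∀ᶠ ε : ℝ in 𝓝[>] 0, ε ∈ Set.Ioc 0 δ := Ioc_mem_nhdsGT hδ
    obtain ⟨ε, e1, e2, e3⟩ := ((hT.below d hn).and hev).exists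
    apply e1
    apply hs
    refine (convex_segment x y).segment_subset (openSegment_subset_segment ℝ _ _ hp) hd ?_
    rw [mem_segment_iff_add_smul, add_sub_cancel_left]
    exact ⟨ε / δ, by positivity, (div_le_one hδ).2 e3,
      by rw [smul_smul, div_mul_cancel₀ _ hδ.ne']⟩
  have h1 := key (y - x) (hsub (right_mem_segment ℝ _ _))
  have h2 := key (-(y - x)) (by
    rw [smul_neg, ← sub_eq_add_neg]; exact hsub (left_mem_segment ℝ _ _))
  rw [cross_neg_right] at h2
  linarith

omit [Finite W] in
theorem cross_nonneg_of_segment (hT : IsTee R t p e) {v : ℂ}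
    (hs : segment ℝ p (p + v) ⊆ edges t) : 0 ≤ cross e v := by
  by_contra hn
  push Not at hn
  have hev : ∀ᶠ ε : ℝ in 𝓝[>] 0, ε ∈ Set.Ioc 0 1 := Ioc_mem_nhdsGT one_pos
  obtain ⟨ε, e1, e2, e3⟩ := ((hT.below v hn).and hev).exists
  exact e1 (hs (add_smul_mem_segment e2.le e3))

/-- A maximal segment along the tee line at `p` extends to both sides of `p`. -/
theorem extends_of_parallel (hT : IsTee R t p e) {b : Set ℂ} (hb : b ∈ maximalSegments t)
    {v : ℂ} (hv : v ≠ 0) (hp : p ∈ b) (hpv : p + v ∈ b) (h0 : cross e v = 0) :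
    ∃ δ : ℝ, 0 < δ ∧ p - δ • e ∈ b ∧ p + δ • e ∈ b := by
  obtain ⟨δ, hδ, hsub⟩ := hT.line
  have hδe : δ • e ≠ 0 := smul_ne_zero hδ.ne' hT.ne
  obtain ⟨b', hb', h1, h2, -⟩ := exists_maximal (t := t) (p := p - δ • e) (q := p + δ • e) (by
    intro h
    apply hδe
    have : (2 : ℂ) * (δ • e) = 0 := by linear_combination -h
    simpa using this) hsub
  have hp' : p ∈ b' := by
    have := (convex_of_mem_maximalSegments hb').midpoint_mem h1 h2
    rwa [midpoint_sub_add] at this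
  obtain ⟨r, hr⟩ := exists_smul_of_cross_eq_zero hT.ne h0
  have hr0 : r ≠ 0 := by rintro rfl; exact hv (by rw [hr, zero_smul])
  set q : ℝ := min 1 (δ / |r|) with hq
  have hq0 : 0 < q := lt_min one_pos (div_pos hδ (abs_pos.2 hr0))
  have m1 : p + q • v ∈ b :=
    (convex_of_mem_maximalSegments hb).segment_subset hp hpv
      (add_smul_mem_segment hq0.le (min_le_left _ _))
  have m2 : p + q • v ∈ b' := by
    refine (convex_of_mem_maximalSegments hb').segment_subset h1 h2 ?_
    have hqr : |q * r| ≤ δ := by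
      rw [abs_mul, abs_of_pos hq0, ← le_div_iff₀ (abs_pos.2 hr0)]; exact min_le_right _ _
    obtain ⟨hl, hu⟩ := abs_le.1 hqr
    rw [mem_segment_iff_add_smul]
    refine ⟨(q * r + δ) / (2 * δ), div_nonneg (by linarith) (by positivity),
      (div_le_one (by positivity)).2 (by linarith), ?_⟩
    have e1 : p + δ • e - (p - δ • e) = (2 * δ) • e := by rw [mul_smul, two_smul]; ring
    rw [e1, smul_smul, div_mul_cancel₀ _ (by positivity), hr, smul_smul, add_smul]
    ring
  have hbb : b = b' := maximal_eq hb hb' (p := p) (q := p + q • v)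
    (by intro h; exact smul_ne_zero hq0.ne' hv (by linear_combination -h)) hp m1 hp' m2
  rw [hbb]
  exact ⟨δ, hδ, h1, h2⟩

end IsTee

namespace NondegTiling

/-- Along every segment starting at a vertex there is a tile edge. -/
theorem exists_edge_at (h : NondegTiling R t) {c₀ : Corner m} {v : ℂ} (hv : v ≠ 0)
    (hs : segment ℝ (pt t c₀) (pt t c₀ + v) ⊆ edges t) :
    ∃ c : Corner m, ∃ r : ℝ, 0 < r ∧ pt t c = pt t c₀ ∧
      (outVec t c = r • v ∨ inVec t c = -(r • v)) := by
  have hev : ∀ᶠ ε : ℝ in 𝓝[>] 0, pt t c₀ + ε • v ∈ edges t := by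
    filter_upwards [Ioc_mem_nhdsGT one_pos] with ε hε
    exact hs (add_smul_mem_segment hε.1.le hε.2)
  -- A corner whose closed cone contains `v` must have `v` along one of its sides, since a direction
  -- inside the cone enters the interior of a tile, where there are no edges.
  have fin : ∀ c : Corner m, pt t c = pt t c₀ → 0 ≤ cross (inVec t c) v →
      0 ≤ cross (outVec t c) v → ∃ c : Corner m, ∃ r : ℝ, 0 < r ∧ pt t c = pt t c₀ ∧
      (outVec t c = r • v ∨ inVec t c = -(r • v)) := by
    intro c hc hA hB
    have hcone := h.cone_pos c
    rcases hA.lt_or_eq with hA1 | hA0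
    · rcases hB.lt_or_eq with hB1 | hB0
      · obtain ⟨ε, e1, e2⟩ := ((h.eventually_interior c hA1 hB1).and hev).exists
        rw [hc] at e1
        exact absurd e2 (h.not_mem_edges_of_mem_interior e1)
      · obtain ⟨r, hr⟩ := exists_smul_of_cross_eq_zero hv (v := outVec t c)
          (by rw [cross_comm, ← hB0, neg_zero])
        rw [hr, cross_smul_right] at hcone
        exact ⟨c, r, pos_of_mul_pos_left hcone hA, hc, Or.inl hr⟩
    · obtain ⟨r, hr⟩ := exists_smul_of_cross_eq_zero hv (v := inVec t c)
          (by rw [cross_comm, ← hA0, neg_zero])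
      rw [hr, cross_smul_left, cross_comm] at hcone
      refine ⟨c, -r, by nlinarith, hc, Or.inr ?_⟩
      rw [hr, neg_smul, neg_neg]
  rcases h.tee_or_corner c₀ with ⟨e, hT⟩ | ⟨j, hC⟩
  · rcases (hT.cross_nonneg_of_segment hs).lt_or_eq with h0 | h0
    · obtain ⟨c, hc, hA, hB⟩ := hT.cover v h0
      exact fin c hc hA hB
    · obtain ⟨r, hr⟩ := exists_smul_of_cross_eq_zero hT.ne h0.symm
      have hr0 : r ≠ 0 := by rintro rfl; exact hv (by rw [hr, zero_smul])
      rcases lt_or_gt_of_ne hr0 with h1 | h1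
      · obtain ⟨c, hc, s, hs, he⟩ := hT.exists_last h
        refine ⟨c, s * -r⁻¹, mul_pos hs (neg_pos.2 (inv_lt_zero.2 h1)), hc, Or.inr ?_⟩
        rw [hr, smul_smul, mul_assoc, neg_mul, inv_mul_cancel₀ hr0, he]; simp
      · obtain ⟨c, hc, s, hs, he⟩ := hT.exists_first h
        refine ⟨c, s * r⁻¹, mul_pos hs (inv_pos.2 h1), hc, Or.inl ?_⟩
        rw [hr, smul_smul, mul_assoc, inv_mul_cancel₀ hr0, he, mul_one]
  · obtain ⟨w, hw, ε, hε, hwε⟩ := h.exists_frequently (hev.mono fun _ hx =>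
      h.edges_subset_region hx)
    rw [hC.pt_eq] at hw
    obtain rfl := hC.unique w hw
    obtain ⟨hA, hB⟩ := (h.ht c₀.1).cross_nonneg_of_corner hε hwε
    exact fin c₀ rfl hA hB

theorem exists_edge_toward (h : NondegTiling R t) {b : Set ℂ} (hb : b ∈ maximalSegments t)
    {c₀ : Corner m} (hp : pt t c₀ ∈ b) {q : ℂ} (hq : q ∈ b) (hne : pt t c₀ ≠ q) :
    ∃ c : Corner m, ∃ r : ℝ, 0 < r ∧ h.seg c = b ∧
      ((pt t c = pt t c₀ ∧ pt t (next c) = pt t c₀ + r • (q - pt t c₀)) ∨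
        (pt t (next c) = pt t c₀ ∧ pt t c = pt t c₀ + r • (q - pt t c₀))) := by
  set p := pt t c₀ with hpdef
  set v := q - p with hv
  have hv0 : v ≠ 0 := sub_ne_zero.2 hne.symm
  have hpv : p + v = q := by rw [hv]; ring
  have hs : segment ℝ p (p + v) ⊆ b := by
    rw [hpv]; exact (convex_of_mem_maximalSegments hb).segment_subset hp hq
  obtain ⟨c, r, hr, hc, ho⟩ := h.exists_edge_at (c₀ := c₀) hv0 (hs.trans (subset_edges hb))
  have hseg : ∀ c : Corner m, segment ℝ p (p + r • v) ⊆ edge (t c.1) c.2 → h.seg c = b :=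
    fun c hc => h.seg_eq_of_ray hb hv0 hr hp (hpv ▸ hq) hc
  rcases ho with ho | ho
  · have e1 : pt t (next c) = p + r • v := by rw [pt_next, hc, ho]
    refine ⟨c, r, hr, hseg c ?_, Or.inl ⟨hc, e1⟩⟩
    rw [edge_eq, hc, e1]
  · have e1 : pt t (prev c) = p + r • v := by rw [pt_prev, hc, ho, sub_neg_eq_add]
    have e2 : pt t (next (prev c)) = p := by rw [next_prev, hc]
    refine ⟨prev c, r, hr, hseg _ ?_, Or.inr ⟨e2, e1⟩⟩
    rw [edge_eq, e1, e2, segment_symm]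

/-- A function on the plane that agrees at the endpoints of the tile edges of a maximal segment
is constant at the vertices of the segment. Moreover, the end of the segment is a vertex. -/
theorem eq_endpoint (h : NondegTiling R t) {x y : ℂ} (hxy : x ≠ y)
    (hb : segment ℝ x y ∈ maximalSegments t) {α : Type*} (F : ℂ → α)
    (hF : ∀ c, h.seg c = segment ℝ x y → F (pt t c) = F (pt t (next c))) :
    (∀ c, pt t c ∈ segment ℝ x y → F (pt t c) = F y) ∧ ∃ c, pt t c = y := by
  set φ : ℂ → ℝ := fun z => crossL (-(Complex.I * (y - x))) z with hφ
  have hφpos : 0 < φ (y - x) := by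
    simp only [hφ, crossL_apply]
    rw [cross_neg_left, ← cross_comm]
    exact cross_I_mul_pos (sub_ne_zero.2 hxy.symm)
  -- From every vertex of the segment other than `y` some edge of the segment leads further towards
  -- `y`, with the same value of `F`. There are finitely many vertices, so `y` is reached.
  have step : ∀ c₀, pt t c₀ ∈ segment ℝ x y → pt t c₀ ≠ y → ∃ c₁, pt t c₁ ∈ segment ℝ x y ∧
      F (pt t c₁) = F (pt t c₀) ∧ φ (pt t c₀) < φ (pt t c₁) := by
    intro c₀ hp hne
    have hgt : ∀ r : ℝ, 0 < r → φ (pt t c₀) < φ (pt t c₀ + r • (y - pt t c₀)) := by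
      intro r hr
      obtain ⟨a, ha0, ha1, ha⟩ := mem_segment_iff_add_smul.1 hp
      have ha1' : a < 1 := ha1.lt_of_ne (by rintro rfl; apply hne; rw [ha, one_smul]; ring)
      have e : y - pt t c₀ = (1 - a) • (y - x) := by rw [ha, sub_smul, one_smul]; ring
      simp only [hφ] at hφpos ⊢
      rw [map_add, map_smul, e, map_smul, smul_eq_mul, smul_eq_mul]
      have := mul_pos hr (mul_pos (sub_pos.2 ha1') hφpos)
      linarith
    obtain ⟨c, r, hr, hc, ⟨h1, h2⟩ | ⟨h1, h2⟩⟩ :=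
      h.exists_edge_toward hb hp (right_mem_segment ℝ x y) hne
    · exact ⟨next c, hc ▸ h.pt_next_mem_seg c, by rw [← hF c hc, h1], by rw [h2]; exact hgt r hr⟩
    · exact ⟨c, hc ▸ h.pt_mem_seg c, by rw [hF c hc, h1], by rw [h2]; exact hgt r hr⟩
  constructor
  · by_contra hn
    push Not at hn
    obtain ⟨c, ⟨hc1, hc2⟩, hmax⟩ := Set.exists_max_image
      {c : Corner m | pt t c ∈ segment ℝ x y ∧ F (pt t c) ≠ F y} (fun c => φ (pt t c))
      (Set.toFinite _) hn
    obtain ⟨c₁, h1, h2, h3⟩ := step c hc1 (by rintro h'; exact hc2 (by rw [h']))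
    exact absurd (hmax c₁ ⟨h1, h2 ▸ hc2⟩) (not_le.2 h3)
  · obtain ⟨c₀, hc₀⟩ := h.exists_seg_eq hb
    obtain ⟨c, hc1, hmax⟩ := Set.exists_max_image
      {c : Corner m | pt t c ∈ segment ℝ x y} (fun c => φ (pt t c))
      (Set.toFinite _) ⟨c₀, hc₀ ▸ h.pt_mem_seg c₀⟩
    refine ⟨c, ?_⟩
    by_contra hne
    obtain ⟨c₁, h1, h2, h3⟩ := step c hc1 hne
    exact absurd (hmax c₁ h1) (not_le.2 h3)

theorem eq_of_mem_segment (h : NondegTiling R t) {b : Set ℂ} (hb : b ∈ maximalSegments t)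
    {α : Type*} (F : ℂ → α) (hF : ∀ c, h.seg c = b → F (pt t c) = F (pt t (next c)))
    {c c' : Corner m} (hc : pt t c ∈ b) (hc' : pt t c' ∈ b) : F (pt t c) = F (pt t c') := by
  obtain ⟨x, y, hxy, rfl⟩ := exists_endpoints hb
  have := (h.eq_endpoint hxy hb F hF).1
  rw [this c hc, this c' hc']

/-- The tile edges connect all vertices. -/
theorem connected (h : NondegTiling R t) {α : Type*} (F : ℂ → α)
    (hF : ∀ c : Corner m, F (pt t c) = F (pt t (next c))) (c c' : Corner m) :
    F (pt t c) = F (pt t c') := by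
  have hseg : ∀ {b}, b ∈ maximalSegments t → ∀ {c c' : Corner m}, pt t c ∈ b → pt t c' ∈ b →
      F (pt t c) = F (pt t c') := fun hb _ _ => h.eq_of_mem_segment hb F fun c _ => hF c
  have htile : ∀ (w : W) (i i' : Fin (m w + 3)), F (t w i) = F (t w i') := by
    intro w i i'
    have := fin_cyclic_induction (Q := fun i => F (t w i) = F (t w i')) i' rfl
      (fun i hi => by rw [← hi]; exact (hF ⟨w, i⟩).symm) i
    exact this
  -- Two tiles that share a point have edges through it. If the point is a vertex of one of them,
  -- that vertex is in the maximal segment of the other edge.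
  have hpoint : ∀ (w w' : W) (q : ℂ), q ∈ region (t w) → q ∈ region (t w') →
      F (t w 0) = F (t w' 0) := by
    intro w w' q hq hq'
    by_cases hww : w = w'
    · subst hww; rfl
    have hedge : ∀ {w w'}, w ≠ w' → q ∈ region (t w) → q ∈ region (t w') → ∃ i,
        q ∈ edge (t w) i ∧ (q ∈ openSegment ℝ (t w i) (t w (i + 1)) ∨ q = t w i) := by
      intro w w' hww hq hq'
      rcases (h.ht w).region_cases hq with h1 | ⟨i, hi⟩ | ⟨i, hi⟩
      · exact absurd (h.tile_eq h1 hq') hww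
      · exact ⟨i, hi ▸ IsConvexPolygon.vertex_mem_edge _ _, Or.inr hi⟩
      · exact ⟨i, openSegment_subset_segment ℝ _ _ hi, Or.inl hi⟩
    obtain ⟨i, hi, hi2⟩ := hedge hww hq hq'
    obtain ⟨i', hi', hi2'⟩ := hedge (Ne.symm hww) hq' hq
    have m1 := h.edge_subset_seg ⟨w, i⟩ hi
    have m2 := h.edge_subset_seg ⟨w', i'⟩ hi'
    rw [htile w 0 i, htile w' 0 i']
    rcases hi2 with hi2 | rfl
    · rcases hi2' with hi2' | rfl
      -- Two open edges crossing at `q` would make the tiles overlap. So the edges are parallel,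
      -- share a piece, and lie in the same maximal segment.
      · have hpar : cross (edgeVec (t w) i) (edgeVec (t w') i') = 0 := by
          by_contra hne
          have hex : ∃ d, 0 < cross (edgeVec (t w) i) d ∧ 0 < cross (edgeVec (t w') i') d := by
            rcases lt_or_gt_of_ne hne with h1 | h1
            · refine ⟨edgeVec (t w) i - edgeVec (t w') i', ?_, ?_⟩
              · rw [cross_sub_right, cross_self]; linarith
              · rw [cross_sub_right, cross_self, cross_comm]; linarith
            · refine ⟨edgeVec (t w') i' - edgeVec (t w) i, ?_, ?_⟩
              · rw [cross_sub_right, cross_self]; linarith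
              · rw [cross_sub_right, cross_self, cross_comm (edgeVec (t w') i')]; linarith
          obtain ⟨d, d1, d2⟩ := hex
          obtain ⟨ε, e1, e2⟩ := (((h.ht w).eventually_mem_interior_of_mem_openSegment hi2 d1).and
            ((h.ht w').eventually_mem_interior_of_mem_openSegment hi2' d2)).exists
          exact hww (h.tile_eq e1 (interior_subset e2))
        obtain ⟨r, hr⟩ := exists_smul_of_cross_eq_zero ((h.ht w).edgeVec_ne_zero i) hpar
        have hr0 : r ≠ 0 := by
          rintro rfl; exact (h.ht w').edgeVec_ne_zero i' (by rw [hr, zero_smul])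
        obtain ⟨δ, hδ, hs⟩ := exists_segment_subset hi2
        obtain ⟨δ', hδ', hs'⟩ := exists_segment_subset hi2'
        change segment ℝ (q - δ • edgeVec (t w) i) (q + δ • edgeVec (t w) i) ⊆ edge (t w) i at hs
        change segment ℝ (q - δ' • edgeVec (t w') i') (q + δ' • edgeVec (t w') i') ⊆
          edge (t w') i' at hs'
        rw [hr] at hs'
        have hmem : ∀ (u : ℂ) (δ s : ℝ), 0 < δ → |s| ≤ δ →
            q + s • u ∈ segment ℝ (q - δ • u) (q + δ • u) := by
          intro u δ s hδ hs
          obtain ⟨hl, hu⟩ := abs_le.1 hs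
          rw [mem_segment_iff_add_smul]
          refine ⟨(s + δ) / (2 * δ), div_nonneg (by linarith) (by positivity),
            (div_le_one (by positivity)).2 (by linarith), ?_⟩
          have e1 : q + δ • u - (q - δ • u) = (2 * δ) • u := by rw [mul_smul, two_smul]; ring
          rw [e1, smul_smul, div_mul_cancel₀ _ (by positivity), add_smul]
          ring
        set s := min δ (δ' * |r|) with hsdef
        have hs0 : 0 < s := lt_min hδ (mul_pos hδ' (abs_pos.2 hr0))
        have n1 : q + s • edgeVec (t w) i ∈ edge (t w) i :=
          hs (hmem _ _ _ hδ (by rw [abs_of_pos hs0]; exact min_le_left _ _))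
        have n2 : q + s • edgeVec (t w) i ∈ edge (t w') i' := by
          have := hs' (hmem (r • edgeVec (t w) i) δ' (s / r) hδ' (by
            rw [abs_div, abs_of_pos hs0, div_le_iff₀ (abs_pos.2 hr0)]; exact min_le_right _ _))
          rwa [smul_smul, div_mul_cancel₀ _ hr0] at this
        have hss : h.seg ⟨w, i⟩ = h.seg ⟨w', i'⟩ := by
          refine h.seg_eq (h.seg_mem _) (p := q) (q := q + s • edgeVec (t w) i) ?_ hi n1 m2
            (h.edge_subset_seg ⟨w', i'⟩ n2)
          intro h'
          exact smul_ne_zero hs0.ne' ((h.ht w).edgeVec_ne_zero i) (by linear_combination -h')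
        exact hseg (h.seg_mem ⟨w, i⟩) (c := ⟨w, i⟩) (c' := ⟨w', i'⟩) (h.pt_mem_seg _)
          (by rw [hss]; exact h.pt_mem_seg _)
      · exact hseg (h.seg_mem ⟨w, i⟩) (c := ⟨w, i⟩) (c' := ⟨w', i'⟩) (h.pt_mem_seg _) m1
    · exact hseg (h.seg_mem ⟨w', i'⟩) (c := ⟨w, i⟩) (c' := ⟨w', i'⟩) m2 (h.pt_mem_seg _)
  suffices H : ∀ w w', F (t w 0) = F (t w' 0) by
    have h1 := htile c.1 c.2 0
    have h2 := htile c'.1 0 c'.2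
    exact h1.trans ((H c.1 c'.1).trans h2)
  by_contra hn
  push Not at hn
  obtain ⟨w, w', hww⟩ := hn
  -- The tiles where `F` agrees with its value on `w` and the remaining ones form two closed sets
  -- covering the connected region of `R`; hence they meet, against `hpoint`.
  set A : Set ℂ := ⋃ v : {v : W // F (t v 0) = F (t w 0)}, region (t v) with hA
  set B : Set ℂ := ⋃ v : {v : W // F (t v 0) ≠ F (t w 0)}, region (t v) with hB
  have hAc : IsClosed A := isClosed_iUnion_of_finite fun v => isClosed_region _
  have hBc : IsClosed B := isClosed_iUnion_of_finite fun v => isClosed_region _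
  have hcov : region R ⊆ A ∪ B := by
    rw [← h.hT.1]
    refine Set.iUnion_subset fun v => ?_
    by_cases hv : F (t v 0) = F (t w 0)
    · exact (Set.subset_iUnion (fun v : {v : W // F (t v 0) = F (t w 0)} => region (t v))
        ⟨v, hv⟩).trans Set.subset_union_left
    · exact (Set.subset_iUnion (fun v : {v : W // F (t v 0) ≠ F (t w 0)} => region (t v))
        ⟨v, hv⟩).trans Set.subset_union_right
  have hpre := (convex_region R).isPreconnected
  rw [isPreconnected_closed_iff] at hpre
  obtain ⟨q, -, hqA, hqB⟩ := hpre A B hAc hBc hcov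
    ⟨t w 0, h.region_subset w (vertex_mem_region _ _),
      Set.mem_iUnion.2 ⟨⟨w, rfl⟩, vertex_mem_region _ _⟩⟩
    ⟨t w' 0, h.region_subset w' (vertex_mem_region _ _),
      Set.mem_iUnion.2 ⟨⟨w', Ne.symm hww⟩, vertex_mem_region _ _⟩⟩
  obtain ⟨⟨v, hv⟩, hvq⟩ := Set.mem_iUnion.1 hqA
  obtain ⟨⟨v', hv'⟩, hvq'⟩ := Set.mem_iUnion.1 hqB
  exact hv' ((hpoint v' v q hvq' hvq).trans hv)

end NondegTiling

end Tiling

/-! ### Interior segments: chains of edges, and an estimate for the number of corners. -/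

section Tiling

variable {W : Type*} {m : W → ℕ} {k : ℕ} {R : Fin (k + 3) → ℂ}
  {t : ∀ w, Fin (m w + 3) → ℂ}

/-- The maximal segments that are not edges of `R`. -/
def interiorSegments (R : Fin (k + 3) → ℂ) (t : ∀ w, Fin (m w + 3) → ℂ) : Set (Set ℂ) :=
  {b | b ∈ maximalSegments t ∧ ∀ j, b ≠ edge R j}

namespace NondegTiling

/-- A tee lies in the relative interior of a segment inside `R`, which is impossible at a corner of
a strictly convex polygon. -/
theorem not_isTee_corner (h : NondegTiling R t) {j : Fin (k + 3)} {e : ℂ}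
    (hT : IsTee R t (R j) e) : False := by
  obtain ⟨δ, hδ, hs⟩ := hT.line
  have h1 := h.edges_subset_region (hs (left_mem_segment ℝ _ _))
  have h2 := h.edges_subset_region (hs (right_mem_segment ℝ _ _))
  rw [sub_eq_add_neg, ← smul_neg] at h1
  obtain ⟨a1, a2⟩ := h.hR.cross_nonneg_of_corner hδ h1
  obtain ⟨b1, b2⟩ := h.hR.cross_nonneg_of_corner hδ h2
  rw [cross_neg_right] at a1 a2
  have hc := h.hR.cross_edgeVec_pos j
  obtain ⟨r, hr⟩ := exists_smul_of_cross_eq_zero (h.hR.edgeVec_ne_zero j)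
    (show cross (edgeVec R j) e = 0 by linarith)
  rw [hr, cross_smul_right] at a1 b1
  have hr0 : r ≠ 0 := by rintro rfl; exact hT.ne (by rw [hr, zero_smul])
  rcases mul_eq_zero.1 (show r * cross (edgeVec R (j - 1)) (edgeVec R j) = 0 by linarith)
    with h0 | h0
  · exact hr0 h0
  · linarith

theorem eq_of_isCornerOf (h : NondegTiling R t) {j : Fin (k + 3)} {c c' : Corner m}
    (hC : IsCornerOf R t j c) (hp : pt t c' = R j) : c' = c := by
  obtain ⟨w, i⟩ := c
  obtain ⟨w', i'⟩ := c'
  obtain rfl : w' = w := hC.unique w' (hp ▸ vertex_mem_region _ _)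
  exact congrArg (Sigma.mk w') ((h.ht w').injective (hp.trans hC.pt_eq.symm))

variable [Finite W]

theorem exists_isCornerOf (h : NondegTiling R t) (j : Fin (k + 3)) :
    ∃ c, IsCornerOf R t j c := by
  have hne : R (j - 1) ≠ R (j - 1 + 1) := fun h' => fin_add_one_ne (j - 1) (h.hR.injective h').symm
  -- The constant function is a dummy: only the fact that the end of the segment is a vertex is
  -- used.
  obtain ⟨c, hc⟩ := (h.eq_endpoint hne (h.edge_R_mem (j - 1)) (fun _ => ()) (fun _ _ => rfl)).2
  rw [sub_add_cancel] at hc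
  rcases h.tee_or_corner c with ⟨e, hT⟩ | ⟨j', hC⟩
  · rw [hc] at hT
    exact (h.not_isTee_corner hT).elim
  · have : j' = j := h.hR.injective (hC.pt_eq.symm.trans hc)
    exact ⟨c, this ▸ hC⟩

theorem seg_eq_edge_R (h : NondegTiling R t) {j : Fin (k + 3)} {c : Corner m}
    (hC : IsCornerOf R t j c) : h.seg c = edge R j := by
  obtain ⟨r, hr, ho⟩ := hC.out_eq
  refine h.seg_eq_of_ray (h.edge_R_mem j) (h.hR.edgeVec_ne_zero j) hr
    (IsConvexPolygon.vertex_mem_edge _ _) (p := R j) ?_ ?_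
  · rw [edgeVec, add_sub_cancel]; exact right_mem_segment ℝ _ _
  · rw [edge_eq, pt_next, hC.pt_eq, ho]

theorem seg_prev_eq_edge_R (h : NondegTiling R t) {j : Fin (k + 3)} {c : Corner m}
    (hC : IsCornerOf R t j c) : h.seg (prev c) = edge R (j - 1) := by
  obtain ⟨r, hr, ho⟩ := hC.in_eq
  refine h.seg_eq_of_ray (h.edge_R_mem (j - 1)) (neg_ne_zero.2 (h.hR.edgeVec_ne_zero (j - 1))) hr
    (IsConvexPolygon.vertex_mem_edge_sub_one _ _) (p := R j) ?_ ?_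
  · rw [edgeVec_sub_one, neg_sub, add_sub_cancel]; exact left_mem_segment ℝ _ _
  · rw [edge_eq, next_prev, pt_prev, hC.pt_eq, ho, smul_neg, ← sub_eq_add_neg, segment_symm]

/-- Edges of the same segment that leave the same point coincide. -/
theorem eq_of_seg_eq (h : NondegTiling R t) {c c' : Corner m} (hs : h.seg c = h.seg c')
    (hp : pt t c = pt t c') : c = c' := by
  rcases h.tee_or_corner c with ⟨e, hT⟩ | ⟨j, hC⟩
  · have h0 := h.outVec_cross (c := c) (x := pt t c') (y := pt t (next c'))
      (hs ▸ h.pt_mem_seg c') (hs ▸ h.pt_next_mem_seg c')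
    rw [pt_next, add_sub_cancel_left] at h0
    obtain ⟨r, hr⟩ := exists_smul_of_cross_eq_zero (h.outVec_ne_zero c) h0
    rcases lt_trichotomy r 0 with h1 | h1 | h1
    · have h2 := hT.out_nonneg c rfl
      have h3 := hT.out_nonneg c' hp.symm
      have h3' := h3
      rw [hr, cross_smul_right] at h3'
      have h4 : cross e (outVec t c) = 0 := by nlinarith
      have h5 : cross e (outVec t c') = 0 := by rw [hr, cross_smul_right, h4, mul_zero]
      obtain ⟨q, hq, hqe⟩ := hT.out_parallel h rfl h4
      obtain ⟨q', hq', hqe'⟩ := hT.out_parallel h hp.symm h5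
      refine h.out_unique hp (r := q * q'⁻¹) (mul_pos hq (inv_pos.2 hq')) ?_
      rw [hqe, hqe', smul_smul, mul_assoc, inv_mul_cancel₀ hq'.ne', mul_one]
    · rw [h1, zero_smul] at hr
      exact absurd hr (h.outVec_ne_zero c')
    · exact (h.out_unique hp.symm h1 hr).symm
  · exact (h.eq_of_isCornerOf hC (hp.symm.trans hC.pt_eq)).symm

/-- On an interior segment every edge is preceded by another one. -/
theorem exists_next_eq (h : NondegTiling R t) {c : Corner m} (hint : ∀ j, h.seg c ≠ edge R j) :
    ∃ c', h.seg c' = h.seg c ∧ pt t (next c') = pt t c := by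
  rcases h.tee_or_corner c with ⟨e, hT⟩ | ⟨j, hC⟩
  -- An edge that leaves the tee line continues with its matched neighbour. An edge along the tee
  -- line is preceded by the incoming side of the last corner, because the maximal segment extends
  -- beyond the tee.
  · rcases (hT.out_nonneg c rfl).lt_or_eq with h0 | h0
    · obtain ⟨c', hp, r, hr, he⟩ := hT.exists_matched_right h rfl h0
      refine ⟨prev c', ?_, by rw [next_prev, hp]⟩
      have ho := h.outVec_ne_zero c
      refine h.seg_eq_of_ray (h.seg_mem c) ho (inv_pos.2 hr) (h.pt_mem_seg c) ?_ ?_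
      · rw [← pt_next]; exact h.pt_next_mem_seg c
      · rw [edge_eq, next_prev, pt_prev, he, smul_neg, smul_smul, inv_mul_cancel₀ hr.ne',
          one_smul, hp, segment_symm, sub_eq_add_neg]
    · obtain ⟨δ, hδ, h1, h2⟩ := hT.extends_of_parallel (h.seg_mem c) (h.outVec_ne_zero c)
        (h.pt_mem_seg c) (by rw [← pt_next]; exact h.pt_next_mem_seg c) h0.symm
      obtain ⟨c', hp, r, hr, he⟩ := hT.exists_last h
      refine ⟨prev c', ?_, by rw [next_prev, hp]⟩
      refine h.seg_eq_of_ray (h.seg_mem c) (v := -(δ • e)) (r := r / δ)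
        (neg_ne_zero.2 (smul_ne_zero hδ.ne' hT.ne)) (div_pos hr hδ) (h.pt_mem_seg c) ?_ ?_
      · rw [← sub_eq_add_neg]; exact h1
      · rw [edge_eq, next_prev, pt_prev, he, smul_neg, smul_smul, div_mul_cancel₀ _ hδ.ne', hp,
          segment_symm, sub_eq_add_neg]
  · exact absurd (h.seg_eq_edge_R hC) (hint j)

end NondegTiling

section Fintype

variable [Fintype W]

/-- The set of all vertices. -/
noncomputable def verts (t : ∀ w, Fin (m w + 3) → ℂ) : Finset ℂ := univ.image (pt t)

theorem pt_mem_verts (t : ∀ w, Fin (m w + 3) → ℂ) (c : Corner m) : pt t c ∈ verts t :=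
  mem_image_of_mem _ (mem_univ c)

namespace NondegTiling

theorem R_mem_verts (h : NondegTiling R t) (j : Fin (k + 3)) : R j ∈ verts t := by
  obtain ⟨c, hc⟩ := h.exists_isCornerOf j
  exact hc.pt_eq ▸ pt_mem_verts t c

/-- The boundary of the chain of all edges in an interior segment vanishes. -/
theorem sum_seg_eq_zero (h : NondegTiling R t) {b : Set ℂ} (hb : b ∈ interiorSegments R t)
    {M : Type*} [AddCommGroup M] (g : ℂ → M) :
    ∑ c ∈ univ.filter (fun c => h.seg c = b), (g (pt t (next c)) - g (pt t c)) = 0 := by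
  have hex : ∀ c : {c // h.seg c = b}, ∃ c' : {c // h.seg c = b},
      pt t (next c'.1) = pt t c.1 := by
    rintro ⟨c, rfl⟩
    obtain ⟨c', h1, h2⟩ := h.exists_next_eq hb.2
    exact ⟨⟨c', h1⟩, h2⟩
  -- A choice of a preceding edge. It is injective because edges of one segment that leave the same
  -- point coincide, hence a permutation; so every point is as often the start of an edge as the end
  -- of one.
  choose τ hτ using hex
  have hinj : Function.Injective τ := by
    intro c c' hcc
    have h1 := hτ c
    rw [hcc, hτ c'] at h1
    exact Subtype.ext (h.eq_of_seg_eq (c.2.trans c'.2.symm) h1.symm)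
  have hbij : Function.Bijective τ := Finite.injective_iff_bijective.1 hinj
  rw [Finset.sum_sub_distrib, sub_eq_zero]
  rw [Finset.sum_subtype (univ.filter fun c => h.seg c = b) (p := fun c => h.seg c = b)
    (by simp) (fun c => g (pt t (next c))),
    Finset.sum_subtype (univ.filter fun c => h.seg c = b) (p := fun c => h.seg c = b)
    (by simp) (fun c => g (pt t c)), ← hbij.sum_comp]
  exact Finset.sum_congr rfl fun c _ => by rw [hτ]

theorem finite_interiorSegments (h : NondegTiling R t) : (interiorSegments R t).Finite :=
  h.finite_maximalSegments.subset fun _ hb => hb.1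

/-- Every corner that is not the first one at its vertex begins an edge at the end of an interior
segment. -/
theorem card_corner_le (h : NondegTiling R t) :
    Fintype.card (Corner m) ≤ (verts t).card + 2 * (interiorSegments R t).ncard := by
  have hxy : ∀ c : Corner m, ∃ x y : ℂ, x ≠ y ∧ h.seg c = segment ℝ x y := fun c =>
    exists_endpoints (h.seg_mem c)
  have hend : ∀ b : Set ℂ, ∃ xy : ℂ × ℂ, b ∈ maximalSegments t → b = segment ℝ xy.1 xy.2 := by
    intro b
    by_cases hb : b ∈ maximalSegments t
    · obtain ⟨x, y, -, he⟩ := exists_endpoints hb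
      exact ⟨(x, y), fun _ => he⟩
    · exact ⟨(0, 0), fun h' => absurd h' hb⟩
  choose E hE using hend
  -- A corner is charged to an end of an interior segment if its edge starts there, and to its
  -- vertex otherwise. This gives an injection, with two ends for each segment.
  set leg : Corner m → Prop := fun c => h.seg c ∈ interiorSegments R t ∧
    (pt t c = (E (h.seg c)).1 ∨ pt t c = (E (h.seg c)).2) with hleg
  set f : Corner m → ℂ ⊕ (Set ℂ × Bool) := fun c =>
    if leg c then Sum.inr (h.seg c, decide (pt t c = (E (h.seg c)).1)) else Sum.inl (pt t c) with hf
  set B := h.finite_interiorSegments.toFinset with hB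
  have hmaps : ∀ c ∈ (univ : Finset (Corner m)),
      f c ∈ (verts t).disjSum (B ×ˢ (univ : Finset Bool)) := by
    intro c _
    by_cases hc : leg c
    · simp only [hf, if_pos hc, Finset.inr_mem_disjSum, Finset.mem_product, Finset.mem_univ,
        and_true, hB, Set.Finite.mem_toFinset]
      exact hc.1
    · simp only [hf, if_neg hc, Finset.inl_mem_disjSum]
      exact pt_mem_verts t c
  -- A segment that runs through a tee is parallel to the tee line. If it ended there without being
  -- interior, it would be an edge of `R`, whose ends are not tees. So at a tee only the first
  -- corner is charged to the vertex.
  have hnl : ∀ {c : Corner m} {e : ℂ}, IsTee R t (pt t c) e → ¬ leg c →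
      cross e (outVec t c) = 0 := by
    intro c e hT hc
    have hsE := hE _ (h.seg_mem c)
    have hp := h.pt_mem_seg c
    by_cases hopen : pt t c ∈ openSegment ℝ (E (h.seg c)).1 (E (h.seg c)).2
    · have h1 := hT.parallel_of_mem_openSegment (by rw [← hsE]; exact subset_edges (h.seg_mem c))
        hopen
      obtain ⟨r, hr⟩ := exists_smul_of_cross_eq_zero (h.outVec_ne_zero c)
        (h.outVec_cross (x := (E (h.seg c)).1) (y := (E (h.seg c)).2)
          (hsE.symm.subset (left_mem_segment ℝ _ _)) (hsE.symm.subset (right_mem_segment ℝ _ _)))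
      rw [hr, cross_smul_right] at h1
      rcases mul_eq_zero.1 h1 with h2 | h2
      · exfalso
        rw [h2, zero_smul] at hr
        have h3 := sub_eq_zero.1 hr
        obtain ⟨x, y, hxy, he⟩ := hxy c
        rw [hsE, h3, segment_same] at he
        have h4 : x ∈ ({(E (h.seg c)).1} : Set ℂ) := he ▸ left_mem_segment ℝ x y
        have h5 : y ∈ ({(E (h.seg c)).1} : Set ℂ) := he ▸ right_mem_segment ℝ x y
        exact hxy (h4.trans h5.symm)
      · exact h2
    · exfalso
      rw [hsE, ← insert_endpoints_openSegment] at hp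
      have hends : pt t c = (E (h.seg c)).1 ∨ pt t c = (E (h.seg c)).2 := by
        rcases hp with h1 | h1 | h1
        · exact Or.inl h1
        · exact Or.inr h1
        · exact absurd h1 hopen
      apply hc
      refine ⟨⟨h.seg_mem c, fun j hj => ?_⟩, hends⟩
      have hpj : pt t c ∈ edge R j := hj ▸ h.pt_mem_seg c
      rw [edge, ← insert_endpoints_openSegment] at hpj
      rcases hpj with h1 | h1 | h1
      · rw [h1] at hT; exact h.not_isTee_corner hT
      · rw [Set.mem_singleton_iff.1 h1] at hT; exact h.not_isTee_corner hT
      · obtain ⟨δ, hδ, hs⟩ := exists_segment_subset h1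
        apply hopen
        refine mem_openSegment_of_symm (d := δ • (R (j + 1) - R j))
          (smul_ne_zero hδ.ne' (h.hR.edgeVec_ne_zero j)) ?_ ?_
        · rw [← hsE, hj]; exact hs (left_mem_segment ℝ _ _)
        · rw [← hsE, hj]; exact hs (right_mem_segment ℝ _ _)
  have hinj : Function.Injective f := by
    intro c c' hcc
    by_cases hc : leg c <;> by_cases hc' : leg c'
    · simp only [hf, if_pos hc, if_pos hc', Sum.inr.injEq, Prod.mk.injEq, decide_eq_decide] at hcc
      obtain ⟨h1, h2⟩ := hcc
      refine h.eq_of_seg_eq h1 ?_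
      rcases hc.2 with h3 | h3
      · rw [h3, h2.1 h3, h1]
      · rcases hc'.2 with h4 | h4
        · rw [h4, h2.2 h4, h1]
        · rw [h3, h4, h1]
    · simp [hf, hc, hc'] at hcc
    · simp [hf, hc, hc'] at hcc
    · simp only [hf, if_neg hc, if_neg hc', Sum.inl.injEq] at hcc
      rcases h.tee_or_corner c with ⟨e, hT⟩ | ⟨j, hC⟩
      · obtain ⟨q, hq, hqe⟩ := hT.out_parallel h rfl (hnl hT hc)
        obtain ⟨q', hq', hqe'⟩ := hT.out_parallel h hcc.symm (hnl (hcc ▸ hT) hc')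
        refine h.out_unique hcc (r := q * q'⁻¹) (mul_pos hq (inv_pos.2 hq')) ?_
        rw [hqe, hqe', smul_smul, mul_assoc, inv_mul_cancel₀ hq'.ne', mul_one]
      · exact (h.eq_of_isCornerOf hC (hcc.symm.trans hC.pt_eq)).symm
  have hcard := Finset.card_le_card_of_injOn f hmaps hinj.injOn
  rw [Finset.card_univ, Finset.card_disjSum, Finset.card_product, Finset.card_univ,
    Fintype.card_bool] at hcard
  rw [Set.ncard_eq_toFinset_card _ h.finite_interiorSegments]
  linarith

end NondegTiling

end Fintype

end Tiling

/-! ### Generic points; counting the corners that see a point; Euler's formula. -/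

theorem isOpen_cross_ne (u p : ℂ) : IsOpen {x | cross u (x - p) ≠ 0} :=
  isOpen_ne_fun ((continuous_cross u).comp (by fun_prop)) continuous_const

theorem dense_cross_ne {u : ℂ} (hu : u ≠ 0) (p : ℂ) : Dense {x | cross u (x - p) ≠ 0} := by
  have hI := cross_I_mul_pos hu
  intro x
  by_cases hx : cross u (x - p) = 0
  · have ht : Tendsto (fun ε : ℝ => x + ε • (Complex.I * u)) (𝓝[>] 0) (𝓝 x) := by
      have hc : Continuous fun ε : ℝ => x + ε • (Complex.I * u) := by fun_prop
      have := hc.tendsto 0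
      rw [zero_smul, add_zero] at this
      exact this.mono_left nhdsWithin_le_nhds
    refine mem_closure_of_tendsto ht ?_
    filter_upwards [self_mem_nhdsWithin] with ε hε
    rw [add_sub_right_comm, cross_add_right, hx, zero_add, cross_smul_right]
    exact (mul_pos hε hI).ne'
  · exact subset_closure hx

section Tiling

variable {W : Type*} {m : W → ℕ} {k : ℕ} {R : Fin (k + 3) → ℂ}
  {t t' : ∀ w, Fin (m w + 3) → ℂ}

/-- `x` is on none of the lines in the directions of the edges of the `t w` through the points
`q c` that correspond to the corners. -/
def Generic (t : ∀ w, Fin (m w + 3) → ℂ) (q : Corner m → ℂ) (x : ℂ) : Prop :=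
  ∀ c, cross (inVec t c) (x - q c) ≠ 0 ∧ cross (outVec t c) (x - q c) ≠ 0

/-- The corner `c`, moved to `q c`, or the opposite cone contains `x`. -/
def CornerSees (t : ∀ w, Fin (m w + 3) → ℂ) (q : Corner m → ℂ) (c : Corner m) (x : ℂ) : Prop :=
  0 < cross (inVec t c) (x - q c) * cross (outVec t c) (x - q c)

namespace NondegTiling

theorem dense_generic [Finite W] (h : NondegTiling R t) (q : Corner m → ℂ) :
    Dense {x | Generic t q x} := by
  have e : {x | Generic t q x} = ⋂ c, ({x | cross (inVec t c) (x - q c) ≠ 0} ∩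
      {x | cross (outVec t c) (x - q c) ≠ 0}) := by
    ext x; simp only [Generic, Set.mem_ofPred_eq, Set.mem_iInter, Set.mem_inter_iff]
  rw [e]
  refine dense_iInter_of_isOpen (fun c => (isOpen_cross_ne _ _).inter (isOpen_cross_ne _ _))
    fun c => ?_
  exact (dense_cross_ne (h.inVec_ne_zero c) _).inter_of_isOpen_left
    (dense_cross_ne (h.outVec_ne_zero c) _) (isOpen_cross_ne _ _)

theorem exists_generic [Finite W] (h : NondegTiling R t) (q : Corner m → ℂ) {U : Set ℂ}
    (hU : IsOpen U) (hne : U.Nonempty) : ∃ x ∈ U, Generic t q x := by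
  obtain ⟨x, hx, hg⟩ := (h.dense_generic q).inter_open_nonempty U hU hne
  exact ⟨x, hx, hg⟩

variable [Fintype W]

/-- The number of corners that see `x`, computed tile by tile. -/
theorem card_cornerSees (ht' : ∀ w, InShapeSpace (t w) (t' w)) {a : W → ℝ}
    {s : ∀ w, Fin (m w + 3) → ℂ} (hs : ∀ w, ∃ c : ℂ, ∀ i, s w i = a w • t' w i + c) {x : ℂ}
    (hx : Generic t (pt s) x) :
    (univ.filter fun c => CornerSees t (pt s) c x).card =
      ∑ w, (m w + 1) + 2 * (univ.filter fun w => x ∈ interior (region (s w))).card := by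
  have key : ∀ w, (univ.filter fun i => CornerSees t (pt s) ⟨w, i⟩ x).card =
      m w + 1 + 2 * if x ∈ interior (region (s w)) then 1 else 0 := by
    intro w
    obtain ⟨hc, r, hr, he⟩ := ht' w
    obtain ⟨c, hsw⟩ := hs w
    -- The ratios of edge vectors of `t' w` and `t w` have a common sign, so seeing means the same
    -- for both families of directions.
    have hrr : ∀ i j, 0 < r i * r j := by
      intro i j
      rcases hr with hr | hr
      · exact mul_pos (hr i) (hr j)
      · exact mul_pos_of_neg_of_neg (hr i) (hr j)
    have hr0 : ∀ i, r i ≠ 0 := fun i h0 => by have := hrr i i; simp [h0] at this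
    rw [← hc.card_sees hsw (x := x) fun i => ?_]
    · congr 1
      ext i
      rw [mem_filter, mem_filter]
      simp only [mem_univ, true_and, CornerSees, Sees, he, ← Complex.real_smul, cross_smul_left]
      have e : r (i - 1) * cross (edgeVec (t w) (i - 1)) (x - s w i) *
          (r i * cross (edgeVec (t w) i) (x - s w i)) = (r (i - 1) * r i) *
          (cross (edgeVec (t w) (i - 1)) (x - s w i) * cross (edgeVec (t w) i) (x - s w i)) := by
        ring
      rw [e, mul_pos_iff_of_pos_left (hrr _ _)]
      rfl
    · rw [he, ← Complex.real_smul, cross_smul_left]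
      exact mul_ne_zero (hr0 i) (hx ⟨w, i⟩).2
  rw [Finset.card_filter, Fintype.sum_sigma]
  simp only [← Finset.card_filter, key, Finset.sum_add_distrib, ← Finset.mul_sum]

/-- The corner `j` of `R`, moved to `q`, or the opposite cone contains `x`. -/
def _root_.PolygonTiling.BoundarySees (R : Fin (k + 3) → ℂ) (j : Fin (k + 3)) (q x : ℂ) : Prop :=
  0 < cross (edgeVec R (j - 1)) (x - q) * cross (edgeVec R j) (x - q)

omit [Fintype W] in
theorem cornerSees_iff_of_isCornerOf {j : Fin (k + 3)} {c : Corner m} (hC : IsCornerOf R t j c)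
    (q : Corner m → ℂ) (x : ℂ) : CornerSees t q c x ↔ BoundarySees R j (q c) x := by
  obtain ⟨r, hr, ho⟩ := hC.out_eq
  obtain ⟨r', hr', hi⟩ := hC.in_eq
  rw [CornerSees, BoundarySees, ho, hi, cross_smul_left, cross_smul_left]
  have e : r' * cross (edgeVec R (j - 1)) (x - q c) * (r * cross (edgeVec R j) (x - q c)) =
    (r' * r) * (cross (edgeVec R (j - 1)) (x - q c) * cross (edgeVec R j) (x - q c)) := by ring
  rw [e, mul_pos_iff_of_pos_left (mul_pos hr' hr)]

/-- The number of corners that see `x`, computed vertex by vertex. -/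
theorem sum_card_cornerSees (t : ∀ w, Fin (m w + 3) → ℂ) (q : Corner m → ℂ) (x : ℂ) :
    (univ.filter fun c => CornerSees t q c x).card =
      ∑ p ∈ verts t, (univ.filter fun c => pt t c = p ∧ CornerSees t q c x).card := by
  rw [Finset.card_eq_sum_card_fiberwise (f := pt t) (t := verts t)
    (fun c _ => pt_mem_verts t c)]
  refine Finset.sum_congr rfl fun p _ => ?_
  rw [Finset.filter_filter]
  congr 1
  ext c
  simp only [mem_filter, mem_univ, true_and]
  exact and_comm

theorem sum_boundary (h : NondegTiling R t) (Q : Fin (k + 3) → Prop) [DecidablePred Q] :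
    ∑ p ∈ verts t, (univ.filter fun j => R j = p ∧ Q j).card = (univ.filter Q).card := by
  rw [Finset.card_eq_sum_card_fiberwise (f := R) (t := verts t) (fun j _ => h.R_mem_verts j)]
  refine Finset.sum_congr rfl fun p _ => ?_
  rw [Finset.filter_filter]
  congr 1
  ext c
  simp only [mem_filter, mem_univ, true_and]
  exact and_comm

omit [Fintype W] in
theorem boundary_fiber_tee (h : NondegTiling R t) {p e : ℂ} (hT : IsTee R t p e)
    (Q : Fin (k + 3) → Prop) [DecidablePred Q] : (univ.filter fun j => R j = p ∧ Q j).card = 0 := by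
  rw [Finset.card_eq_zero, Finset.filter_eq_empty_iff]
  rintro j - ⟨rfl, -⟩
  exact h.not_isTee_corner hT

theorem corner_fiber (h : NondegTiling R t) {j : Fin (k + 3)} {c : Corner m}
    (hC : IsCornerOf R t j c) (Q : Fin (k + 3) → Prop) [DecidablePred Q]
    (S : Corner m → Prop) [DecidablePred S] :
    (univ.filter fun c' => pt t c' = R j ∧ S c').card = (if S c then 1 else 0) ∧
      (univ.filter fun j' => R j' = R j ∧ Q j').card = if Q j then 1 else 0 := by
  have e1 : (univ.filter fun c' => pt t c' = R j ∧ S c') = if S c then {c} else ∅ := by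
    ext c'
    simp only [mem_filter, mem_univ, true_and]
    split_ifs with hS
    · rw [mem_singleton]
      exact ⟨fun hc => h.eq_of_isCornerOf hC hc.1, fun hc => hc ▸ ⟨hC.pt_eq, hS⟩⟩
    · simp only [notMem_empty, iff_false, not_and]
      intro hc
      rwa [h.eq_of_isCornerOf hC hc]
  have e2 : (univ.filter fun j' => R j' = R j ∧ Q j') = if Q j then {j} else ∅ := by
    ext j'
    simp only [mem_filter, mem_univ, true_and]
    split_ifs with hS
    · rw [mem_singleton]
      exact ⟨fun hc => h.hR.injective hc.1, by rintro rfl; exact ⟨rfl, hS⟩⟩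
    · simp only [notMem_empty, iff_false, not_and]
      intro hc
      rwa [h.hR.injective hc]
  rw [e1, e2]
  constructor <;> split_ifs <;> simp

/-- For corners moved by a map of the vertices, exactly one corner at each vertex sees `x`, except
for the corners of `R`. -/
theorem card_cornerSees_add (h : NondegTiling R t) (f : ℂ → ℂ) {x : ℂ}
    (hx : Generic t (fun c => f (pt t c)) x) :
    (univ.filter fun c => CornerSees t (fun c => f (pt t c)) c x).card +
      (univ.filter fun j => ¬ BoundarySees R j (f (R j)) x).card = (verts t).card := by
  rw [sum_card_cornerSees, ← h.sum_boundary, ← Finset.sum_add_distrib, Finset.card_eq_sum_ones]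
  refine Finset.sum_congr rfl fun p hp => ?_
  obtain ⟨c, -, rfl⟩ := mem_image.1 hp
  rcases h.tee_or_corner c with ⟨e, hT⟩ | ⟨j, hC⟩
  · rw [h.boundary_fiber_tee hT, add_zero, Finset.card_eq_one]
    obtain ⟨c₁, hc₁, r, hr, ho⟩ := hT.exists_first h
    have hne : cross e (x - f (pt t c)) ≠ 0 := by
      have : cross (outVec t c₁) (x - f (pt t c₁)) ≠ 0 := (hx c₁).2
      rw [ho, cross_smul_left, hc₁] at this
      exact right_ne_zero_of_mul this
    obtain ⟨c₀, ⟨h1, h2⟩, h3⟩ := hT.existsUnique_sees h hne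
      (fun c' hc' => hc' ▸ (hx c').1)
      (fun c' hc' => hc' ▸ (hx c').2)
    refine ⟨c₀, ?_⟩
    ext c'
    simp only [mem_filter, mem_univ, true_and, mem_singleton]
    constructor
    · rintro ⟨a1, a2⟩
      exact h3 c' ⟨a1, a1 ▸ a2⟩
    · rintro rfl
      refine ⟨h1, ?_⟩
      rw [← h1] at h2
      exact h2
  · have e := cornerSees_iff_of_isCornerOf hC (fun c => f (pt t c)) x
    rw [hC.pt_eq]
    obtain ⟨e1, e2⟩ := h.corner_fiber hC (fun j => ¬ BoundarySees R j (f (R j)) x)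
      (fun c => CornerSees t (fun c => f (pt t c)) c x)
    rw [e1, e2]
    rw [hC.pt_eq] at e
    by_cases hS : BoundarySees R j (f (R j)) x
    · rw [if_pos (e.2 hS), if_neg (not_not.2 hS)]
    · rw [if_neg (fun h' => hS (e.1 h')), if_pos hS]

/-- Euler's formula. -/
theorem card_verts (h : NondegTiling R t) : (verts t).card = ∑ w, (m w + 1) + 2 := by
  -- For the identity map and a generic `x` inside `R`, all corners of `R` see `x` and exactly one
  -- tile contains it; the counts by tiles and by vertices then give the number of vertices.
  obtain ⟨x, hxR, hx⟩ := h.exists_generic (pt t) isOpen_interior h.hR.interior_nonempty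
  have h1 := h.card_cornerSees_add (fun z => z) hx
  have ht' : ∀ w, InShapeSpace (t w) (t w) := fun w =>
    ⟨h.ht w, fun _ => 1, Or.inl fun _ => one_pos, fun i => by simp⟩
  have h2 := card_cornerSees ht' (a := fun _ => 1) (s := t) (fun w => ⟨0, fun i => by simp⟩) hx
  have h3 : (univ.filter fun j => ¬ BoundarySees R j (R j) x).card = 0 := by
    rw [Finset.card_eq_zero, Finset.filter_eq_empty_iff]
    intro j _
    have hi := h.hR.mem_interior_iff.1 hxR
    rw [not_not, BoundarySees]
    refine mul_pos ?_ (hi j)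
    have := hi (j - 1)
    rwa [IsConvexPolygon.cross_prev] at this
  have h4 : (univ.filter fun w => x ∈ interior (region (t w))).card = 1 := by
    have hx' := interior_subset hxR
    rw [← h.hT.1, Set.mem_iUnion] at hx'
    obtain ⟨w, hw⟩ := hx'
    have hin : x ∈ interior (region (t w)) := by
      refine (h.ht w).mem_interior_iff.2 fun i => ?_
      exact ((h.ht w).mem_region_iff.1 hw i).lt_of_ne' (hx ⟨w, i⟩).2
    rw [Finset.card_eq_one]
    refine ⟨w, ?_⟩
    ext w'
    simp only [mem_filter, mem_univ, true_and, mem_singleton]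
    exact ⟨fun hw' => h.tile_eq hw' hw, fun e => e ▸ hin⟩
  change (univ.filter fun c => CornerSees t (pt t) c x).card + _ = _ at h1
  rw [h2, h3, h4] at h1
  omega

end NondegTiling

end Tiling

/-! ### Solutions of the linear system and the index formula. -/

section Tiling

variable {W : Type*} {m : W → ℕ} {k : ℕ} {R : Fin (k + 3) → ℂ}
  {t t' : ∀ w, Fin (m w + 3) → ℂ}

/-- The vertex map `f` sends the tiles `t w` to homothetic copies of `t' w` with factors `a w`. -/
def IsSolution (t t' : ∀ w, Fin (m w + 3) → ℂ) (f : ℂ → ℂ) (a : W → ℝ) : Prop :=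
  ∀ c : Corner m, f (pt t (next c)) - f (pt t c) = a c.1 • outVec t' c

/-- The vertex map `f` sends the edges of `R` to lines that have the point `x` on their left. -/
def LeftOf (R : Fin (k + 3) → ℂ) (f : ℂ → ℂ) (x : ℂ) : Prop :=
  ∀ j, 0 < cross (edgeVec R j) (x - f (R j))

theorem exists_shape_ratio (ht' : ∀ w, InShapeSpace (t w) (t' w)) (w : W) :
    ∃ r : Fin (m w + 3) → ℝ, ((∀ i, 0 < r i) ∨ ∀ i, r i < 0) ∧ (∀ i, r i ≠ 0) ∧
      ∀ i, edgeVec (t' w) i = r i • edgeVec (t w) i := by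
  obtain ⟨-, r, hr, he⟩ := ht' w
  refine ⟨r, hr, fun i h0 => ?_, fun i => by rw [he, Complex.real_smul]⟩
  rcases hr with hr | hr
  · exact (hr i).ne' h0
  · exact (hr i).ne h0

namespace IsSolution

variable {f g : ℂ → ℂ} {a b : W → ℝ}

theorem sub (hf : IsSolution t t' f a) (hg : IsSolution t t' g b) (l : ℝ) :
    IsSolution t t' (fun z => f z - l • g z) (fun w => a w - l * b w) := by
  intro c
  have h1 := hf c
  have h2 := hg c
  simp only
  rw [sub_smul, mul_smul, ← h1, ← h2, smul_sub]
  ring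

theorem neg (hf : IsSolution t t' f a) : IsSolution t t' (fun z => -f z) (fun w => -a w) := by
  intro c
  have h1 := hf c
  rw [neg_smul, ← h1]
  ring

theorem homothetic (hf : IsSolution t t' f a) (w : W) :
    ∃ c : ℂ, ∀ i, f (t w i) = a w • t' w i + c := by
  refine ⟨f (t w 0) - a w • t' w 0, fun i => ?_⟩
  refine fin_cyclic_induction (Q := fun i => f (t w i) = a w • t' w i + (f (t w 0) - a w • t' w 0))
    0 (by ring) (fun i hi => ?_) i
  have h1 : f (t w (i + 1)) - f (t w i) = a w • edgeVec (t' w) i := hf ⟨w, i⟩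
  rw [sub_eq_iff_eq_add.1 h1, hi, edgeVec, smul_sub]
  ring

theorem tile_eq (hf : IsSolution t t' f a) {w : W} (ha : a w = 0) (i j : Fin (m w + 3)) :
    f (t w i) = f (t w j) := by
  obtain ⟨c, hc⟩ := hf.homothetic w
  rw [hc, hc, ha, zero_smul, zero_smul]

variable [Fintype W]

theorem eq_of_zero (hf : IsSolution t t' f a) (h : NondegTiling R t) (ha : ∀ w, a w = 0)
    (c c' : Corner m) : f (pt t c) = f (pt t c') :=
  h.connected f (fun c => by
    have := hf c
    rw [ha, zero_smul] at this
    exact (sub_eq_zero.1 this).symm) c c'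

/-- The images of the vertices in a segment are on a line parallel to it. -/
theorem collinear (hf : IsSolution t t' f a) (h : NondegTiling R t)
    (ht' : ∀ w, InShapeSpace (t w) (t' w)) {b : Set ℂ} (hb : b ∈ maximalSegments t) {x y : ℂ}
    (hx : x ∈ b) (hy : y ∈ b) {c c' : Corner m} (hc : pt t c ∈ b) (hc' : pt t c' ∈ b) :
    cross (y - x) (f (pt t c) - f (pt t c')) = 0 := by
  rw [cross_sub_right, sub_eq_zero]
  refine h.eq_of_mem_segment hb (fun z => cross (y - x) (f z)) (fun c₁ hc₁ => ?_) hc hc'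
  obtain ⟨r, -, -, hr⟩ := exists_shape_ratio ht' c₁.1
  have h1 := hf c₁
  have h2 : outVec t' c₁ = r c₁.2 • outVec t c₁ := hr c₁.2
  have h3 := h.outVec_cross (c := c₁) (hc₁ ▸ hx) (hc₁ ▸ hy)
  rw [cross_comm, neg_eq_zero] at h3
  rw [sub_eq_iff_eq_add.1 h1, cross_add_right, h2, cross_smul_right, cross_smul_right, h3, mul_zero,
    mul_zero, zero_add]

theorem collinear_R (hf : IsSolution t t' f a) (h : NondegTiling R t)
    (ht' : ∀ w, InShapeSpace (t w) (t' w)) {j : Fin (k + 3)} {p q : ℂ} (hp : p ∈ verts t)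
    (hq : q ∈ verts t) (hpj : p ∈ edge R j) (hqj : q ∈ edge R j) :
    cross (edgeVec R j) (f p - f q) = 0 := by
  obtain ⟨c, -, rfl⟩ := mem_image.1 hp
  obtain ⟨c', -, rfl⟩ := mem_image.1 hq
  exact hf.collinear h ht' (h.edge_R_mem j) (left_mem_segment ℝ _ _) (right_mem_segment ℝ _ _)
    hpj hqj

theorem cross_prev (hf : IsSolution t t' f a) (h : NondegTiling R t)
    (ht' : ∀ w, InShapeSpace (t w) (t' w)) (j : Fin (k + 3)) (x : ℂ) :
    cross (edgeVec R (j - 1)) (x - f (R j)) = cross (edgeVec R (j - 1)) (x - f (R (j - 1))) := by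
  have := hf.collinear_R h ht' (h.R_mem_verts (j - 1)) (h.R_mem_verts j)
    (IsConvexPolygon.vertex_mem_edge R (j - 1)) (IsConvexPolygon.vertex_mem_edge_sub_one R j)
  have e : x - f (R j) = x - f (R (j - 1)) + (f (R (j - 1)) - f (R j)) := by ring
  rw [e, cross_add_right, this, add_zero]

/-- The index formula. -/
theorem index (hf : IsSolution t t' f a) (h : NondegTiling R t)
    (ht' : ∀ w, InShapeSpace (t w) (t' w)) {x : ℂ} (hx : Generic t (fun c => f (pt t c)) x) :
    2 * (univ.filter fun w => x ∈ interior (region fun i => f (t w i))).card +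
      (univ.filter fun j => ¬ BoundarySees R j (f (R j)) x).card = 2 := by
  -- The same corners are counted by vertices and by tiles; Euler's formula cancels the terms that
  -- do not depend on `x`.
  have h1 := h.card_cornerSees_add f hx
  have h2 := NondegTiling.card_cornerSees ht' (s := fun w i => f (t w i)) hf.homothetic hx
  change (univ.filter fun c => CornerSees t (fun c => f (pt t c)) c x).card = _ at h2
  rw [h2, h.card_verts] at h1
  omega

theorem generic_R (h : NondegTiling R t) {x : ℂ} (hx : Generic t (fun c => f (pt t c)) x)
    (j : Fin (k + 3)) : cross (edgeVec R j) (x - f (R j)) ≠ 0 := by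
  obtain ⟨c, hc⟩ := h.exists_isCornerOf j
  obtain ⟨r, hr, ho⟩ := hc.out_eq
  have : cross (outVec t c) (x - f (pt t c)) ≠ 0 := (hx c).2
  rw [ho, cross_smul_left, hc.pt_eq] at this
  exact right_ne_zero_of_mul this

theorem leftOf_or (hf : IsSolution t t' f a) (h : NondegTiling R t)
    (ht' : ∀ w, InShapeSpace (t w) (t' w)) {x : ℂ} (hx : Generic t (fun c => f (pt t c)) x)
    (hs : ∀ j, BoundarySees R j (f (R j)) x) :
    LeftOf R f x ∨ ∀ j, cross (edgeVec R j) (x - f (R j)) < 0 := by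
  have hs' : ∀ j, 0 < cross (edgeVec R (j - 1)) (x - f (R (j - 1))) *
      cross (edgeVec R j) (x - f (R j)) := fun j => by
    rw [← hf.cross_prev h ht']; exact hs j
  rcases lt_or_gt_of_ne (generic_R h hx 0) with h0 | h0
  · refine Or.inr (fin_cyclic_induction 0 h0 fun j hj => ?_)
    have := hs' (j + 1)
    rw [add_sub_cancel_right] at this
    exact neg_of_mul_pos_right this hj.le
  · refine Or.inl (fin_cyclic_induction 0 h0 fun j hj => ?_)
    have := hs' (j + 1)
    rw [add_sub_cancel_right] at this
    exact pos_of_mul_pos_right this hj.le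

/-- A point inside a tile is on the same side of all edges of the boundary. -/
theorem leftOf_or_of_mem_interior (hf : IsSolution t t' f a) (h : NondegTiling R t)
    (ht' : ∀ w, InShapeSpace (t w) (t' w)) {x : ℂ} (hx : Generic t (fun c => f (pt t c)) x)
    {w : W} (hw : x ∈ interior (region fun i => f (t w i))) :
    LeftOf R f x ∨ ∀ j, cross (edgeVec R j) (x - f (R j)) < 0 := by
  have h1 := hf.index h ht' hx
  have h2 : 0 < (univ.filter fun w => x ∈ interior (region fun i => f (t w i))).card :=
    Finset.card_pos.2 ⟨w, by simpa using hw⟩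
  have h3 : (univ.filter fun j => ¬ BoundarySees R j (f (R j)) x).card = 0 := by omega
  rw [Finset.card_eq_zero, Finset.filter_eq_empty_iff] at h3
  exact hf.leftOf_or h ht' hx fun j => not_not.1 (h3 (mem_univ j))

omit [Fintype W] in
theorem isConvexPolygon (hf : IsSolution t t' f a) (ht' : ∀ w, InShapeSpace (t w) (t' w)) {w : W}
    (ha : a w ≠ 0) : IsConvexPolygon fun i => f (t w i) := by
  obtain ⟨c, hc⟩ := hf.homothetic w
  exact (ht' w).1.homothetic ha c hc

/-- A generic point of a tile that has not collapsed leaves, by the index formula, no corner of the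
boundary that does not see it; so it is on the same side of all boundary lines, and the sign of `f`
makes it the left side. -/
theorem exists_leftOf (hf : IsSolution t t' f a) (h : NondegTiling R t)
    (ht' : ∀ w, InShapeSpace (t w) (t' w)) (ha : ∃ w, a w ≠ 0) :
    ∃ x, LeftOf R f x ∨ LeftOf R (fun z => -f z) x := by
  obtain ⟨w, hw⟩ := ha
  obtain ⟨x, hx, hg⟩ := h.exists_generic (fun c => f (pt t c)) isOpen_interior
    (hf.isConvexPolygon ht' hw).interior_nonempty
  rcases hf.leftOf_or_of_mem_interior h ht' hg hx with h1 | h1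
  · exact ⟨x, Or.inl h1⟩
  · refine ⟨-x, Or.inr fun j => ?_⟩
    have := h1 j
    rw [← neg_sub', cross_neg_right]
    linarith

section Positive

variable {x₀ : ℂ}

/-- All vertices are in the polygon bounded by the image of the boundary. -/
theorem cross_nonneg (hf : IsSolution t t' f a) (h : NondegTiling R t)
    (ht' : ∀ w, InShapeSpace (t w) (t' w)) (ha : ∃ w, a w ≠ 0) (hx₀ : LeftOf R f x₀)
    (c : Corner m) (j : Fin (k + 3)) : 0 ≤ cross (edgeVec R j) (f (pt t c) - f (R j)) := by
  have key : ∀ w, a w ≠ 0 → ∀ i j, 0 ≤ cross (edgeVec R j) (f (t w i) - f (R j)) := by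
    intro w hw i j
    have hP := hf.isConvexPolygon ht' hw
    have hcl : IsClosed {x | 0 ≤ cross (edgeVec R j) (x - f (R j))} :=
      isClosed_le continuous_const ((continuous_cross _).comp (by fun_prop))
    have hsub : interior (region fun i => f (t w i)) ∩ {x | Generic t (fun c => f (pt t c)) x} ⊆
        {x | 0 ≤ cross (edgeVec R j) (x - f (R j))} := by
      rintro x ⟨hx, hg⟩
      rcases hf.leftOf_or_of_mem_interior h ht' hg hx with h1 | h1
      · exact (h1 j).le
      -- A point on the right of all boundary lines and `x₀` on their left would differ by a vector
      -- with negative cross products with all edges of `R`, although these add up to zero.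
      · exfalso
        refine not_forall_cross_edgeVec_neg R (x - x₀) fun j => ?_
        have e : x - x₀ = (x - f (R j)) - (x₀ - f (R j)) := by ring
        rw [e, cross_sub_right]
        linarith [h1 j, hx₀ j]
    have h2 := closure_minimal (((h.dense_generic _).open_subset_closure_inter
      isOpen_interior).trans (closure_minimal hsub hcl)) hcl
    rw [hP.closure_interior] at h2
    exact h2 (vertex_mem_region (fun i => f (t w i)) i)
  -- Now only collapsed tiles touch the point `f (pt t c)`. By connectivity all vertices would go
  -- there, including those of a tile with nonzero factor.
  by_contra hn
  have hF := h.connected (fun z => f z = f (pt t c)) (fun c₁ => by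
    by_cases h0 : a c₁.1 = 0
    · have := hf c₁
      rw [h0, zero_smul, sub_eq_zero] at this
      rw [this]
    · have hne : ∀ i, f (t c₁.1 i) ≠ f (pt t c) := fun i hi => hn (hi ▸ key c₁.1 h0 i j)
      exact propext ⟨fun h' => absurd h' (hne _), fun h' => absurd h' (hne _)⟩) c
  obtain ⟨w, hw⟩ := ha
  have h1 : f (pt t ⟨w, 0⟩) = f (pt t c) := (hF ⟨w, 0⟩).mp rfl
  exact hn (h1 ▸ key w hw 0 j)

theorem exists_ratio_nonneg (hf : IsSolution t t' f a) (h : NondegTiling R t)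
    (ht' : ∀ w, InShapeSpace (t w) (t' w)) (ha : ∃ w, a w ≠ 0) (hx₀ : LeftOf R f x₀)
    (j : Fin (k + 3)) : ∃ r : ℝ, 0 ≤ r ∧ f (R (j + 1)) - f (R j) = r • edgeVec R j := by
  have h1 := hf.collinear_R h ht' (h.R_mem_verts (j + 1)) (h.R_mem_verts j)
    (right_mem_segment ℝ _ _) (left_mem_segment ℝ _ _)
  obtain ⟨r, hr⟩ := exists_smul_of_cross_eq_zero (h.hR.edgeVec_ne_zero j) h1
  refine ⟨r, ?_, hr⟩
  obtain ⟨c, hc⟩ := h.exists_isCornerOf (j + 1)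
  have h2 := hf.cross_nonneg h ht' ha hx₀ c (j - 1)
  rw [← hf.cross_prev h ht', hc.pt_eq, hr, cross_smul_right] at h2
  exact nonneg_of_mul_nonneg_left h2 (h.hR.cross_edgeVec_pos j)

end Positive

end IsSolution

end Tiling

/-! ### No edge of `R` shrinks to a point. -/

section Tiling

variable {W : Type*} [Fintype W] {m : W → ℕ} {k : ℕ} {R : Fin (k + 3) → ℂ}
  {t t' : ∀ w, Fin (m w + 3) → ℂ}

namespace IsSolution

variable {f : ℂ → ℂ} {a : W → ℝ} {x₀ : ℂ}

/-- The image of the edge `j` of `R` shrinks to a point only if the image of the vertices touches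
its line nowhere else. -/
theorem cross_pos_of_shrunk (hf : IsSolution t t' f a) (h : NondegTiling R t)
    (ht' : ∀ w, InShapeSpace (t w) (t' w)) (ha : ∃ w, a w ≠ 0) (hx₀ : LeftOf R f x₀)
    {j : Fin (k + 3)} (hj : f (R (j + 1)) = f (R j)) (c : Corner m) (hc : f (pt t c) ≠ f (R j)) :
    0 < cross (edgeVec R j) (f (pt t c) - f (R j)) := by
  refine (hf.cross_nonneg h ht' ha hx₀ c j).lt_of_ne fun h0 => hc ?_
  obtain ⟨r, hr⟩ := exists_smul_of_cross_eq_zero (h.hR.edgeVec_ne_zero j) h0.symm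
  -- The lines of the edges `j - 1` and `j + 1` pass through the same point `f (R j)` and bound the
  -- position on the line of edge `j` from both sides.
  have h1 := hf.cross_nonneg h ht' ha hx₀ c (j - 1)
  have h2 := hf.cross_nonneg h ht' ha hx₀ c (j + 1)
  have h3 := h.hR.cross_edgeVec_pos j
  have h4 := h.hR.cross_edgeVec_pos (j + 1)
  rw [← hf.cross_prev h ht', hr, cross_smul_right] at h1
  rw [hj, hr, cross_smul_right, cross_comm] at h2
  rw [add_sub_cancel_right] at h4
  have h5 : 0 ≤ r := nonneg_of_mul_nonneg_left h1 h3
  have h6 : r ≤ 0 := by nlinarith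
  rw [le_antisymm h6 h5, zero_smul, sub_eq_zero] at hr
  exact hr

/-- Where the edge `j` of `R` shrinks to a point, the corners at a highest vertex that is sent to
that point are below this vertex or strictly above it. -/
theorem corner_cases_of_shrunk (hf : IsSolution t t' f a) (h : NondegTiling R t)
    (ht' : ∀ w, InShapeSpace (t w) (t' w)) (ha : ∃ w, a w ≠ 0) (hx₀ : LeftOf R f x₀)
    {j : Fin (k + 3)} (hj : f (R (j + 1)) = f (R j)) {c : Corner m} (hc : f (pt t c) = f (R j))
    (hmax : ∀ c', f (pt t c') = f (R j) →
      cross (edgeVec R j) (pt t c') ≤ cross (edgeVec R j) (pt t c)) :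
    (cross (edgeVec R j) (outVec t c) ≤ 0 ∧ 0 ≤ cross (edgeVec R j) (inVec t c)) ∨
      (0 < cross (edgeVec R j) (outVec t c) ∧ cross (edgeVec R j) (inVec t c) < 0) := by
  have hn : f (pt t (next c)) - f (pt t c) = a c.1 • outVec t' c := hf c
  have hp : f (pt t c) - f (pt t (prev c)) = a c.1 • inVec t' c := by
    have := hf (prev c)
    rwa [next_prev] at this
  by_cases h0 : a c.1 = 0
  -- A collapsed tile has its neighbouring vertices sent to the same point, so by maximality they
  -- are not higher than the vertex of `c`.
  · rw [h0, zero_smul, sub_eq_zero] at hn hp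
    have h1 := hmax (next c) (hn.trans hc)
    have h2 := hmax (prev c) (hp.symm.trans hc)
    rw [pt_next, cross_add_right] at h1
    rw [pt_prev, cross_sub_right] at h2
    exact Or.inl ⟨by linarith, by linarith⟩
  · obtain ⟨r, hr, hr0, hre⟩ := exists_shape_ratio ht' c.1
    have ho : outVec t' c = r c.2 • outVec t c := hre c.2
    have hi : inVec t' c = r (c.2 - 1) • inVec t c := hre (c.2 - 1)
    -- For a tile that has not collapsed, both neighbours are sent strictly above the line of edge
    -- `j`. The common sign of the factors decides whether both sides of the original corner go up
    -- or both go down.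
    have key : ∀ c', f (pt t c') ≠ f (pt t c) →
        0 < cross (edgeVec R j) (f (pt t c') - f (pt t c)) := by
      intro c' hne
      rw [hc] at hne ⊢
      exact hf.cross_pos_of_shrunk h ht' ha hx₀ hj c' hne
    have h1 := key (next c) (by
      intro h'
      rw [h', sub_self, ho, smul_smul, eq_comm, smul_eq_zero] at hn
      exact hn.elim (mul_ne_zero h0 (hr0 _)) (h.outVec_ne_zero c))
    have h2 := key (prev c) (by
      intro h'
      rw [h', sub_self, hi, smul_smul, eq_comm, smul_eq_zero] at hp
      exact hp.elim (mul_ne_zero h0 (hr0 _)) (h.inVec_ne_zero c))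
    rw [hn, ho, smul_smul, cross_smul_right] at h1
    rw [← neg_sub, hp, hi, smul_smul, cross_neg_right, cross_smul_right] at h2
    have hsgn : 0 < (a c.1 * r c.2) * (a c.1 * r (c.2 - 1)) := by
      have : 0 < r c.2 * r (c.2 - 1) := by
        rcases hr with hr | hr
        · exact mul_pos (hr _) (hr _)
        · exact mul_pos_of_neg_of_neg (hr _) (hr _)
      have := mul_pos (mul_self_pos.2 h0) this
      linarith
    rcases pos_and_pos_or_neg_and_neg_of_mul_pos hsgn with ⟨s1, s2⟩ | ⟨s1, s2⟩
    · right
      constructor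
      · exact pos_of_mul_pos_right h1 s1.le
      · nlinarith
    · left
      constructor
      · nlinarith
      · nlinarith

/-- With edge `j` as the horizontal, take a highest vertex among those sent to the point to which
this edge has shrunk. Each corner there is below it or has both sides going strictly up, so no
corner covers directions just above the horizontal. Hence this vertex is a tee with horizontal line
and its corners below, or a corner of `R`. Both cases are contradictory. -/
theorem not_shrunk (hf : IsSolution t t' f a) (h : NondegTiling R t)
    (ht' : ∀ w, InShapeSpace (t w) (t' w)) (ha : ∃ w, a w ≠ 0) (hx₀ : LeftOf R f x₀)
    (j : Fin (k + 3)) : f (R (j + 1)) ≠ f (R j) := by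
  intro hj
  set e := edgeVec R j with he
  have he0 : e ≠ 0 := h.hR.edgeVec_ne_zero j
  have hI := cross_I_mul_pos he0
  obtain ⟨cj, hcj⟩ := h.exists_isCornerOf j
  obtain ⟨c₀, hc₀, hmax⟩ := Set.exists_max_image {c : Corner m | f (pt t c) = f (R j)}
    (fun c => cross e (pt t c)) (Set.toFinite _) ⟨cj, by rw [Set.mem_ofPred_eq, hcj.pt_eq]⟩
  have hcases : ∀ c, pt t c = pt t c₀ → (cross e (outVec t c) ≤ 0 ∧ 0 ≤ cross e (inVec t c)) ∨
      (0 < cross e (outVec t c) ∧ cross e (inVec t c) < 0) := fun c hc =>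
    hf.corner_cases_of_shrunk h ht' ha hx₀ hj (by rw [hc]; exact hc₀)
      (fun c' hc' => by rw [hc]; exact hmax c' hc')
  have hup : 0 < cross e (x₀ - f (R j)) := hx₀ j
  -- A cone with both boundary rays in the lower half-plane stays there.
  have hdown : ∀ {u v d : ℂ}, 0 < cross u v → cross e v ≤ 0 → 0 ≤ cross e u → 0 ≤ cross u d →
      0 ≤ cross v d → cross e d ≤ 0 := by
    intro u v d huv h1 h2 h3 h4
    obtain ⟨α, β, hα, hβ, hd⟩ := exists_cone_combination huv h3 h4
    rw [hd, cross_sub_right, cross_smul_right, cross_smul_right]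
    nlinarith
  rcases h.tee_or_corner c₀ with ⟨e', hT⟩ | ⟨i, hC⟩
  -- Directions slightly above `e` and `-e` are in no cone at the tee, hence not on the side filled
  -- by its corners. For both signs of `σ` this forces the tee line to be horizontal, with its
  -- corners below.
  · have hside : ∀ σ : ℝ, σ ≠ 0 → ∀ᶠ ε : ℝ in 𝓝[>] 0,
        cross e' (σ • e + ε • (Complex.I * e)) ≤ 0 := by
      intro σ hσ
      have hev : ∀ᶠ ε : ℝ in 𝓝[>] 0, ∀ c : Corner m, pt t c = pt t c₀ →
          ¬ (0 ≤ cross (inVec t c) (σ • e + ε • (Complex.I * e)) ∧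
            0 ≤ cross (outVec t c) (σ • e + ε • (Complex.I * e))) := by
        refine eventually_all.2 fun c => ?_
        by_cases hc : pt t c = pt t c₀
        · rcases hcases c hc with ⟨h1, h2⟩ | ⟨h1, h2⟩
          · filter_upwards [self_mem_nhdsWithin] with ε hε _ hmem
            have := hdown (h.cone_pos c) h1 h2 hmem.1 hmem.2
            rw [cross_add_right, cross_smul_right, cross_self, mul_zero, zero_add,
              cross_smul_right] at this
            linarith [mul_pos hε hI]
          · rcases lt_or_gt_of_ne hσ with hσ | hσ
            · have := eventually_cross_add_smul_pos (u := -inVec t c) (ρ := σ • e) (Complex.I * e)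
                (by rw [cross_neg_left, cross_smul_right, cross_comm]; nlinarith)
              filter_upwards [this] with ε hε _ hmem
              rw [cross_neg_left] at hε
              linarith [hmem.1]
            · have := eventually_cross_add_smul_pos (u := -outVec t c) (ρ := σ • e) (Complex.I * e)
                (by rw [cross_neg_left, cross_smul_right, cross_comm]; nlinarith)
              filter_upwards [this] with ε hε _ hmem
              rw [cross_neg_left] at hε
              linarith [hmem.2]
        · exact Eventually.of_forall fun _ hc' => absurd hc' hc
      filter_upwards [hev] with ε hε
      by_contra hn
      push Not at hn
      obtain ⟨c, h1, h2⟩ := hT.cover _ hn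
      exact hε c h1 h2
    have hpar : cross e' e = 0 := by
      have hlim : ∀ σ : ℝ, σ ≠ 0 → σ * cross e' e ≤ 0 := by
        intro σ hσ
        by_contra hn
        push Not at hn
        obtain ⟨ε, h1, h2⟩ := ((hside σ hσ).and (eventually_cross_add_smul_pos (u := e')
          (ρ := σ • e) (Complex.I * e) (by rwa [cross_smul_right]))).exists
        linarith
      have h1 := hlim 1 one_ne_zero
      have h2 := hlim (-1) (by norm_num)
      linarith
    obtain ⟨l, hl⟩ := exists_smul_of_cross_eq_zero he0 (v := e') (by rw [cross_comm, hpar, neg_zero])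
    have hl0 : l < 0 := by
      obtain ⟨ε, h1, h2⟩ := ((hside 1 one_ne_zero).and self_mem_nhdsWithin).exists
      rw [hl, cross_smul_left, one_smul, cross_add_right, cross_self, zero_add,
        cross_smul_right] at h1
      refine lt_of_le_of_ne (not_lt.1 fun h0 => ?_) fun h0 => hT.ne (by rw [hl, h0, zero_smul])
      linarith [mul_pos h0 (mul_pos h2 hI)]
    rcases hT.src with ⟨w, i, hp, hsrc⟩ | ⟨i, hp, hsrc⟩
    · have hei : edgeVec (t w) i = (-l) • e := by rw [neg_smul, ← hl, hsrc, neg_neg]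
      set c₁ : Corner m := ⟨w, i⟩
      have hp1 : pt t c₀ ∈ h.seg c₁ := h.edge_subset_seg c₁ (openSegment_subset_segment ℝ _ _ hp)
      -- The segment carrying the tee is horizontal, so its vertices stay on the line of edge `j`,
      -- which the image meets only in the point `f (R j)`. Hence the tile `w` above this segment
      -- collapses.
      have hval : ∀ c, pt t c ∈ h.seg c₁ → f (pt t c) = f (R j) := by
        intro c hc
        by_contra hne
        have h1 := hf.cross_pos_of_shrunk h ht' ha hx₀ hj c hne
        have h2 := hf.collinear h ht' (h.seg_mem c₁) (h.pt_mem_seg c₁) (h.pt_next_mem_seg c₁) hc hp1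
        have e1 : pt t (next c₁) - pt t c₁ = (-l) • e := by
          rw [pt_next, add_sub_cancel_left]; exact hei
        rw [e1, cross_smul_left, hc₀] at h2
        rcases mul_eq_zero.1 h2 with h3 | h3
        · linarith
        · linarith
      have ha0 : a w = 0 := by
        have h1 : f (pt t (next c₁)) - f (pt t c₁) = a w • outVec t' c₁ := hf c₁
        rw [hval _ (h.pt_mem_seg c₁), hval _ (h.pt_next_mem_seg c₁), sub_self, eq_comm,
          smul_eq_zero] at h1
        exact h1.resolve_right ((ht' w).1.edgeVec_ne_zero i)
      -- This vertex of the collapsed tile is strictly above the edge through the chosen vertex,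
      -- against maximality.
      have h1 : f (t w (i - 1)) = f (R j) :=
        (hf.tile_eq ha0 (i - 1) i).trans (hval c₁ (h.pt_mem_seg c₁))
      have h2 := hmax ⟨w, i - 1⟩ h1
      have h3 := h.ht w i (i - 1) (by simp) (fun h' => fin_add_one_ne_sub_one i h'.symm)
      have h4 := ((h.ht w).mem_edge_iff i).1 (openSegment_subset_segment ℝ _ _ hp)
      have e2 : t w (i - 1) - t w i = (t w (i - 1) - pt t c₀) + (pt t c₀ - t w i) := by ring
      rw [e2, cross_add_right, h4.2, add_zero, hei, cross_smul_left, cross_sub_right] at h3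
      change cross e (t w (i - 1)) ≤ cross e (pt t c₀) at h2
      nlinarith
    -- If the tee is on an edge of `R`, this edge is directed against `e` and its image line passes
    -- through the same point; `x₀` cannot be on the left of both.
    · have h1 := hf.collinear_R h ht' (pt_mem_verts t c₀) (h.R_mem_verts i)
        (openSegment_subset_segment ℝ _ _ hp) (left_mem_segment ℝ _ _)
      have h2 := hx₀ i
      have e1 : x₀ - f (R i) = (x₀ - f (R j)) + (f (pt t c₀) - f (R i)) := by
        rw [show f (pt t c₀) = f (R j) from hc₀]; ring
      rw [e1, cross_add_right, h1, add_zero, ← hsrc, hl, cross_smul_left] at h2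
      nlinarith
  · have hfi : f (R i) = f (R j) := by rw [← hC.pt_eq]; exact hc₀
    have hcone := h.hR.cross_edgeVec_pos i
    obtain ⟨r, hr, ho⟩ := hC.out_eq
    obtain ⟨r', hr', hi⟩ := hC.in_eq
    have hcs := hcases c₀ rfl
    rw [ho, hi, cross_smul_right, cross_smul_right] at hcs
    rcases hcs with ⟨h1, h2⟩ | ⟨h1, h2⟩
    · have h3 := hx₀ (i - 1)
      rw [← hf.cross_prev h ht'] at h3
      have := hdown hcone (nonpos_of_mul_nonpos_right h1 hr) (nonneg_of_mul_nonneg_right h2 hr')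
        h3.le (hx₀ i).le
      rw [hfi] at this
      linarith
    -- With both sides going up, `R i` would be the only lowest vertex of `R`; but both ends of edge
    -- `j` are lowest.
    · have h1' : 0 < cross e (edgeVec R i) := pos_of_mul_pos_right h1 hr.le
      have h2' : cross e (edgeVec R (i - 1)) < 0 := by nlinarith
      have heq : ∀ l, cross e (R l - R i) ≤ 0 → R l = R i := by
        intro l hle
        obtain ⟨α, β, hα, hβ, hd⟩ := h.hR.vertex_cone i l
        rw [hd, cross_sub_right, cross_smul_right, cross_smul_right] at hle
        have hα0 : α = 0 := by nlinarith
        have hβ0 : β = 0 := by nlinarith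
        rw [hα0, hβ0, zero_smul, zero_smul, sub_zero, sub_eq_zero] at hd
        exact hd
      have h3 := h.hR.cross_vertex_nonneg j i
      have h4 := heq j (by rw [← neg_sub, cross_neg_right]; linarith)
      have h5 := heq (j + 1) (by
        have e1 : R (j + 1) - R i = e - (R i - R j) := by rw [he, edgeVec]; ring
        rw [e1, cross_sub_right, cross_self]; linarith)
      exact fin_add_one_ne j (h.hR.injective (h5.trans h4.symm))

/-- A nontrivial solution transforms `R` into a polygon of the same shape. -/
theorem exists_ratio_pos (hf : IsSolution t t' f a) (h : NondegTiling R t)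
    (ht' : ∀ w, InShapeSpace (t w) (t' w)) (ha : ∃ w, a w ≠ 0) (hx₀ : LeftOf R f x₀)
    (j : Fin (k + 3)) : ∃ r : ℝ, 0 < r ∧ f (R (j + 1)) - f (R j) = r • edgeVec R j := by
  obtain ⟨r, hr, he⟩ := hf.exists_ratio_nonneg h ht' ha hx₀ j
  refine ⟨r, hr.lt_of_ne' ?_, he⟩
  rintro rfl
  rw [zero_smul, sub_eq_zero] at he
  exact hf.not_shrunk h ht' ha hx₀ j he

theorem map_R_ne (hf : IsSolution t t' f a) (h : NondegTiling R t)
    (ht' : ∀ w, InShapeSpace (t w) (t' w)) (ha : ∃ w, a w ≠ 0) (j : Fin (k + 3)) :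
    f (R (j + 1)) ≠ f (R j) := by
  obtain ⟨x, hx | hx⟩ := hf.exists_leftOf h ht' ha
  · exact hf.not_shrunk h ht' ha hx j
  · intro h'
    obtain ⟨w, hw⟩ := ha
    exact hf.neg.not_shrunk h ht' ⟨w, neg_ne_zero.2 hw⟩ hx j (by rw [h'])

/-- Two solutions are proportional up to a translation. -/
theorem proportional {g : ℂ → ℂ} {b : W → ℝ} (hf : IsSolution t t' f a)
    (hg : IsSolution t t' g b) (h : NondegTiling R t) (ht' : ∀ w, InShapeSpace (t w) (t' w))
    (ha : ∃ w, a w ≠ 0) : ∃ l : ℝ, (∀ w, b w = l * a w) ∧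
      ∀ c c', g (pt t c) - l • f (pt t c) = g (pt t c') - l • f (pt t c') := by
  have h1 := hf.collinear_R h ht' (h.R_mem_verts (0 + 1)) (h.R_mem_verts 0)
    (right_mem_segment ℝ _ _) (left_mem_segment ℝ _ _)
  have h2 := hg.collinear_R h ht' (h.R_mem_verts (0 + 1)) (h.R_mem_verts 0)
    (right_mem_segment ℝ _ _) (left_mem_segment ℝ _ _)
  obtain ⟨r, hr⟩ := exists_smul_of_cross_eq_zero (h.hR.edgeVec_ne_zero 0) h1
  obtain ⟨q, hq⟩ := exists_smul_of_cross_eq_zero (h.hR.edgeVec_ne_zero 0) h2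
  have hr0 : r ≠ 0 := by
    rintro rfl
    rw [zero_smul, sub_eq_zero] at hr
    exact hf.map_R_ne h ht' ha 0 hr
  -- The multiple is chosen so that the difference shrinks edge 0 of `R`, which forces all its
  -- factors to vanish.
  have hs := hg.sub hf (q / r)
  have hz : ∀ w, b w - q / r * a w = 0 := by
    by_contra hn
    push Not at hn
    refine hs.map_R_ne h ht' hn 0 ?_
    have : (g (R (0 + 1)) - g (R 0)) - (q / r) • (f (R (0 + 1)) - f (R 0)) = 0 := by
      rw [hr, hq, smul_smul, div_mul_cancel₀ _ hr0, sub_self]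
    rw [smul_sub] at this
    linear_combination this
  exact ⟨q / r, fun w => sub_eq_zero.1 (hz w), fun c c' => hs.eq_of_zero h hz c c'⟩

end IsSolution

end Tiling

/-! ### The dimension of the space of solutions. -/

section Tiling

variable {W : Type*} [Fintype W] {m : W → ℕ} {k : ℕ} {R : Fin (k + 3) → ℂ}
  {t t' : ∀ w, Fin (m w + 3) → ℂ}

/-- The linear map whose kernel consists of the solutions. -/
noncomputable def defect (t t' : ∀ w, Fin (m w + 3) → ℂ) :
    (verts t → ℂ) × (W → ℝ) →ₗ[ℝ] Corner m → ℂ where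
  toFun p c := p.1 ⟨pt t (next c), pt_mem_verts t _⟩ - p.1 ⟨pt t c, pt_mem_verts t c⟩ -
    p.2 c.1 • outVec t' c
  map_add' p q := by
    ext c
    simp only [Prod.fst_add, Prod.snd_add, Pi.add_apply, add_smul]
    ring
  map_smul' r p := by
    ext c
    simp only [Prod.smul_fst, Prod.smul_snd, Pi.smul_apply, smul_sub, smul_eq_mul, mul_smul,
      RingHom.id_apply]

/-- The sums of a vector-valued function on the corners over the tiles, and the heights of its sums
over the segments in a family `B` with directions `u`. -/
noncomputable def closing {B : Type*} (S : Corner m → B → Prop) (u : B → ℂ) :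
    (Corner m → ℂ) →ₗ[ℝ] (W → ℂ) × (B → ℝ) where
  toFun y := (fun w => ∑ i, y ⟨w, i⟩, fun b => ∑ c, if S c b then cross (u b) (y c) else 0)
  map_add' y z := by
    ext x
    · simp [Finset.sum_add_distrib]
    · simp only [Prod.snd_add, Pi.add_apply, ← Finset.sum_add_distrib]
      refine Finset.sum_congr rfl fun c _ => ?_
      split_ifs
      · rw [cross_add_right]
      · rw [add_zero]
  map_smul' r y := by
    ext x
    · simp [Finset.mul_sum]
    · simp only [Prod.smul_snd, Pi.smul_apply, smul_eq_mul, Finset.mul_sum, RingHom.id_apply]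
      refine Finset.sum_congr rfl fun c _ => ?_
      split_ifs
      · rw [cross_smul_right]
      · rw [mul_zero]

/-- Extension by zero of a function on the vertices. -/
noncomputable def extend (t : ∀ w, Fin (m w + 3) → ℂ) (f : verts t → ℂ) (z : ℂ) : ℂ :=
  if hz : z ∈ verts t then f ⟨z, hz⟩ else 0

theorem extend_pt (f : verts t → ℂ) (c : Corner m) :
    extend t f (pt t c) = f ⟨pt t c, pt_mem_verts t c⟩ := dif_pos (pt_mem_verts t c)

theorem isSolution_of_mem_ker {p : (verts t → ℂ) × (W → ℝ)}
    (hp : p ∈ LinearMap.ker (defect t t')) : IsSolution t t' (extend t p.1) p.2 := by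
  intro c
  have : p.1 ⟨pt t (next c), pt_mem_verts t _⟩ - p.1 ⟨pt t c, pt_mem_verts t c⟩ -
    p.2 c.1 • outVec t' c = 0 := congrFun hp c
  rw [extend_pt, extend_pt]
  exact sub_eq_zero.1 this

namespace NondegTiling

theorem card_corner (h : NondegTiling R t) :
    Fintype.card (Corner m) + 2 = (verts t).card + 2 * Fintype.card W := by
  rw [h.card_verts, Fintype.card_sigma]
  simp only [Fintype.card_fin]
  rw [Finset.sum_add_distrib, Finset.sum_add_distrib]
  simp only [Finset.sum_const, Finset.card_univ, smul_eq_mul]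
  omega

/-- The edges of a tile add up to zero before and after applying the vertex map. Along an interior
segment the chain of edges has no boundary; its prescribed edge vectors are parallel to `u b`, so
only the transverse component gives a relation. -/
theorem range_defect_le (h : NondegTiling R t) (ht' : ∀ w, InShapeSpace (t w) (t' w))
    {u : interiorSegments R t → ℂ} (hu : ∀ b, ∃ c, h.seg c = b.1 ∧ u b = outVec t c) :
    LinearMap.range (defect t t') ≤
      LinearMap.ker (closing (fun c (b : interiorSegments R t) => h.seg c = b.1) u) := by
  rintro _ ⟨⟨f, a⟩, rfl⟩
  rw [LinearMap.mem_ker]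
  refine Prod.ext (funext fun w => ?_) (funext fun b => ?_)
  · change ∑ i, (f ⟨t w (i + 1), pt_mem_verts t ⟨w, i + 1⟩⟩ - f ⟨t w i, pt_mem_verts t ⟨w, i⟩⟩ -
      a w • edgeVec (t' w) i) = 0
    rw [Finset.sum_sub_distrib, ← Finset.smul_sum, sum_edgeVec, smul_zero, sub_zero]
    exact sum_edgeVec fun i => f ⟨t w i, pt_mem_verts t ⟨w, i⟩⟩
  · obtain ⟨c₀, hc₀, hub⟩ := hu b
    have h1 := h.sum_seg_eq_zero b.2 fun z => cross (u b) (extend t f z)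
    rw [Finset.sum_filter] at h1
    refine Eq.trans (Finset.sum_congr rfl fun c _ => ?_) h1
    split_ifs with hc
    · obtain ⟨r, -, -, hr⟩ := exists_shape_ratio ht' c.1
      have h2 : outVec t' c = r c.2 • outVec t c := hr c.2
      have h3 := h.outVec_cross (c := c) (x := pt t c₀) (y := pt t (next c₀))
        (by rw [hc, ← hc₀]; exact h.pt_mem_seg c₀) (by rw [hc, ← hc₀]; exact h.pt_next_mem_seg c₀)
      rw [pt_next, add_sub_cancel_left, ← hub, cross_comm, neg_eq_zero] at h3
      change cross (u b) (f ⟨pt t (next c), pt_mem_verts t _⟩ - f ⟨pt t c, pt_mem_verts t c⟩ -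
        a c.1 • outVec t' c) = _
      rw [extend_pt, extend_pt, cross_sub_right, cross_sub_right, cross_smul_right, h2,
        cross_smul_right, h3, mul_zero, mul_zero, sub_zero]
    · rfl

/-- The relations are independent: a vector along its own edge has height zero, so such vectors
reach all tile sums alone; a transverse vector, corrected by these, reaches a single segment. -/
theorem range_closing (h : NondegTiling R t)
    {u : interiorSegments R t → ℂ} (hu : ∀ b, ∃ c, h.seg c = b.1 ∧ u b = outVec t c) :
    LinearMap.range (closing (fun c (b : interiorSegments R t) => h.seg c = b.1) u) = ⊤ := by
  have : Finite (interiorSegments R t) := h.finite_interiorSegments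
  have : Fintype (interiorSegments R t) := Fintype.ofFinite _
  set Φ := closing (fun c (b : interiorSegments R t) => h.seg c = b.1) u with hΦ
  have hsingle : ∀ c z, Φ (Pi.single c z) =
      (Pi.single c.1 z, fun b => if h.seg c = b.1 then cross (u b) z else 0) := by
    intro c z
    refine Prod.ext (funext fun w => ?_) (funext fun b => ?_)
    · change ∑ i, (Pi.single c z : Corner m → ℂ) ⟨w, i⟩ = (Pi.single c.1 z : W → ℂ) w
      by_cases hw : w = c.1
      · subst hw
        rw [Pi.single_eq_same, Finset.sum_eq_single c.2]
        · exact Pi.single_eq_same _ _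
        · intro i _ hi
          refine Pi.single_eq_of_ne (fun h' => hi ?_) _
          exact eq_of_heq (Sigma.ext_iff.1 h').2
        · intro h'; exact absurd (mem_univ _) h'
      · rw [Pi.single_eq_of_ne hw]
        refine Finset.sum_eq_zero fun i _ => Pi.single_eq_of_ne (fun h' => hw ?_) _
        rw [← h']
    · change (∑ c', if h.seg c' = b.1 then cross (u b) ((Pi.single c z : Corner m → ℂ) c') else 0)
        = if h.seg c = b.1 then cross (u b) z else 0
      rw [Finset.sum_eq_single c]
      · rw [Pi.single_eq_same]
      · intro c' _ hc'
        rw [Pi.single_eq_of_ne hc', cross_zero_right, ite_self]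
      · intro h'; exact absurd (mem_univ _) h'
  have h1 : ∀ c : Corner m, ((Pi.single c.1 (outVec t c), 0) : (W → ℂ) × _) ∈ LinearMap.range Φ := by
    intro c
    refine ⟨Pi.single c (outVec t c), ?_⟩
    rw [hsingle]
    refine Prod.ext rfl (funext fun b => ?_)
    change (if h.seg c = b.1 then cross (u b) (outVec t c) else 0) = 0
    split_ifs with hc
    · obtain ⟨c₀, hc₀, hub⟩ := hu b
      have h3 := h.outVec_cross (c := c) (x := pt t c₀) (y := pt t (next c₀))
        (by rw [hc, ← hc₀]; exact h.pt_mem_seg c₀) (by rw [hc, ← hc₀]; exact h.pt_next_mem_seg c₀)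
      rw [pt_next, add_sub_cancel_left, ← hub] at h3
      rw [cross_comm, h3, neg_zero]
    · rfl
  have h2 : ∀ w z, ((Pi.single w z, 0) : (W → ℂ) × _) ∈ LinearMap.range Φ := by
    intro w z
    have e := smul_eq_of_cross (edgeVec (t w) (0 - 1)) (edgeVec (t w) 0) z
    have hp := (h.ht w).cross_edgeVec_pos 0
    have e' : ((Pi.single w z, 0) : (W → ℂ) × (interiorSegments R t → ℝ)) =
        (cross (edgeVec (t w) (0 - 1)) (edgeVec (t w) 0))⁻¹ •
        (cross z (edgeVec (t w) 0) • (Pi.single w (edgeVec (t w) (0 - 1)), 0) +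
          cross (edgeVec (t w) (0 - 1)) z • (Pi.single w (edgeVec (t w) 0), 0)) := by
      rw [eq_inv_smul_iff₀ hp.ne']
      refine Prod.ext ?_ (by simp)
      simp only [Prod.smul_fst, Prod.fst_add, ← Pi.single_smul, ← Pi.single_add]
      rw [e]
    rw [e']
    exact Submodule.smul_mem _ _ (Submodule.add_mem _ (Submodule.smul_mem _ _ (h1 ⟨w, 0 - 1⟩))
      (Submodule.smul_mem _ _ (h1 ⟨w, 0⟩)))
  have h3 : ∀ (b : interiorSegments R t) (r : ℝ),
      ((0, Pi.single b r) : (W → ℂ) × (interiorSegments R t → ℝ)) ∈ LinearMap.range Φ := by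
    intro b r
    obtain ⟨c, hc, hub⟩ := hu b
    have hp := cross_I_mul_pos (h.outVec_ne_zero c)
    have h4 := Submodule.sub_mem _ (LinearMap.mem_range_self Φ (Pi.single c (Complex.I * outVec t c)))
      (h2 c.1 (Complex.I * outVec t c))
    have h5 := Submodule.smul_mem _ (r / cross (outVec t c) (Complex.I * outVec t c)) h4
    convert h5 using 1
    rw [hsingle]
    refine Prod.ext (by simp) (funext fun b' => ?_)
    simp only [Prod.mk_sub_mk, sub_zero, Prod.smul_snd, Pi.smul_apply, smul_eq_mul]
    by_cases hb : b' = b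
    · rw [hb, Pi.single_eq_same, if_pos hc, hub, div_mul_cancel₀ _ hp.ne']
    · rw [Pi.single_eq_of_ne hb, if_neg fun h' => hb (Subtype.ext (h'.symm.trans hc)), mul_zero]
  rw [eq_top_iff]
  rintro ⟨y, g⟩ -
  have e : ((y, g) : (W → ℂ) × (interiorSegments R t → ℝ)) =
      ∑ w, (Pi.single w (y w), 0) + ∑ b, (0, Pi.single b (g b)) := by
    refine Prod.ext ?_ ?_
    · simp only [Prod.fst_add, Prod.fst_sum, Finset.sum_const_zero, add_zero]
      exact (Finset.univ_sum_single y).symm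
    · simp only [Prod.snd_add, Prod.snd_sum, Finset.sum_const_zero, zero_add]
      exact (Finset.univ_sum_single g).symm
  rw [e]
  exact Submodule.add_mem _ (Submodule.sum_mem _ fun w _ => h2 w (y w))
    (Submodule.sum_mem _ fun b _ => h3 b (g b))

/-- A dimension count: unknowns minus equations plus independent relations, simplified by Euler's
formula. -/
theorem le_finrank_ker (h : NondegTiling R t) (ht' : ∀ w, InShapeSpace (t w) (t' w)) :
    (interiorSegments R t).ncard + 4 ≤
      Fintype.card W + Module.finrank ℝ (LinearMap.ker (defect t t')) := by
  have : Finite (interiorSegments R t) := h.finite_interiorSegments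
  have : Fintype (interiorSegments R t) := Fintype.ofFinite _
  have hex : ∀ b : interiorSegments R t, ∃ c, h.seg c = b.1 := fun b => h.exists_seg_eq b.2.1
  choose c hc using hex
  have hu : ∀ b, ∃ c', h.seg c' = b.1 ∧ outVec t (c b) = outVec t c' := fun b => ⟨c b, hc b, rfl⟩
  have h1 := Submodule.finrank_mono (h.range_defect_le ht' hu)
  have h2 := (defect t t').finrank_range_add_finrank_ker
  have h3 := (closing (fun c (b : interiorSegments R t) => h.seg c = b.1)
    (fun b => outVec t (c b))).finrank_range_add_finrank_ker
  rw [h.range_closing hu, finrank_top] at h3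
  have e1 : Module.finrank ℝ ((verts t → ℂ) × (W → ℝ)) = 2 * (verts t).card + Fintype.card W := by
    rw [Module.finrank_prod, Module.finrank_pi_fintype, Module.finrank_pi]
    simp [Complex.finrank_real_complex, mul_comm]
  have e2 : Module.finrank ℝ (Corner m → ℂ) = 2 * Fintype.card (Corner m) := by
    rw [Module.finrank_pi_fintype]
    simp [Complex.finrank_real_complex, mul_comm]
  have e3 : Module.finrank ℝ ((W → ℂ) × (interiorSegments R t → ℝ)) =
      2 * Fintype.card W + (interiorSegments R t).ncard := by
    rw [Module.finrank_prod, Module.finrank_pi_fintype, Module.finrank_pi,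
      ← Nat.card_coe_set_eq, Nat.card_eq_fintype_card]
    simp [Complex.finrank_real_complex, mul_comm]
  rw [e1] at h2
  rw [e2, e3] at h3
  have := h.card_corner
  omega

/-- A solution is determined by the image of `R 0` and the signed length of the image of edge 0,
measured by the cross product with `I * e`: if both vanish, so do all factors, and then everything
sits at one point. -/
theorem finrank_ker_le (h : NondegTiling R t) (ht' : ∀ w, InShapeSpace (t w) (t' w)) :
    Module.finrank ℝ (LinearMap.ker (defect t t')) ≤ 3 := by
  let e := edgeVec R 0
  let L : (verts t → ℂ) × (W → ℝ) →ₗ[ℝ] ℝ × ℂ :=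
    ((crossL (Complex.I * e)).comp
      (LinearMap.proj ⟨R (0 + 1), h.R_mem_verts _⟩ - LinearMap.proj ⟨R 0, h.R_mem_verts 0⟩)).prod
      (LinearMap.proj ⟨R 0, h.R_mem_verts 0⟩) ∘ₗ LinearMap.fst ℝ _ _
  have hL : Function.Injective (L.comp (LinearMap.ker (defect t t')).subtype) := by
    rw [← LinearMap.ker_eq_bot, LinearMap.ker_eq_bot']
    rintro ⟨⟨f, a⟩, hp⟩ hz
    have hf := isSolution_of_mem_ker hp
    have z1 : cross (Complex.I * e) (f ⟨R (0 + 1), h.R_mem_verts _⟩ - f ⟨R 0, h.R_mem_verts 0⟩) = 0 :=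
      congrArg Prod.fst hz
    have z2 : f ⟨R 0, h.R_mem_verts 0⟩ = 0 := congrArg Prod.snd hz
    have x0 : extend t f (R 0) = f ⟨R 0, h.R_mem_verts 0⟩ := dif_pos _
    have x1 : extend t f (R (0 + 1)) = f ⟨R (0 + 1), h.R_mem_verts _⟩ := dif_pos _
    have ha : ∀ w, a w = 0 := by
      by_contra hn
      push Not at hn
      refine hf.map_R_ne h ht' hn 0 ?_
      have h2 := hf.collinear_R h ht' (h.R_mem_verts (0 + 1)) (h.R_mem_verts 0)
        (right_mem_segment ℝ _ _) (left_mem_segment ℝ _ _)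
      obtain ⟨r, hr⟩ := exists_smul_of_cross_eq_zero (h.hR.edgeVec_ne_zero 0) h2
      rw [← x0, ← x1, hr, cross_smul_right, cross_comm] at z1
      have hp := cross_I_mul_pos (h.hR.edgeVec_ne_zero 0)
      have hr0 : r = 0 := by
        rcases mul_eq_zero.1 z1 with h' | h'
        · exact h'
        · exact absurd (neg_eq_zero.1 h') hp.ne'
      rw [hr0, zero_smul, sub_eq_zero] at hr
      exact hr
    have hf0 : f = 0 := by
      funext ⟨v, hv⟩
      obtain ⟨c, -, rfl⟩ := mem_image.1 hv
      obtain ⟨c₀, -, hc₀⟩ := mem_image.1 (h.R_mem_verts 0)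
      have := hf.eq_of_zero h ha c c₀
      rw [hc₀, x0, z2, extend_pt] at this
      exact this
    exact Subtype.ext (Prod.ext hf0 (funext ha))
  have := LinearMap.finrank_le_finrank_of_injective hL
  rwa [Module.finrank_prod, Module.finrank_self, Complex.finrank_real_complex] at this

omit [Fintype W] in
theorem inShapeSpace_self (h : NondegTiling R t) (w : W) : InShapeSpace (t w) (t w) :=
  ⟨h.ht w, fun _ => 1, Or.inl fun _ => one_pos, fun i => by simp⟩

/-- The two dimension bounds for `t' = t` give one inequality, and the injection of the corners the
other. -/
theorem ncard_interiorSegments (h : NondegTiling R t) :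
    (interiorSegments R t).ncard + 1 = Fintype.card W := by
  have h1 := h.le_finrank_ker h.inShapeSpace_self
  have h2 := h.finrank_ker_le h.inShapeSpace_self
  have h3 := h.card_corner
  have h4 := h.card_corner_le
  omega

/-- If all factors always vanished, only the translations would remain, which form a space of
dimension 2, while the dimension is at least 3. -/
theorem exists_isSolution (h : NondegTiling R t) (ht' : ∀ w, InShapeSpace (t w) (t' w)) :
    ∃ (f : ℂ → ℂ) (a : W → ℝ), IsSolution t t' f a ∧ ∃ w, a w ≠ 0 := by
  by_contra hn
  push Not at hn
  let L : (verts t → ℂ) × (W → ℝ) →ₗ[ℝ] ℂ :=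
    (LinearMap.proj ⟨R 0, h.R_mem_verts 0⟩) ∘ₗ LinearMap.fst ℝ _ _
  have hL : Function.Injective (L.comp (LinearMap.ker (defect t t')).subtype) := by
    rw [← LinearMap.ker_eq_bot, LinearMap.ker_eq_bot']
    rintro ⟨⟨f, a⟩, hp⟩ z2
    have hf := isSolution_of_mem_ker hp
    have ha : ∀ w, a w = 0 := hn _ _ hf
    have x0 : extend t f (R 0) = f ⟨R 0, h.R_mem_verts 0⟩ := dif_pos _
    change f ⟨R 0, h.R_mem_verts 0⟩ = 0 at z2
    have hf0 : f = 0 := by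
      funext ⟨v, hv⟩
      obtain ⟨c, -, rfl⟩ := mem_image.1 hv
      obtain ⟨c₀, -, hc₀⟩ := mem_image.1 (h.R_mem_verts 0)
      have := hf.eq_of_zero h ha c c₀
      rw [hc₀, x0, z2, extend_pt] at this
      exact this
    exact Subtype.ext (Prod.ext hf0 (funext ha))
  have h1 := LinearMap.finrank_le_finrank_of_injective hL
  rw [Complex.finrank_real_complex] at h1
  have h2 := h.le_finrank_ker ht'
  have h3 := h.ncard_interiorSegments
  omega

end NondegTiling

end Tiling

/-! ### A solution is a tiling; images of the maximal segments. -/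

theorem mem_segment_add_smul {p d z : ℂ} {a b : ℝ} :
    z ∈ segment ℝ (p + a • d) (p + b • d) ↔ ∃ q ∈ Set.uIcc a b, z = p + q • d := by
  have h := image_segment ℝ (AffineMap.lineMap p (p + d) : ℝ →ᵃ[ℝ] ℂ) a b
  have e : ∀ q : ℝ, (AffineMap.lineMap p (p + d) : ℝ →ᵃ[ℝ] ℂ) q = p + q • d := fun q => by
    rw [AffineMap.lineMap_apply, vsub_eq_sub, vadd_eq_add, add_sub_cancel_left, add_comm]
  rw [e, e, segment_eq_uIcc] at h
  rw [← h]
  constructor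
  · rintro ⟨q, hq, rfl⟩
    exact ⟨q, hq, e q⟩
  · rintro ⟨q, hq, rfl⟩
    exact ⟨q, hq, e q⟩

section Tiling

variable {W : Type*} [Fintype W] {m : W → ℕ} {k : ℕ} {R : Fin (k + 3) → ℂ}
  {t t' : ∀ w, Fin (m w + 3) → ℂ}

/-- The convex hull of the image of the vertices in `b`. -/
def spanned (t : ∀ w, Fin (m w + 3) → ℂ) (f : ℂ → ℂ) (b : Set ℂ) : Set ℂ :=
  convexHull ℝ {z | ∃ c, pt t c ∈ b ∧ f (pt t c) = z}

omit [Fintype W] in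
theorem mem_spanned {f : ℂ → ℂ} {b : Set ℂ} {c : Corner m} (hc : pt t c ∈ b) :
    f (pt t c) ∈ spanned t f b :=
  subset_convexHull ℝ _ ⟨c, hc, rfl⟩

namespace IsSolution

variable {f : ℂ → ℂ} {a : W → ℝ} {x₀ : ℂ}

/-- If the image of `R j` were on the line of another edge `i`, then, as its two neighbours are not
on the right, the edges at `R j` would turn so that `R j` could not be strictly to the left of edge
`i` in `R`. -/
theorem isConvexPolygon_R (hf : IsSolution t t' f a) (h : NondegTiling R t)
    (ht' : ∀ w, InShapeSpace (t w) (t' w)) (ha : ∃ w, a w ≠ 0) (hx₀ : LeftOf R f x₀) :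
    IsConvexPolygon fun j => f (R j) := by
  intro i j hji hji'
  obtain ⟨r, hr, hre⟩ := hf.exists_ratio_pos h ht' ha hx₀ i
  have e1 : edgeVec (fun j => f (R j)) i = r • edgeVec R i := hre
  rw [e1, cross_smul_left]
  refine mul_pos hr ?_
  have hnn : ∀ l, 0 ≤ cross (edgeVec R i) (f (R l) - f (R i)) := by
    intro l
    obtain ⟨c, hc⟩ := h.exists_isCornerOf l
    rw [← hc.pt_eq]
    exact hf.cross_nonneg h ht' ha hx₀ c i
  refine (hnn j).lt_of_ne fun h0 => ?_
  obtain ⟨r1, hr1, he1⟩ := hf.exists_ratio_pos h ht' ha hx₀ j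
  obtain ⟨r2, hr2, he2⟩ := hf.exists_ratio_pos h ht' ha hx₀ (j - 1)
  rw [sub_add_cancel] at he2
  have h1 := hnn (j + 1)
  have h2 := hnn (j - 1)
  rw [show f (R (j + 1)) - f (R i) = (f (R (j + 1)) - f (R j)) + (f (R j) - f (R i)) by ring, he1,
    cross_add_right, ← h0, add_zero, cross_smul_right] at h1
  rw [show f (R (j - 1)) - f (R i) = (f (R j) - f (R i)) - (f (R j) - f (R (j - 1))) by ring, he2,
    cross_sub_right, ← h0, zero_sub, cross_smul_right] at h2
  have h1' := nonneg_of_mul_nonneg_right h1 hr1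
  have h2' : cross (edgeVec R i) (edgeVec R (j - 1)) ≤ 0 := by nlinarith
  obtain ⟨α, β, hα, hβ, he⟩ := h.hR.vertex_cone j i
  have h3 := h.hR i j hji hji'
  rw [← neg_sub, cross_neg_right, he, cross_sub_right, cross_smul_right, cross_smul_right] at h3
  nlinarith

theorem inShapeSpace_R (hf : IsSolution t t' f a) (h : NondegTiling R t)
    (ht' : ∀ w, InShapeSpace (t w) (t' w)) (ha : ∃ w, a w ≠ 0) (hx₀ : LeftOf R f x₀) :
    InShapeSpace R fun j => f (R j) := by
  refine ⟨hf.isConvexPolygon_R h ht' ha hx₀, ?_⟩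
  choose r hr hre using hf.exists_ratio_pos h ht' ha hx₀
  exact ⟨r, Or.inl hr, fun i => by rw [← Complex.real_smul]; exact hre i⟩

theorem region_subset (hf : IsSolution t t' f a) (h : NondegTiling R t)
    (ht' : ∀ w, InShapeSpace (t w) (t' w)) (ha : ∃ w, a w ≠ 0) (hx₀ : LeftOf R f x₀)
    (c : Corner m) : f (pt t c) ∈ region fun j => f (R j) := by
  refine (hf.isConvexPolygon_R h ht' ha hx₀).mem_region_iff.2 fun j => ?_
  obtain ⟨r, hr, hre⟩ := hf.exists_ratio_pos h ht' ha hx₀ j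
  have e1 : edgeVec (fun j => f (R j)) j = r • edgeVec R j := hre
  rw [e1, cross_smul_left]
  exact mul_nonneg hr.le (hf.cross_nonneg h ht' ha hx₀ c j)

/-- By the index formula a generic point inside the image of `R` is in exactly one tile, and no
generic point is in two. Density of generic points and closedness of the tiles give the rest. -/
theorem isTiling (hf : IsSolution t t' f a) (h : NondegTiling R t)
    (ht' : ∀ w, InShapeSpace (t w) (t' w)) (ha : ∃ w, a w ≠ 0) (hx₀ : LeftOf R f x₀) :
    IsTiling (fun j => f (R j)) fun w i => f (t w i) := by
  have hR' := hf.isConvexPolygon_R h ht' ha hx₀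
  constructor
  · refine Set.Subset.antisymm (Set.iUnion_subset fun w => region_subset_of_forall
      (convex_region _) fun i => hf.region_subset h ht' ha hx₀ ⟨w, i⟩) ?_
    have hcl : IsClosed (⋃ w, region fun i => f (t w i)) :=
      isClosed_iUnion_of_finite fun w => isClosed_region _
    have hsub : interior (region fun j => f (R j)) ∩ {x | Generic t (fun c => f (pt t c)) x} ⊆
        ⋃ w, region fun i => f (t w i) := by
      rintro x ⟨hx, hg⟩
      have hi : ∀ j, 0 < cross (edgeVec R j) (x - f (R j)) := by
        intro j
        obtain ⟨r, hr, hre⟩ := hf.exists_ratio_pos h ht' ha hx₀ j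
        have e1 : edgeVec (fun j => f (R j)) j = r • edgeVec R j := hre
        have := hR'.mem_interior_iff.1 hx j
        rw [e1, cross_smul_left] at this
        exact pos_of_mul_pos_right this hr.le
      have h0 : (univ.filter fun j => ¬ BoundarySees R j (f (R j)) x).card = 0 := by
        rw [Finset.card_eq_zero, Finset.filter_eq_empty_iff]
        intro j _
        rw [not_not, BoundarySees, hf.cross_prev h ht']
        exact mul_pos (hi _) (hi j)
      have h1 := hf.index h ht' hg
      rw [h0] at h1
      obtain ⟨w, hw⟩ := Finset.card_pos.1 (by omega :
        0 < (univ.filter fun w => x ∈ interior (region fun i => f (t w i))).card)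
      exact Set.mem_iUnion.2 ⟨w, interior_subset (mem_filter.1 hw).2⟩
    have h2 := closure_minimal (((h.dense_generic _).open_subset_closure_inter
      isOpen_interior).trans (closure_minimal hsub hcl)) hcl
    rwa [hR'.closure_interior] at h2
  · intro w w' hne
    rw [Set.disjoint_iff_inter_eq_empty]
    by_contra hn
    obtain ⟨x, hx, hg⟩ := h.exists_generic (fun c => f (pt t c))
      (isOpen_interior.inter isOpen_interior) (Set.nonempty_iff_ne_empty.2 hn)
    have h1 := hf.index h ht' hg
    have h2 : ({w, w'} : Finset W) ⊆
        univ.filter fun w => x ∈ interior (region fun i => f (t w i)) := by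
      intro v hv
      rw [mem_insert, mem_singleton] at hv
      refine mem_filter.2 ⟨mem_univ _, ?_⟩
      rcases hv with rfl | rfl
      · exact hx.1
      · exact hx.2
    have h3 := Finset.card_le_card h2
    rw [Finset.card_pair hne] at h3
    omega

/-- A coordinate on the line that contains the images of the vertices in `b`. -/
theorem exists_coordinate (hf : IsSolution t t' f a) (h : NondegTiling R t)
    (ht' : ∀ w, InShapeSpace (t w) (t' w)) {b : Set ℂ} (hb : b ∈ maximalSegments t) :
    ∃ (d q₀ : ℂ) (ρ : ℂ → ℝ) (c₁ c₂ : Corner m), d ≠ 0 ∧ pt t c₁ ∈ b ∧ pt t c₂ ∈ b ∧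
      ∀ c, pt t c ∈ b → f (pt t c) = q₀ + ρ (pt t c) • d ∧ ρ (pt t c₁) ≤ ρ (pt t c) ∧
        ρ (pt t c) ≤ ρ (pt t c₂) := by
  obtain ⟨x, y, hxy, hbe⟩ := exists_endpoints hb
  obtain ⟨c₀, hc₀⟩ := h.exists_seg_eq hb
  have hc₀b : pt t c₀ ∈ b := hc₀ ▸ h.pt_mem_seg c₀
  have hd : y - x ≠ 0 := sub_ne_zero.2 hxy.symm
  have hex : ∀ v, ∃ r : ℝ, (∃ c, pt t c = v ∧ v ∈ b) → f v = f (pt t c₀) + r • (y - x) := by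
    intro v
    by_cases hv : ∃ c, pt t c = v ∧ v ∈ b
    · obtain ⟨c, rfl, hc⟩ := hv
      have h1 := hf.collinear h ht' hb (x := x) (y := y) (hbe ▸ left_mem_segment ℝ _ _)
        (hbe ▸ right_mem_segment ℝ _ _) hc hc₀b
      obtain ⟨r, hr⟩ := exists_smul_of_cross_eq_zero hd h1
      exact ⟨r, fun _ => by rw [← hr]; ring⟩
    · exact ⟨0, fun h' => absurd h' hv⟩
  choose ρ hρ using hex
  have hne : {c : Corner m | pt t c ∈ b}.Nonempty := ⟨c₀, hc₀b⟩
  obtain ⟨c₁, h1, h1'⟩ := Set.exists_min_image _ (fun c => ρ (pt t c)) (Set.toFinite _) hne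
  obtain ⟨c₂, h2, h2'⟩ := Set.exists_max_image _ (fun c => ρ (pt t c)) (Set.toFinite _) hne
  exact ⟨y - x, f (pt t c₀), ρ, c₁, c₂, hd, h1, h2, fun c hc => ⟨hρ _ ⟨c, rfl, hc⟩, h1' c hc, h2' c hc⟩⟩

omit [Fintype W] in
theorem spanned_eq {b : Set ℂ} {d q₀ : ℂ} {ρ : ℂ → ℝ} {c₁ c₂ : Corner m} (h1 : pt t c₁ ∈ b)
    (h2 : pt t c₂ ∈ b) (hρ : ∀ c, pt t c ∈ b → f (pt t c) = q₀ + ρ (pt t c) • d ∧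
      ρ (pt t c₁) ≤ ρ (pt t c) ∧ ρ (pt t c) ≤ ρ (pt t c₂)) :
    spanned t f b = segment ℝ (f (pt t c₁)) (f (pt t c₂)) := by
  refine Set.Subset.antisymm (convexHull_min ?_ (convex_segment _ _))
    ((convex_convexHull ℝ _).segment_subset (mem_spanned h1) (mem_spanned h2))
  rintro _ ⟨c, hc, rfl⟩
  rw [(hρ c hc).1, (hρ _ h1).1, (hρ _ h2).1]
  exact mem_segment_add_smul.2 ⟨_, Set.mem_uIcc.2 (Or.inl (hρ c hc).2), rfl⟩

/-- The images of the edges in `b` cover all values of a coordinate between its extremes. -/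
theorem exists_mem_uIcc (h : NondegTiling R t) {b : Set ℂ} (hb : b ∈ maximalSegments t)
    {ρ : ℂ → ℝ} {c₁ c₂ : Corner m} (h1 : pt t c₁ ∈ b) (h2 : pt t c₂ ∈ b) {q : ℝ}
    (hq1 : ρ (pt t c₁) ≤ q) (hq2 : q ≤ ρ (pt t c₂)) :
    ∃ c, h.seg c = b ∧ q ∈ Set.uIcc (ρ (pt t c)) (ρ (pt t (next c))) := by
  by_contra hn
  push Not at hn
  have hno : ∀ c, h.seg c = b → (ρ (pt t c) < q ∧ ρ (pt t (next c)) < q) ∨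
      (q < ρ (pt t c) ∧ q < ρ (pt t (next c))) := by
    intro c hc
    have := hn c hc
    rw [Set.mem_uIcc] at this
    push Not at this
    obtain ⟨t1, t2⟩ := this
    rcases lt_trichotomy (ρ (pt t c)) q with h' | h' | h'
    · exact Or.inl ⟨h', t1 h'.le⟩
    · exact absurd (t1 h'.le) (not_lt.2 (not_lt.1 fun h'' => by
        have := t2 (by linarith); linarith))
    · refine Or.inr ⟨h', ?_⟩
      by_contra h''
      have := t2 (not_lt.1 h'')
      linarith
  -- If no image edge contains the value `q`, being below or above `q` is constant along the
  -- segment, by connectivity; the extreme vertices contradict this.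
  have hF : ∀ c, pt t c ∈ b → ∀ c', pt t c' ∈ b → (ρ (pt t c) < q) = (ρ (pt t c') < q) := by
    refine fun c hcb c' hcb' => h.eq_of_mem_segment hb (fun z => ρ z < q) (fun c hc => ?_) hcb hcb'
    rcases hno c hc with h' | h'
    · exact propext ⟨fun _ => h'.2, fun _ => h'.1⟩
    · exact propext ⟨fun h'' => absurd h'' h'.1.not_gt, fun h'' => absurd h'' h'.2.not_gt⟩
  have hG : ∀ c, pt t c ∈ b → ∀ c', pt t c' ∈ b → (q < ρ (pt t c)) = (q < ρ (pt t c')) := by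
    refine fun c hcb c' hcb' => h.eq_of_mem_segment hb (fun z => q < ρ z) (fun c hc => ?_) hcb hcb'
    rcases hno c hc with h' | h'
    · exact propext ⟨fun h'' => absurd h'' h'.1.not_gt, fun h'' => absurd h'' h'.2.not_gt⟩
    · exact propext ⟨fun _ => h'.2, fun _ => h'.1⟩
  obtain ⟨c, hc⟩ := h.exists_seg_eq hb
  have hcb : pt t c ∈ b := hc ▸ h.pt_mem_seg c
  rcases hno c hc with h' | h'
  · have : ρ (pt t c₂) < q := (hF c hcb c₂ h2).mp h'.1
    linarith
  · have : q < ρ (pt t c₁) := (hG c hcb c₁ h1).mp h'.1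
    linarith

theorem exists_mem_edge_of_mem_spanned (hf : IsSolution t t' f a) (h : NondegTiling R t)
    (ht' : ∀ w, InShapeSpace (t w) (t' w)) {b : Set ℂ} (hb : b ∈ maximalSegments t) {p : ℂ}
    (hp : p ∈ spanned t f b) :
    ∃ c, h.seg c = b ∧ p ∈ segment ℝ (f (pt t c)) (f (pt t (next c))) := by
  obtain ⟨d, q₀, ρ, c₁, c₂, hd, h1, h2, hρ⟩ := hf.exists_coordinate h ht' hb
  rw [spanned_eq h1 h2 hρ, (hρ _ h1).1, (hρ _ h2).1] at hp
  obtain ⟨q, hq, rfl⟩ := mem_segment_add_smul.1 hp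
  rw [Set.uIcc_of_le (hρ _ h1).2.2] at hq
  obtain ⟨c, hc, hqc⟩ := exists_mem_uIcc h hb h1 h2 hq.1 hq.2
  refine ⟨c, hc, ?_⟩
  rw [(hρ _ (hc ▸ h.pt_mem_seg c)).1, (hρ _ (hc ▸ h.pt_next_mem_seg c)).1]
  exact mem_segment_add_smul.2 ⟨q, hqc, rfl⟩

/-- The images of the edges in an interior segment cover it in both directions. -/
theorem exists_directed (h : NondegTiling R t) {b : Set ℂ} (hb : b ∈ interiorSegments R t)
    {ρ : ℂ → ℝ} {c₁ c₂ : Corner m} (h1 : pt t c₁ ∈ b) (h2 : pt t c₂ ∈ b)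
    (h12 : ρ (pt t c₁) < ρ (pt t c₂)) {q : ℝ}
    (hq : q ∈ Set.Icc (ρ (pt t c₁)) (ρ (pt t c₂))) :
    (∃ c, h.seg c = b ∧ ρ (pt t c) ≤ q ∧ q ≤ ρ (pt t (next c))) ∧
      ∃ c, h.seg c = b ∧ ρ (pt t (next c)) ≤ q ∧ q ≤ ρ (pt t c) := by
  have hgen : ∀ q ∈ Set.Ioo (ρ (pt t c₁)) (ρ (pt t c₂)), (∀ c, ρ (pt t c) ≠ q) →
      (∃ c, h.seg c = b ∧ ρ (pt t c) < q ∧ q < ρ (pt t (next c))) ∧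
        ∃ c, h.seg c = b ∧ ρ (pt t (next c)) < q ∧ q < ρ (pt t c) := by
    intro q hq hne
    obtain ⟨c, hc, hqc⟩ := exists_mem_uIcc h hb.1 h1 h2 hq.1.le hq.2.le
    -- Applied to the indicator of the vertices beyond `q`, the vanishing boundary says that as many
    -- edges cross `q` forwards as backwards.
    have hs := h.sum_seg_eq_zero hb fun z => if q < ρ z then (1 : ℤ) else 0
    rw [Set.mem_uIcc] at hqc
    rcases hqc with ⟨h3, h4⟩ | ⟨h3, h4⟩
    · have h3 := h3.lt_of_ne (hne c)
      have h4 := h4.lt_of_ne' (hne (next c))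
      refine ⟨⟨c, hc, h3, h4⟩, ?_⟩
      by_contra hn
      push Not at hn
      have hp := Finset.sum_pos' (s := univ.filter fun c => h.seg c = b)
        (f := fun c => (if q < ρ (pt t (next c)) then (1 : ℤ) else 0) -
          if q < ρ (pt t c) then (1 : ℤ) else 0) (fun c' hc' => by
          have h5 := hn c' (mem_filter.1 hc').2
          by_cases h6 : q < ρ (pt t (next c'))
          · rw [if_pos h6]; split_ifs <;> simp
          · have h7 := h5 ((not_lt.1 h6).lt_of_ne (hne _))
            rw [if_neg h6, if_neg (not_lt.2 h7)]; simp)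
        ⟨c, mem_filter.2 ⟨mem_univ _, hc⟩, by
          rw [if_pos h4, if_neg (not_lt.2 h3.le)]; simp⟩
      exact hp.ne' hs
    · have h3 := h3.lt_of_ne (hne (next c))
      have h4 := h4.lt_of_ne' (hne c)
      refine ⟨?_, ⟨c, hc, h3, h4⟩⟩
      by_contra hn
      push Not at hn
      have hp := Finset.sum_pos' (s := univ.filter fun c => h.seg c = b)
        (f := fun c => -((if q < ρ (pt t (next c)) then (1 : ℤ) else 0) -
          if q < ρ (pt t c) then (1 : ℤ) else 0)) (fun c' hc' => by
          have h5 := hn c' (mem_filter.1 hc').2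
          by_cases h6 : q < ρ (pt t c')
          · rw [if_pos h6]; split_ifs <;> simp
          · have h7 := h5 ((not_lt.1 h6).lt_of_ne (hne _))
            rw [if_neg h6, if_neg (not_lt.2 h7)]; simp)
        ⟨c, mem_filter.2 ⟨mem_univ _, hc⟩, by
          rw [if_pos h4, if_neg (not_lt.2 h3.le)]; simp⟩
      rw [Finset.sum_neg_distrib, hs, neg_zero] at hp
      exact lt_irrefl _ hp
  have hfin : (Set.range fun c : Corner m => ρ (pt t c)).Finite := Set.finite_range _
  -- Values that avoid all vertices are dense, and the covered values form a closed set, so the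
  -- generic case suffices.
  have hsub : Set.Icc (ρ (pt t c₁)) (ρ (pt t c₂)) ⊆
      closure (Set.Ioo (ρ (pt t c₁)) (ρ (pt t c₂)) ∩
        (Set.range fun c : Corner m => ρ (pt t c))ᶜ) := by
    rw [← closure_Ioo h12.ne]
    exact closure_minimal ((hfin.countable.dense_compl ℝ).open_subset_closure_inter isOpen_Ioo) isClosed_closure
  have hclosed : ∀ u v : Corner m → ℝ,
      IsClosed {q | ∃ c, h.seg c = b ∧ u c ≤ q ∧ q ≤ v c} := by
    intro u v
    have e : {q | ∃ c, h.seg c = b ∧ u c ≤ q ∧ q ≤ v c} =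
        ⋃ c ∈ {c | h.seg c = b}, Set.Icc (u c) (v c) := by
      ext q; simp only [Set.mem_ofPred_eq, Set.mem_iUnion, Set.mem_Icc, exists_prop]
    rw [e]
    exact (Set.toFinite _).isClosed_biUnion fun c _ => isClosed_Icc
  constructor
  · refine closure_minimal ?_ (hclosed (fun c => ρ (pt t c)) fun c => ρ (pt t (next c))) (hsub hq)
    rintro q ⟨h3, h4⟩
    obtain ⟨⟨c, a1, a2, a3⟩, -⟩ := hgen q h3 fun c hc => h4 ⟨c, hc⟩
    exact ⟨c, a1, a2.le, a3.le⟩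
  · refine closure_minimal ?_ (hclosed (fun c => ρ (pt t (next c))) fun c => ρ (pt t c)) (hsub hq)
    rintro q ⟨h3, h4⟩
    obtain ⟨-, ⟨c, a1, a2, a3⟩⟩ := hgen q h3 fun c hc => h4 ⟨c, hc⟩
    exact ⟨c, a1, a2.le, a3.le⟩

end IsSolution

end Tiling

/-! ### Combinatorial equivalence. -/

section Tiling

variable {W : Type*} [Fintype W] {m : W → ℕ} {k : ℕ} {R : Fin (k + 3) → ℂ}
  {t t' : ∀ w, Fin (m w + 3) → ℂ}

namespace NondegTiling

omit [Fintype W] in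
theorem isSolution_id (t : ∀ w, Fin (m w + 3) → ℂ) : IsSolution t t (fun z => z) fun _ => 1 :=
  fun c => by rw [one_smul, pt_next, add_sub_cancel_left]

/-- A maximal segment is covered by the edges in it. -/
theorem exists_mem_edge (h : NondegTiling R t) {b : Set ℂ} (hb : b ∈ maximalSegments t) {p : ℂ}
    (hp : p ∈ b) : ∃ c, h.seg c = b ∧ p ∈ edge (t c.1) c.2 := by
  refine (isSolution_id t).exists_mem_edge_of_mem_spanned h h.inShapeSpace_self hb ?_
  obtain ⟨x, y, hxy, rfl⟩ := exists_endpoints hb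
  obtain ⟨c, hc⟩ := (h.eq_endpoint hxy hb (fun _ => ()) fun _ _ => rfl).2
  rw [segment_symm] at hb
  obtain ⟨c', hc'⟩ := (h.eq_endpoint hxy.symm hb (fun _ => ()) fun _ _ => rfl).2
  refine (convex_convexHull ℝ _).segment_subset ?_ ?_ hp
  · exact hc' ▸ mem_spanned (f := fun z => z) (hc'.symm ▸ left_mem_segment ℝ x y)
  · exact hc ▸ mem_spanned (f := fun z => z) (hc.symm ▸ right_mem_segment ℝ x y)

omit [Fintype W] in
theorem edge_R_injective (h : NondegTiling R t) : Function.Injective (edge R) := by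
  intro i j hij
  by_contra hne
  have h1 : R i ∈ edge R j := hij ▸ IsConvexPolygon.vertex_mem_edge R i
  have h2 : R (i + 1) ∈ edge R j := hij ▸ right_mem_segment ℝ _ _
  have h3 := ((h.hR.mem_edge_iff j).1 h1).2
  have h4 := ((h.hR.mem_edge_iff j).1 h2).2
  have key : ∀ l, cross (edgeVec R j) (R l - R j) = 0 → l = j ∨ l = j + 1 := by
    intro l hl
    by_contra hn
    push Not at hn
    exact (h.hR j l hn.1 hn.2).ne' hl
  rcases key i h3 with rfl | rfl
  · exact hne rfl
  · rcases key _ h4 with h5 | h5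
    · exact fin_add_one_ne_sub_one (j + 1) (by rw [h5, add_sub_cancel_right])
    · exact fin_add_one_ne (j + 1) h5

/-- The number of segments depends only on the number of tiles and the number of sides of `R`, so it
is the same for a nondegenerate image; this makes the correspondence of segments injective. -/
theorem ncard_maximalSegments (h : NondegTiling R t) :
    (maximalSegments t).ncard + 1 = Fintype.card W + (k + 3) := by
  have e : maximalSegments t = interiorSegments R t ∪ Set.range (edge R) := by
    ext b
    constructor
    · intro hb
      by_cases hj : ∃ j, b = edge R j
      · obtain ⟨j, rfl⟩ := hj
        exact Or.inr ⟨j, rfl⟩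
      · push Not at hj
        exact Or.inl ⟨hb, hj⟩
    · rintro (hb | ⟨j, rfl⟩)
      · exact hb.1
      · exact h.edge_R_mem j
  have hd : Disjoint (interiorSegments R t) (Set.range (edge R)) := by
    rw [Set.disjoint_left]
    rintro _ hb ⟨j, rfl⟩
    exact hb.2 j rfl
  have hr : (Set.range (edge R)).ncard = k + 3 := by
    rw [← Set.image_univ, Set.ncard_image_of_injective _ h.edge_R_injective, Set.ncard_univ,
      Nat.card_eq_fintype_card, Fintype.card_fin]
  rw [e, Set.ncard_union_eq hd h.finite_interiorSegments (Set.finite_range _), hr,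
    ← h.ncard_interiorSegments]
  ring

end NondegTiling

namespace IsSolution

variable {f : ℂ → ℂ} {a : W → ℝ} {x₀ : ℂ}

theorem spanned_edge_R (hf : IsSolution t t' f a) (h : NondegTiling R t)
    (ht' : ∀ w, InShapeSpace (t w) (t' w)) (ha : ∃ w, a w ≠ 0) (hx₀ : LeftOf R f x₀)
    (j : Fin (k + 3)) : spanned t f (edge R j) = edge (fun j => f (R j)) j := by
  have hR' := hf.isConvexPolygon_R h ht' ha hx₀
  refine Set.Subset.antisymm (convexHull_min ?_ (convex_segment _ _)) ?_
  · rintro _ ⟨c, hc, rfl⟩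
    rw [hR'.mem_edge_iff]
    refine ⟨hf.region_subset h ht' ha hx₀ c, ?_⟩
    obtain ⟨r, hr, hre⟩ := hf.exists_ratio_pos h ht' ha hx₀ j
    have e1 : edgeVec (fun j => f (R j)) j = r • edgeVec R j := hre
    rw [e1, cross_smul_left, hf.collinear_R h ht' (pt_mem_verts t c) (h.R_mem_verts j) hc
      (IsConvexPolygon.vertex_mem_edge R j), mul_zero]
  · obtain ⟨c, hc⟩ := h.exists_isCornerOf j
    obtain ⟨c', hc'⟩ := h.exists_isCornerOf (j + 1)
    refine (convex_convexHull ℝ _).segment_subset ?_ ?_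
    · have := mem_spanned (f := f) (b := edge R j) (c := c) 
        (hc.pt_eq.symm ▸ IsConvexPolygon.vertex_mem_edge R j)
      rwa [hc.pt_eq] at this
    · have := mem_spanned (f := f) (b := edge R j) (c := c') 
        (by rw [hc'.pt_eq]; exact right_mem_segment ℝ _ _)
      rwa [hc'.pt_eq] at this

theorem edge_subset_spanned (h : NondegTiling R t) (f : ℂ → ℂ) (c : Corner m) :
    segment ℝ (f (pt t c)) (f (pt t (next c))) ⊆ spanned t f (h.seg c) :=
  (convex_convexHull ℝ _).segment_subset (mem_spanned (h.pt_mem_seg c))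
    (mem_spanned (h.pt_next_mem_seg c))

theorem spanned_interior (hf : IsSolution t t' f a) (h : NondegTiling R t)
    (ht' : ∀ w, InShapeSpace (t w) (t' w)) {b : Set ℂ} (hb : b ∈ interiorSegments R t) :
    ∃ x y : ℂ, spanned t f b = segment ℝ x y ∧ ∀ p ∈ segment ℝ x y,
      (∃ c, h.seg c = b ∧ SameRay ℝ (y - x) (f (pt t (next c)) - f (pt t c)) ∧
        p ∈ segment ℝ (f (pt t c)) (f (pt t (next c)))) ∧
      ∃ c, h.seg c = b ∧ SameRay ℝ (x - y) (f (pt t (next c)) - f (pt t c)) ∧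
        p ∈ segment ℝ (f (pt t c)) (f (pt t (next c))) := by
  obtain ⟨d, q₀, ρ, c₁, c₂, hd, h1, h2, hρ⟩ := hf.exists_coordinate h ht' hb.1
  refine ⟨_, _, spanned_eq h1 h2 hρ, fun p hp => ?_⟩
  rcases (hρ _ h1).2.2.eq_or_lt with h12 | h12
  -- On a segment that has shrunk to a point, any edge counts for both sides.
  · have e : f (pt t c₁) = f (pt t c₂) := by rw [(hρ _ h1).1, (hρ _ h2).1, h12]
    rw [← spanned_eq h1 h2 hρ] at hp
    obtain ⟨c, hc, hpc⟩ := hf.exists_mem_edge_of_mem_spanned h ht' hb.1 hp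
    rw [e, sub_self]
    exact ⟨⟨c, hc, SameRay.zero_left _, hpc⟩, ⟨c, hc, SameRay.zero_left _, hpc⟩⟩
  · rw [(hρ _ h1).1, (hρ _ h2).1] at hp ⊢
    obtain ⟨q, hq, rfl⟩ := mem_segment_add_smul.1 hp
    rw [Set.uIcc_of_le h12.le] at hq
    obtain ⟨⟨c, hc, hq1, hq2⟩, ⟨c', hc', hq1', hq2'⟩⟩ := exists_directed h hb h1 h2 h12 hq
    have hsub : ∀ u v : ℝ, (q₀ + u • d) - (q₀ + v • d) = (u - v) • d := fun u v => by
      rw [sub_smul]; ring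
    have hray : ∀ u v : ℝ, 0 ≤ u → 0 ≤ v → SameRay ℝ (u • d) (v • d) := fun u v hu hv =>
      ((SameRay.refl d).nonneg_smul_left hu).nonneg_smul_right hv
    refine ⟨⟨c, hc, ?_, ?_⟩, ⟨c', hc', ?_, ?_⟩⟩
    · rw [(hρ _ (hc ▸ h.pt_next_mem_seg c)).1, (hρ _ (hc ▸ h.pt_mem_seg c)).1, hsub, hsub]
      exact hray _ _ (sub_nonneg.2 h12.le) (sub_nonneg.2 (hq1.trans hq2))
    · rw [(hρ _ (hc ▸ h.pt_mem_seg c)).1, (hρ _ (hc ▸ h.pt_next_mem_seg c)).1]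
      exact mem_segment_add_smul.2 ⟨q, Set.mem_uIcc.2 (Or.inl ⟨hq1, hq2⟩), rfl⟩
    · rw [(hρ _ (hc' ▸ h.pt_next_mem_seg c')).1, (hρ _ (hc' ▸ h.pt_mem_seg c')).1, hsub, hsub,
        ← neg_sub, neg_smul, ← neg_sub (ρ (pt t c')), neg_smul, sameRay_neg_iff]
      exact hray _ _ (sub_nonneg.2 h12.le) (sub_nonneg.2 (hq1'.trans hq2'))
    · rw [(hρ _ (hc' ▸ h.pt_mem_seg c')).1, (hρ _ (hc' ▸ h.pt_next_mem_seg c')).1]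
      exact mem_segment_add_smul.2 ⟨q, Set.mem_uIcc.2 (Or.inr ⟨hq1', hq2'⟩), rfl⟩

/-- If the image of the tiling is nondegenerate, the segments correspond to each other. -/
theorem seg_eq_iff (hf : IsSolution t t' f a) (h : NondegTiling R t)
    (ht' : ∀ w, InShapeSpace (t w) (t' w)) {R' : Fin (k + 3) → ℂ}
    (hS : NondegTiling R' fun w i => f (t w i)) :
    (∀ c, spanned t f (h.seg c) = hS.seg c) ∧
      ∀ c c', hS.seg c = hS.seg c' ↔ h.seg c = h.seg c' := by
  have hne : ∀ c : Corner m, f (pt t c) ≠ f (pt t (next c)) := hS.pt_ne_next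
  have hβ : ∀ c, spanned t f (h.seg c) ⊆ hS.seg c := by
    intro c
    obtain ⟨d, q₀, ρ, c₁, c₂, hd, h1, h2, hρ⟩ := hf.exists_coordinate h ht' (h.seg_mem c)
    have hsp := spanned_eq h1 h2 hρ
    have hc := edge_subset_spanned h f c
    have h12 : f (pt t c₁) ≠ f (pt t c₂) := by
      intro h12
      rw [hsp, h12, segment_same] at hc
      exact hne c ((hc (left_mem_segment ℝ _ _)).trans (hc (right_mem_segment ℝ _ _)).symm)
    have hed : segment ℝ (f (pt t c₁)) (f (pt t c₂)) ⊆ edges fun w i => f (t w i) := by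
      intro p hp
      rw [← hsp] at hp
      obtain ⟨c', -, hp'⟩ := hf.exists_mem_edge_of_mem_spanned h ht' (h.seg_mem c) hp
      exact edge_subset_edges (fun w i => f (t w i)) c'.1 c'.2 hp'
    obtain ⟨β, hβ, hp1, hp2, -⟩ := exists_maximal h12 hed
    have hsub : spanned t f (h.seg c) ⊆ β := by
      rw [hsp]
      exact (convex_of_mem_maximalSegments hβ).segment_subset hp1 hp2
    rwa [(hS.edge_subset_iff hβ).1 (hc.trans hsub)]
  have himp : ∀ c c', h.seg c = h.seg c' → hS.seg c = hS.seg c' := by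
    intro c c' hcc
    refine hS.seg_eq (hS.seg_mem c') (p := f (pt t c)) (q := f (pt t (next c))) (hne c)
      (left_mem_segment ℝ _ _) (right_mem_segment ℝ _ _) (hβ c' ?_) (hβ c' ?_)
    · exact mem_spanned (hcc ▸ h.pt_mem_seg c)
    · exact mem_spanned (hcc ▸ h.pt_next_mem_seg c)
  have hinj : ∀ c c', hS.seg c = hS.seg c' → h.seg c = h.seg c' := by
    intro c c' hcc
    have hex : ∀ b ∈ maximalSegments t, ∃ c, h.seg c = b := fun b hb => h.exists_seg_eq hb
    choose γ hγ using hex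
    -- The map of segments is well defined and surjective, between finite sets with the same number
    -- of elements.
    refine Set.inj_on_of_surj_on_of_ncard_le (t := maximalSegments fun w i => f (t w i))
      (fun b hb => hS.seg (γ b hb)) (fun b hb => hS.seg_mem _) (fun b' hb' => ?_) ?_
      (h.seg_mem c) (h.seg_mem c') ?_ h.finite_maximalSegments
    · obtain ⟨c₁, hc₁⟩ := hS.exists_seg_eq hb'
      exact ⟨h.seg c₁, h.seg_mem c₁, (himp _ _ (hγ _ _)).trans hc₁⟩
    · have h1 := h.ncard_maximalSegments
      have h2 := hS.ncard_maximalSegments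
      omega
    · exact (himp _ _ (hγ _ _)).trans (hcc.trans (himp _ _ (hγ _ _)).symm)
  refine ⟨fun c => Set.Subset.antisymm (hβ c) fun p hp => ?_, fun c c' => ⟨hinj c c', himp c c'⟩⟩
  obtain ⟨c', hc', hp'⟩ := hS.exists_mem_edge (hS.seg_mem c) hp
  rw [← hinj _ _ hc']
  exact edge_subset_spanned h f c' hp'

theorem combinatoriallyEquivalent (hf : IsSolution t t' f a) (h : NondegTiling R t)
    (ht' : ∀ w, InShapeSpace (t w) (t' w)) (ha : ∃ w, a w ≠ 0) (hx₀ : LeftOf R f x₀) :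
    CombinatoriallyEquivalent R t (fun j => f (R j)) fun w i => f (t w i) := by
  refine ⟨spanned t f, fun b hb w i hwi => ?_, fun j => ⟨hf.spanned_edge_R h ht' ha hx₀ j,
    fun p hp => ?_⟩, fun b hb hj => ?_, fun hc hnd => ?_⟩
  · rw [← (h.edge_subset_iff (c := ⟨w, i⟩) hb).1 hwi]
    exact edge_subset_spanned h f ⟨w, i⟩
  · rw [← hf.spanned_edge_R h ht' ha hx₀] at hp
    obtain ⟨c, hcs, hpc⟩ := hf.exists_mem_edge_of_mem_spanned h ht' (h.edge_R_mem j) hp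
    exact ⟨c.1, c.2, (h.edge_subset_iff (h.edge_R_mem j)).2 hcs, hpc⟩
  · obtain ⟨x, y, hxy, hcov⟩ := hf.spanned_interior h ht' ⟨hb, hj⟩
    refine ⟨x, y, hxy, fun p hp => ?_⟩
    obtain ⟨⟨c, h1, h2, h3⟩, ⟨c', h1', h2', h3'⟩⟩ := hcov p hp
    exact ⟨⟨c.1, c.2, (h.edge_subset_iff hb).2 h1, h2, h3⟩,
      ⟨c'.1, c'.2, (h.edge_subset_iff hb).2 h1', h2', h3'⟩⟩
  · have hS : NondegTiling (fun j => f (R j)) fun w i => f (t w i) :=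
      ⟨hf.isConvexPolygon_R h ht' ha hx₀, hc, hf.isTiling h ht' ha hx₀, hnd⟩
    obtain ⟨h1, h2⟩ := hf.seg_eq_iff h ht' hS
    refine ⟨⟨fun b hb => ?_, fun b hb b' hb' hbb => ?_, fun β hβ => ?_⟩, fun w b hb => ?_⟩
    · obtain ⟨c, rfl⟩ := h.exists_seg_eq hb
      rw [h1]
      exact hS.seg_mem c
    · obtain ⟨c, rfl⟩ := h.exists_seg_eq hb
      obtain ⟨c', rfl⟩ := h.exists_seg_eq hb'
      rw [h1, h1] at hbb
      exact (h2 _ _).1 hbb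
    · obtain ⟨c, rfl⟩ := hS.exists_seg_eq hβ
      exact ⟨h.seg c, h.seg_mem c, h1 c⟩
    · obtain ⟨c, rfl⟩ := h.exists_seg_eq hb
      rw [h1]
      refine exists_congr fun i => ?_
      rw [h.edge_subset_iff (c := ⟨w, i⟩) (h.seg_mem c),
        hS.edge_subset_iff (c := ⟨w, i⟩) (hS.seg_mem c), h2]

theorem isHomotheticTiling (hf : IsSolution t t' f a) (h : NondegTiling R t)
    (ht' : ∀ w, InShapeSpace (t w) (t' w)) (ha : ∃ w, a w ≠ 0) (hx₀ : LeftOf R f x₀) :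
    IsHomotheticTiling R t t' (fun j => f (R j)) a fun w i => f (t w i) := by
  refine ⟨hf.inShapeSpace_R h ht' ha hx₀, fun w => ?_, hf.isTiling h ht' ha hx₀,
    hf.combinatoriallyEquivalent h ht' ha hx₀⟩
  obtain ⟨c, hc⟩ := hf.homothetic w
  exact ⟨c, fun i => by rw [← Complex.real_smul]; exact hc i⟩

end IsSolution

end Tiling

/-! ### Every combinatorially equivalent homothetic tiling comes from a solution. -/

section Tiling

variable {W : Type*} [Fintype W] {m : W → ℕ} {k : ℕ} {R R₁ : Fin (k + 3) → ℂ}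
  {t t' s₁ : ∀ w, Fin (m w + 3) → ℂ} {a₁ : W → ℝ}

namespace NondegTiling

theorem seg_prev_eq_of_matched (h : NondegTiling R t) {c c' : Corner m} (hM : Matched t c c') :
    h.seg (prev c') = h.seg c := by
  obtain ⟨hp, r, hr, ho⟩ := hM
  refine h.seg_eq_of_ray (h.seg_mem c) (h.outVec_ne_zero c) (inv_pos.2 hr) (h.pt_mem_seg c) ?_ ?_
  · rw [← pt_next]; exact h.pt_next_mem_seg c
  · rw [edge_eq, next_prev, pt_prev, ← hp, ho, smul_neg, smul_smul, inv_mul_cancel₀ hr.ne',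
      one_smul, ← sub_eq_add_neg, segment_symm]

theorem seg_eq_seg_prev_of_isTee (h : NondegTiling R t) {p e : ℂ} (hT : IsTee R t p e)
    {c c' : Corner m} (hc : pt t c = p) (hc' : pt t c' = p) {r r' : ℝ} (hr : 0 < r) (hr' : 0 < r')
    (ho : outVec t c = r • e) (hi : inVec t c' = r' • e) : h.seg c = h.seg (prev c') := by
  obtain ⟨δ, hδ, hs⟩ := hT.line
  have hne : p - δ • e ≠ p + δ • e := by
    intro h'
    have h2 : (2 * δ) • e = 0 := by rw [two_mul, add_smul]; linear_combination -h'
    rcases smul_eq_zero.1 h2 with h3 | h3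
    · linarith
    · exact hT.ne h3
  obtain ⟨b, hb, h1, h2, -⟩ := exists_maximal hne hs
  have hpb : p ∈ b := by
    have := (convex_of_mem_maximalSegments hb).midpoint_mem h1 h2
    rwa [midpoint_sub_add] at this
  have e1 : h.seg c = b := by
    refine h.seg_eq_of_ray hb (v := δ • e) (r := r / δ) (smul_ne_zero hδ.ne' hT.ne) (by positivity)
      hpb h2 ?_
    rw [edge_eq, pt_next, hc, ho, smul_smul, div_mul_cancel₀ _ hδ.ne']
  have e2 : h.seg (prev c') = b := by
    refine h.seg_eq_of_ray hb (v := -(δ • e)) (r := r' / δ)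
      (neg_ne_zero.2 (smul_ne_zero hδ.ne' hT.ne)) (by positivity) hpb
      (by rwa [← sub_eq_add_neg]) ?_
    rw [edge_eq, next_prev, pt_prev, hc', hi, smul_neg, smul_smul, div_mul_cancel₀ _ hδ.ne',
      ← sub_eq_add_neg, segment_symm]
  rw [e1, e2]

theorem cross_outVec_of_seg_eq (h : NondegTiling R t) {c c' : Corner m} (hs : h.seg c = h.seg c') :
    cross (outVec t c) (outVec t c') = 0 := by
  have := h.outVec_cross (c := c) (x := pt t c') (y := pt t (next c')) (hs ▸ h.pt_mem_seg c')
    (hs ▸ h.pt_next_mem_seg c')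
  rwa [pt_next, add_sub_cancel_left] at this

end NondegTiling

namespace IsHomotheticTiling

omit [Fintype W] in
theorem homothetic (H : IsHomotheticTiling R t t' R₁ a₁ s₁) (w : W) :
    ∃ c : ℂ, ∀ i, s₁ w i = a₁ w • t' w i + c := by
  obtain ⟨c, hc⟩ := H.2.1 w
  exact ⟨c, fun i => by rw [Complex.real_smul]; exact hc i⟩

omit [Fintype W] in
theorem outVec_eq (H : IsHomotheticTiling R t t' R₁ a₁ s₁) (c : Corner m) :
    pt s₁ (next c) - pt s₁ c = a₁ c.1 • outVec t' c := by
  obtain ⟨v, hv⟩ := H.homothetic c.1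
  change s₁ c.1 (c.2 + 1) - s₁ c.1 c.2 = a₁ c.1 • (t' c.1 (c.2 + 1) - t' c.1 c.2)
  rw [hv, hv, smul_sub]
  ring

/-- The edges of the tiles that correspond to edges in the same segment are on a line parallel to
this segment. -/
theorem exists_line (H : IsHomotheticTiling R t t' R₁ a₁ s₁) (h : NondegTiling R t)
    (ht' : ∀ w, InShapeSpace (t w) (t' w)) {b : Set ℂ} (hb : b ∈ maximalSegments t) :
    ∃ p₀, ∀ c, h.seg c = b → ∀ z ∈ edge (s₁ c.1) c.2, cross (outVec t c) (z - p₀) = 0 := by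
  obtain ⟨⟨hR₁, r, hr, hre⟩, -, -, σ, h1, h2, h3, -⟩ := id H
  by_cases hj : ∃ j, b = edge R j
  · obtain ⟨j, rfl⟩ := hj
    refine ⟨R₁ j, fun c hc z hz => ?_⟩
    have hz' := h1 _ hb c.1 c.2 ((h.edge_subset_iff hb).2 hc) hz
    rw [(h2 j).1] at hz'
    have h4 := ((hR₁.mem_edge_iff j).1 hz').2
    have h5 := h.outVec_cross (c := c) (x := R j) (y := R (j + 1))
      (hc ▸ left_mem_segment ℝ (R j) _) (hc ▸ right_mem_segment ℝ (R j) _)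
    rw [hre, ← Complex.real_smul, cross_smul_left] at h4
    have hr0 : r j ≠ 0 := by
      rcases hr with hr | hr
      · exact (hr j).ne'
      · exact (hr j).ne
    have h6 := (mul_eq_zero.1 h4).resolve_left hr0
    obtain ⟨l, hl⟩ := exists_smul_of_cross_eq_zero (h.hR.edgeVec_ne_zero j) h6
    rw [hl, cross_smul_right]
    change cross (outVec t c) (edgeVec R j) = 0 at h5
    rw [h5, mul_zero]
  · push Not at hj
    obtain ⟨x, y, hxy, hcov⟩ := h3 b hb hj
    have hsub : ∀ c, h.seg c = b → edge (s₁ c.1) c.2 ⊆ segment ℝ x y := fun c hc =>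
      hxy ▸ h1 b hb c.1 c.2 ((h.edge_subset_iff hb).2 hc)
    refine ⟨x, fun c hc z hz => ?_⟩
    obtain ⟨γ, -, -, rfl⟩ := mem_segment_iff_add_smul.1 (hsub c hc hz)
    rw [add_sub_cancel_left, cross_smul_right]
    by_cases hxy0 : x = y
    · rw [hxy0, sub_self, cross_zero_right, mul_zero]
    -- A nondegenerate segment has a point that is no vertex of a tile. The edge covering this point
    -- is not shrunk, and it shows that the new segment is parallel to the old one.
    have hinf : ((fun θ : ℝ => x + θ • (y - x)) '' Set.Ioo 0 1).Infinite := by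
      refine (Set.Ioo_infinite one_pos).image fun θ _ θ' _ h' => ?_
      have : θ • (y - x) = θ' • (y - x) := add_left_cancel h'
      exact smul_left_injective ℝ (sub_ne_zero.2 (Ne.symm hxy0)) this
    obtain ⟨p, ⟨θ, hθ, rfl⟩, hp⟩ := hinf.exists_notMem_finite (Set.finite_range (pt s₁))
    obtain ⟨⟨w, i, hwi, -, hpi⟩, -⟩ := hcov _ (mem_segment_iff_add_smul.2 ⟨θ, hθ.1.le, hθ.2.le, rfl⟩)
    set c₀ : Corner m := ⟨w, i⟩
    have hc₀ := (h.edge_subset_iff (c := c₀) hb).1 hwi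
    have hsub₀ := hsub c₀ hc₀
    obtain ⟨α, -, -, hα⟩ := mem_segment_iff_add_smul.1
      (hsub₀ (left_mem_segment ℝ (pt s₁ c₀) (pt s₁ (next c₀))))
    obtain ⟨β, -, -, hβ⟩ := mem_segment_iff_add_smul.1
      (hsub₀ (right_mem_segment ℝ (pt s₁ c₀) (pt s₁ (next c₀))))
    have hαβ : β - α ≠ 0 := by
      intro h0
      have e : pt s₁ (next c₀) = pt s₁ c₀ := by rw [hα, hβ, sub_eq_zero.1 h0]
      have hpi' : x + θ • (y - x) ∈ segment ℝ (pt s₁ c₀) (pt s₁ (next c₀)) := hpi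
      rw [e, segment_same, Set.mem_singleton_iff] at hpi'
      exact hp ⟨c₀, hpi'.symm⟩
    have hd := H.outVec_eq c₀
    obtain ⟨q, -, -, hq⟩ := exists_shape_ratio ht' c₀.1
    have hq' : outVec t' c₀ = q c₀.2 • outVec t c₀ := hq c₀.2
    rw [hα, hβ, hq', smul_smul] at hd
    have hd' : (β - α) • (y - x) = (a₁ c₀.1 * q c₀.2) • outVec t c₀ := by
      rw [← hd, sub_smul]; ring
    have h4 := h.cross_outVec_of_seg_eq (hc.trans hc₀.symm)
    have h5 : (β - α) * cross (outVec t c) (y - x) = 0 := by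
      rw [← cross_smul_right, hd', cross_smul_right, h4, mul_zero]
    rw [(mul_eq_zero.1 h5).resolve_left hαβ, mul_zero]

theorem cross_pt (H : IsHomotheticTiling R t t' R₁ a₁ s₁) (h : NondegTiling R t)
    (ht' : ∀ w, InShapeSpace (t w) (t' w)) {c c' : Corner m} (hs : h.seg c = h.seg (prev c')) :
    cross (outVec t c) (pt s₁ c' - pt s₁ c) = 0 := by
  obtain ⟨p₀, hp₀⟩ := H.exists_line h ht' (h.seg_mem c)
  have h1 := hp₀ c rfl (pt s₁ c) (left_mem_segment ℝ _ _)
  have h2 := hp₀ (prev c') hs.symm (pt s₁ c') (by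
    have := right_mem_segment ℝ (pt s₁ (prev c')) (pt s₁ (next (prev c')))
    rw [next_prev] at this
    change pt s₁ c' ∈ segment ℝ (pt s₁ (prev c')) (pt s₁ (next (prev c')))
    rwa [next_prev])
  have h3 := h.cross_outVec_of_seg_eq hs.symm
  obtain ⟨l, hl⟩ := exists_smul_of_cross_eq_zero (h.outVec_ne_zero (prev c')) h3
  have e : pt s₁ c' - pt s₁ c = (pt s₁ c' - p₀) - (pt s₁ c - p₀) := by ring
  rw [e, cross_sub_right, h1, sub_zero, hl, cross_smul_left, h2, mul_zero]

/-- The two sides of this corner lie in two consecutive edges of `R₁`, whose lines meet only in `R₁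
j`. -/
theorem pt_eq_of_isCornerOf (H : IsHomotheticTiling R t t' R₁ a₁ s₁) (h : NondegTiling R t)
    {j : Fin (k + 3)} {c : Corner m} (hC : IsCornerOf R t j c) : pt s₁ c = R₁ j := by
  obtain ⟨⟨hR₁, -⟩, -, -, σ, h1, h2, -⟩ := id H
  have a1 : pt s₁ c ∈ edge R₁ j := by
    rw [← (h2 j).1]
    exact h1 _ (h.edge_R_mem j) c.1 c.2 ((h.edge_subset_iff (h.edge_R_mem j)).2 (h.seg_eq_edge_R hC))
      (left_mem_segment ℝ _ _)
  have a2 : pt s₁ c ∈ edge R₁ (j - 1) := by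
    rw [← (h2 (j - 1)).1]
    exact h1 _ (h.edge_R_mem (j - 1)) c.1 (c.2 - 1)
      ((h.edge_subset_iff (c := prev c) (h.edge_R_mem (j - 1))).2 (h.seg_prev_eq_edge_R hC))
      (IsConvexPolygon.vertex_mem_edge_sub_one (s₁ c.1) c.2)
  have b1 := ((hR₁.mem_edge_iff j).1 a1).2
  have b2 := ((hR₁.mem_edge_iff (j - 1)).1 a2).2
  rw [IsConvexPolygon.cross_prev] at b2
  have b3 := smul_eq_of_cross (edgeVec R₁ (j - 1)) (edgeVec R₁ j) (pt s₁ c - R₁ j)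
  rw [b2, cross_comm (pt s₁ c - R₁ j), b1, neg_zero, zero_smul, zero_smul, add_zero] at b3
  exact sub_eq_zero.1 ((smul_eq_zero.1 b3).resolve_left (hR₁.cross_edgeVec_pos j).ne')

/-- If no corner sees `x`, then at each corner `x` is on opposite sides of the two directed lines.
Matched corners share a line with reversed directions, so the sign propagates from the first
outgoing side to the last incoming side. But these are on one line with the same direction, and the
signs disagree. -/
theorem exists_sees (H : IsHomotheticTiling R t t' R₁ a₁ s₁) (h : NondegTiling R t)
    (ht' : ∀ w, InShapeSpace (t w) (t' w)) {p e : ℂ} (hT : IsTee R t p e) {x : ℂ}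
    (hx : Generic t (pt s₁) x) : ∃ c, pt t c = p ∧ CornerSees t (pt s₁) c x := by
  by_contra hn
  push Not at hn
  have hsign : ∀ c, pt t c = p →
      (0 < cross (outVec t c) (x - pt s₁ c) ↔ cross (inVec t c) (x - pt s₁ c) < 0) := by
    intro c hc
    have h1 := not_lt.1 (hn c hc)
    obtain ⟨h2, h3⟩ := hx c
    constructor
    · intro h4
      exact (not_lt.1 fun h5 => absurd (mul_pos h5 h4) (not_lt.2 h1)).lt_of_ne h2
    · intro h4
      exact (not_lt.1 fun h5 => absurd (mul_pos_of_neg_of_neg h4 h5) (not_lt.2 h1)).lt_of_ne' h3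
  obtain ⟨c₁, hc₁, r₁, hr₁, ho⟩ := hT.exists_first h
  obtain ⟨c₂, hc₂, r₂, hr₂, hi⟩ := hT.exists_last h
  have hchain := hT.chain h (fun c => 0 < cross (outVec t c) (x - pt s₁ c)) (fun c c' hc hM => by
    have hc' : pt t c' = p := hM.1 ▸ hc
    have h0 := H.cross_pt h ht' (h.seg_prev_eq_of_matched hM).symm
    have e1 : x - pt s₁ c = (x - pt s₁ c') + (pt s₁ c' - pt s₁ c) := by ring
    obtain ⟨-, r, hr, hro⟩ := hM
    have e2 : cross (outVec t c) (x - pt s₁ c) = -(r * cross (inVec t c') (x - pt s₁ c')) := by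
      rw [e1, cross_add_right, h0, add_zero, hro, cross_neg_left, cross_smul_left]
    refine propext ?_
    rw [hsign c' hc', e2]
    constructor
    · intro h'; nlinarith
    · intro h'; nlinarith [mul_pos hr (neg_pos.2 h')]) hc₁ hc₂
  have h0 := H.cross_pt h ht' (h.seg_eq_seg_prev_of_isTee hT hc₁ hc₂ hr₁ hr₂ ho hi)
  have e1 : x - pt s₁ c₁ = (x - pt s₁ c₂) + (pt s₁ c₂ - pt s₁ c₁) := by ring
  have e2 : cross (outVec t c₁) (x - pt s₁ c₁) = r₁ * cross e (x - pt s₁ c₂) := by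
    rw [e1, cross_add_right, h0, add_zero, ho, cross_smul_left]
  have h3 := hsign c₂ hc₂
  have h4 := (hx c₂).1
  rw [e2, h3, hi, cross_smul_left] at hchain
  rw [hi, cross_smul_left] at h4
  rcases lt_or_gt_of_ne (right_ne_zero_of_mul h4) with h5 | h5
  · have : 0 < r₁ * cross e (x - pt s₁ c₂) := hchain.mpr (by nlinarith)
    nlinarith
  · have : r₂ * cross e (x - pt s₁ c₂) < 0 := hchain.mp (mul_pos hr₁ h5)
    nlinarith

/-- Exactly one of the corners that correspond to the corners at a vertex in the interior of an
edge sees a given point. -/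
theorem card_sees_eq_one (H : IsHomotheticTiling R t t' R₁ a₁ s₁) (h : NondegTiling R t)
    (ht' : ∀ w, InShapeSpace (t w) (t' w)) {c : Corner m} {e : ℂ} (hT : IsTee R t (pt t c) e)
    {x : ℂ} (hx : Generic t (pt s₁) x) :
    (univ.filter fun c' => pt t c' = pt t c ∧ CornerSees t (pt s₁) c' x).card = 1 := by
  obtain ⟨⟨hR₁, r, hr, hre⟩, -, hT₁, -⟩ := id H
  have hrr : ∀ i j, 0 < r i * r j := by
    intro i j
    rcases hr with hr | hr
    · exact mul_pos (hr i) (hr j)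
    · exact mul_pos_of_neg_of_neg (hr i) (hr j)
  have hgR : ∀ j, cross (edgeVec R₁ j) (x - R₁ j) ≠ 0 := by
    intro j
    obtain ⟨c, hc⟩ := h.exists_isCornerOf j
    obtain ⟨r', hr', ho⟩ := hc.out_eq
    have h1 := (hx c).2
    rw [ho, cross_smul_left, H.pt_eq_of_isCornerOf h hc] at h1
    rw [hre, ← Complex.real_smul, cross_smul_left]
    exact mul_ne_zero (left_ne_zero_of_mul (hrr j j).ne') (right_ne_zero_of_mul h1)
  have hB : (univ.filter fun j => BoundarySees R j (R₁ j) x).card =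
      k + 1 + 2 * if x ∈ interior (region R₁) then 1 else 0 := by
    rw [← hR₁.card_sees (a := 1) (c := 0) (s := R₁) (fun i => by simp) hgR]
    congr 1
    ext j
    rw [mem_filter, mem_filter]
    simp only [mem_univ, true_and, BoundarySees, Sees, hre, ← Complex.real_smul,
      cross_smul_left]
    have e : r (j - 1) * cross (edgeVec R (j - 1)) (x - R₁ j) *
        (r j * cross (edgeVec R j) (x - R₁ j)) = (r (j - 1) * r j) *
        (cross (edgeVec R (j - 1)) (x - R₁ j) * cross (edgeVec R j) (x - R₁ j)) := by ring
    rw [e, mul_pos_iff_of_pos_left (hrr _ _)]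
  -- Only disjointness of the tiles and containment in `R₁` are used.
  have hcount : (univ.filter fun w => x ∈ interior (region (s₁ w))).card ≤
      if x ∈ interior (region R₁) then 1 else 0 := by
    split_ifs with hxR
    · refine Finset.card_le_one.2 fun w hw w' hw' => ?_
      by_contra hne
      exact Set.disjoint_left.1 (hT₁.2 w w' hne) (mem_filter.1 hw).2 (mem_filter.1 hw').2
    · rw [Nat.le_zero, Finset.card_eq_zero, Finset.filter_eq_empty_iff]
      intro w _ hw
      exact hxR (interior_mono ((Set.subset_iUnion (fun w => region (s₁ w)) w).trans hT₁.1.subset)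
        hw)
  have hN : (univ.filter fun j => BoundarySees R j (R₁ j) x).card +
      (univ.filter fun j => ¬ BoundarySees R j (R₁ j) x).card = k + 3 := by
    rw [Finset.card_filter_add_card_filter_not, Finset.card_univ, Fintype.card_fin]
  have htot := NondegTiling.card_cornerSees ht' H.homothetic hx
  have hle : ∀ p ∈ verts t, 1 ≤ (univ.filter fun c => pt t c = p ∧ CornerSees t (pt s₁) c x).card +
      (univ.filter fun j => R j = p ∧ ¬ BoundarySees R j (R₁ j) x).card := by
    intro p hp
    obtain ⟨c, -, rfl⟩ := mem_image.1 hp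
    rcases h.tee_or_corner c with ⟨e, hT⟩ | ⟨j, hC⟩
    · obtain ⟨c', h1, h2⟩ := H.exists_sees h ht' hT hx
      have : 0 < (univ.filter fun c' => pt t c' = pt t c ∧ CornerSees t (pt s₁) c' x).card :=
        Finset.card_pos.2 ⟨c', mem_filter.2 ⟨mem_univ _, h1, h2⟩⟩
      omega
    · have e := NondegTiling.cornerSees_iff_of_isCornerOf hC (pt s₁) x
      rw [H.pt_eq_of_isCornerOf h hC] at e
      obtain ⟨e1, e2⟩ := h.corner_fiber hC (fun j => ¬ BoundarySees R j (R₁ j) x)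
        (fun c => CornerSees t (pt s₁) c x)
      rw [hC.pt_eq, e1, e2]
      by_cases hS : BoundarySees R j (R₁ j) x
      · rw [if_pos (e.2 hS)]; omega
      · rw [if_pos hS]; omega
  -- The count by tiles and Euler's formula bound the total by the number of vertices. As each
  -- vertex contributes at least 1, it contributes exactly 1.
  have hsum : ∑ p ∈ verts t, ((univ.filter fun c => pt t c = p ∧ CornerSees t (pt s₁) c x).card +
      (univ.filter fun j => R j = p ∧ ¬ BoundarySees R j (R₁ j) x).card) ≤ ∑ p ∈ verts t, 1 := by
    rw [Finset.sum_add_distrib, ← NondegTiling.sum_card_cornerSees, h.sum_boundary, htot,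
      ← Finset.card_eq_sum_ones, h.card_verts]
    omega
  have heq := (Finset.sum_eq_sum_iff_of_le hle).1 (le_antisymm (Finset.sum_le_sum hle) hsum)
    (pt t c) (pt_mem_verts t c)
  rw [h.boundary_fiber_tee hT] at heq
  exact heq.symm

/-- The facing sides of matched corners lie on a common line. If the corners were at different
points of it, both would see some points near the midpoint, but only one corner of the group may see
a point. -/
theorem pt_eq_of_matched (H : IsHomotheticTiling R t t' R₁ a₁ s₁) (h : NondegTiling R t)
    (ht' : ∀ w, InShapeSpace (t w) (t' w)) {c c' : Corner m} {e : ℂ} (hT : IsTee R t (pt t c) e)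
    (hM : Matched t c c') : pt s₁ c = pt s₁ c' := by
  set ρ := outVec t c with hρ
  have hρ0 : ρ ≠ 0 := h.outVec_ne_zero c
  have hI := cross_I_mul_pos hρ0
  obtain ⟨τ, hτ⟩ := exists_smul_of_cross_eq_zero hρ0
    (H.cross_pt h ht' (h.seg_prev_eq_of_matched hM).symm)
  obtain ⟨hp, r, hr, ho⟩ := hM
  by_contra hne
  have hτ0 : τ ≠ 0 := by
    rintro rfl
    rw [zero_smul, sub_eq_zero] at hτ
    exact hne hτ.symm
  have hcone := h.cone_pos c
  have hcone' : 0 < cross (outVec t c') ρ := by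
    have := h.cone_pos c'
    rw [hρ, ho, cross_neg_right, cross_smul_right, cross_comm]
    nlinarith
  set n := Complex.I * ρ with hn
  obtain ⟨η, ⟨h1, h2⟩, hη⟩ := (((eventually_cross_add_smul_pos (u := inVec t c)
    (ρ := (1 / 2 : ℝ) • ρ) n (by rw [cross_smul_right]; positivity)).and
    (eventually_cross_add_smul_pos (u := outVec t c')
    (ρ := (1 / 2 : ℝ) • ρ) (-n) (by rw [cross_smul_right]; positivity))).and
    self_mem_nhdsWithin).exists
  have hη : 0 < η := hη
  have hττ : 0 < τ * τ := mul_self_pos.2 hτ0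
  -- The midpoint of the two corners, pushed off the common line into the cone of `c`, or into the
  -- opposite cone if `τ < 0`; seen from `c'` the same displacement leads into the opposite cone or
  -- the cone.
  set x₁ : ℂ := pt s₁ c + τ • ((1 / 2 : ℝ) • ρ + η • n) with hx₁
  have d1 : x₁ - pt s₁ c = τ • ((1 / 2 : ℝ) • ρ + η • n) := by rw [hx₁, add_sub_cancel_left]
  have d2 : x₁ - pt s₁ c' = -(τ • ((1 / 2 : ℝ) • ρ + η • -n)) := by
    have : x₁ - pt s₁ c' = (x₁ - pt s₁ c) - (pt s₁ c' - pt s₁ c) := by ring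
    rw [this, d1, hτ]
    simp only [Complex.real_smul]
    push_cast
    ring
  have s1 : CornerSees t (pt s₁) c x₁ := by
    rw [CornerSees, d1, ← hρ, cross_smul_right, cross_smul_right]
    have e1 : cross ρ ((1 / 2 : ℝ) • ρ + η • n) = η * cross ρ n := by
      rw [cross_add_right, cross_smul_right, cross_self, mul_zero, zero_add, cross_smul_right]
    rw [e1]
    have := mul_pos hττ (mul_pos h1 (mul_pos hη hI))
    linarith
  have s2 : CornerSees t (pt s₁) c' x₁ := by
    have e0 : inVec t c' = -(r⁻¹ • ρ) := by
      rw [hρ, ho, smul_neg, neg_neg, smul_smul, inv_mul_cancel₀ hr.ne', one_smul]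
    have e1 : cross ρ ((1 / 2 : ℝ) • ρ + η • -n) = -(η * cross ρ n) := by
      rw [cross_add_right, cross_smul_right, cross_self, mul_zero, zero_add, cross_smul_right,
        cross_neg_right, mul_neg]
    rw [CornerSees, d2, e0, cross_neg_left, cross_neg_right, cross_neg_right, neg_neg,
      cross_smul_left, cross_smul_right, cross_smul_right, e1]
    have := mul_pos hττ (mul_pos h2 (mul_pos (inv_pos.2 hr) (mul_pos hη hI)))
    linarith
  have hopen : ∀ c, IsOpen {x | CornerSees t (pt s₁) c x} := fun c =>
    isOpen_lt continuous_const (((continuous_cross _).comp (by fun_prop)).mul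
      ((continuous_cross _).comp (by fun_prop)))
  obtain ⟨x, hx, hg⟩ := h.exists_generic (pt s₁) ((hopen c).inter (hopen c')) ⟨x₁, s1, s2⟩
  obtain ⟨c₀, hc₀⟩ := Finset.card_eq_one.1 (H.card_sees_eq_one h ht' hT hg)
  have m1 : c ∈ ({c₀} : Finset (Corner m)) := hc₀ ▸ mem_filter.2 ⟨mem_univ _, rfl, hx.1⟩
  have m2 : c' ∈ ({c₀} : Finset (Corner m)) := hc₀ ▸ mem_filter.2 ⟨mem_univ _, hp.symm, hx.2⟩
  exact hne (congrArg (pt s₁) ((mem_singleton.1 m1).trans (mem_singleton.1 m2).symm))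

/-- Matched corners stay together, hence so do all corners at a vertex, and their positions define a
map of the vertices. -/
theorem exists_isSolution (H : IsHomotheticTiling R t t' R₁ a₁ s₁) (h : NondegTiling R t)
    (ht' : ∀ w, InShapeSpace (t w) (t' w)) :
    ∃ g : ℂ → ℂ, IsSolution t t' g a₁ ∧ (∀ c, g (pt t c) = pt s₁ c) ∧ ∀ j, g (R j) = R₁ j := by
  have hpt : ∀ c c', pt t c = pt t c' → pt s₁ c = pt s₁ c' := by
    intro c c' hcc
    rcases h.tee_or_corner c with ⟨e, hT⟩ | ⟨j, hC⟩
    · refine hT.chain h (pt s₁) (fun d d' hd hM => ?_) rfl hcc.symm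
      rw [← hd] at hT
      exact H.pt_eq_of_matched h ht' hT hM
    · rw [h.eq_of_isCornerOf hC (c' := c') (hcc ▸ hC.pt_eq)]
  have hex : ∀ z, ∃ y, ∀ c, pt t c = z → y = pt s₁ c := by
    intro z
    by_cases hz : ∃ c, pt t c = z
    · obtain ⟨c, rfl⟩ := hz
      exact ⟨pt s₁ c, fun c' hc' => hpt c c' hc'.symm⟩
    · exact ⟨0, fun c hc => absurd ⟨c, hc⟩ hz⟩
  choose g hg using hex
  have hg' : ∀ c, g (pt t c) = pt s₁ c := fun c => hg _ c rfl
  refine ⟨g, fun c => ?_, hg', fun j => ?_⟩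
  · rw [hg', hg']
    exact H.outVec_eq c
  · obtain ⟨c, hc⟩ := h.exists_isCornerOf j
    rw [← hc.pt_eq, hg', H.pt_eq_of_isCornerOf h hc]

end IsHomotheticTiling

end Tiling

end PolygonTiling

theorem mainTheorem1 {W : Type*} [Finite W] {m : W → ℕ} {k : ℕ}
    (R : Fin (k + 3) → ℂ) (t t' : ∀ w, Fin (m w + 3) → ℂ)
    (hR : PolygonTiling.IsConvexPolygon R)
    (ht : ∀ w, PolygonTiling.IsConvexPolygon (t w))
    (hT : PolygonTiling.IsTiling R t)
    (hnd : PolygonTiling.IsNondegenerate R t)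
    (ht' : ∀ w, PolygonTiling.InShapeSpace (t w) (t' w)) :
    ∃ (R' : Fin (k + 3) → ℂ) (a : W → ℝ) (s : ∀ w, Fin (m w + 3) → ℂ),
      PolygonTiling.IsHomotheticTiling R t t' R' a s ∧
      -- tile corners that coincide in the old tiling coincide in the new one
      (∀ w i w' i', t w i = t w' i' → s w i = s w' i') ∧
      -- uniqueness up to homothety
      ∀ (R₁ : Fin (k + 3) → ℂ) (a₁ : W → ℝ) (s₁ : ∀ w, Fin (m w + 3) → ℂ),
        PolygonTiling.IsHomotheticTiling R t t' R₁ a₁ s₁ →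
        ∃ (l : ℝ) (v : ℂ), l ≠ 0 ∧
          (∀ j, R₁ j = (l : ℂ) * R' j + v) ∧
          (∀ w, a₁ w = l * a w) ∧
          ∀ w i, s₁ w i = (l : ℂ) * s w i + v := by
  open PolygonTiling in
  obtain ⟨_⟩ := nonempty_fintype W
  have h : NondegTiling R t := ⟨hR, ht, hT, hnd⟩
  obtain ⟨f, a, hf, ha, x₀, hx₀⟩ : ∃ (f : ℂ → ℂ) (a : W → ℝ), IsSolution t t' f a ∧
      (∃ w, a w ≠ 0) ∧ ∃ x₀, LeftOf R f x₀ := by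
    obtain ⟨f, a, hf, w, hw⟩ := h.exists_isSolution ht'
    obtain ⟨x, hx | hx⟩ := hf.exists_leftOf h ht' ⟨w, hw⟩
    · exact ⟨f, a, hf, ⟨w, hw⟩, x, hx⟩
    -- The sign of the solution is reversed if its boundary runs the wrong way round.
    · exact ⟨_, _, hf.neg, ⟨w, neg_ne_zero.2 hw⟩, x, hx⟩
  refine ⟨fun j => f (R j), a, fun w i => f (t w i), hf.isHomotheticTiling h ht' ha hx₀,
    fun w i w' i' hww => congrArg f hww, fun R₁ a₁ s₁ H => ?_⟩
  obtain ⟨g, hg, hgs, hgR⟩ := H.exists_isSolution h ht'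
  obtain ⟨l, hl, hlg⟩ := hf.proportional hg h ht' ha
  obtain ⟨c₀, hc₀⟩ := h.exists_isCornerOf 0
  have hv : ∀ c, g (pt t c) = (l : ℂ) * f (pt t c) + (g (R 0) - l • f (R 0)) := fun c => by
    have := hlg c c₀
    rw [hc₀.pt_eq] at this
    rw [← this, Complex.real_smul]
    ring
  refine ⟨l, g (R 0) - l • f (R 0), ?_, fun j => ?_, hl, fun w i => ?_⟩
  · rintro rfl
    -- With ratio zero all vertices would coincide, including two corners of the convex polygon
    -- `R₁`.
    have h0 : ∀ w, a₁ w = 0 := fun w => by rw [hl, zero_mul]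
    obtain ⟨c₁, hc₁⟩ := h.exists_isCornerOf 1
    have := hg.eq_of_zero h h0 c₁ c₀
    rw [hc₁.pt_eq, hc₀.pt_eq, hgR, hgR] at this
    exact one_ne_zero (H.1.1.injective this)
  · obtain ⟨c, hc⟩ := h.exists_isCornerOf j
    have := hv c
    rwa [hc.pt_eq, hgR] at this
  · have := hv ⟨w, i⟩
    rwa [hgs] at this
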